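/- **Theorem (Soundness of bisimilarity for the concurrent pattern calculus CPC).** Bisimilarity is contained in barbed congruence: for all CPC processes $P$ and $Q$, if $P\sim Q$ then $P\simeq Q$. The notions are the following. *Syntax.* Fix an infinite set of names. Patterns are $p ::= \lambda x \mid x \mid \ulcorner x\urcorner \mid p\bullet p$ (binding, variable and protected names, compounds). Write $\mathsf{bn}(p),\mathsf{vn}(p),\mathsf{pn}(p)$ for the sets of binding, variable and protected names of $p$, and $\mathsf{fn}(p)=\mathsf{vn}(p)\cup\mathsf{pn}(p)$. All patterns are well formed: their binding names are pairwise distinct and different from the free ones. A pattern is communicable if it contains only variable names and compounds. Processes are $P ::= 0 \mid P|P \mid {!P} \mid (\nu x)P \mid p\to P$, where $(\nu x)P$ binds $x$ in $P$ and $p\to P$ binds $\mathsf{bn}(p)$ in $P$; $\mathsf{fn}(P)$ is the set of free names of $P$. Processes are taken up to $\alpha$-conversion. *Substitutions.* A substitution $\sigma$ is a partial function with finite domain from names to communicable patterns; $\mathsf{fn}(\sigma)$ is the union of $\mathsf{fn}(\sigma(x))$ for $x\in\mathsf{dom}(\sigma)$. It acts without capture on the free names of patterns and processes (fixing the names outside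 its domain), with $\sigma\ulcorner x\urcorner=\ulcorner\sigma(x)\urcorner$ where $\ulcorner p\bullet q\urcorner=\ulcorner p\urcorner\bullet\ulcorner q\urcorner$; and $\hat\sigma p$ is the result of replacing every $\lambda x$ in $p$ with $x\in\mathsf{dom}(\sigma)$ by $\sigma(x)$. *Unification* $\{p\|q\}$ is the partial function with $\{x\|x\}=\{x\|\ulcorner x\urcorner\}=\{\ulcorner x\urcorner\|x\}=\{\ulcorner x\urcorner\|\ulcorner x\urcorner\}=(\emptyset,\emptyset)$; $\{\lambda x\|q\}=(\{q/x\},\emptyset)$ if $q$ is communicable; $\{p\|\lambda x\}=(\emptyset,\{p/x\})$ if $p$ is communicable; $\{p_1\bullet p_2\|q_1\bullet q_2\}=(\sigma_1\cup\sigma_2,\rho_1\cup\rho_2)$ if $\{p_i\|q_i\}=(\sigma_i,\rho_i)$ for $i=1,2$; undefined otherwise. *Reduction.* Structural congruence $\equiv$ is the least congruence containing $\alpha$-conversion and $P|0\equiv P$, $P|Q\equiv Q|P$, $P|(Q|R)\equiv(P|Q)|R$, $(\nu n)0\equiv 0$, $(\nu n)(\nu m)P\equiv(\nu m)(\nu n)P$,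 $!P\equiv P|{!P}$, and $P|(\nu n)Q\equiv(\nu n)(P|Q)$ if $n\notin\mathsf{fn}(P)$. Reduction $\mapsto$ is the least relation with $(p\to P)|(q\to Q)\mapsto \sigma P|\rho Q$ whenever $\{p\|q\}=(\sigma,\rho)$ that is closed under parallel composition, restriction and $\equiv$. *Barbed congruence.* $P\downarrow_{\tilde m}$ means that $P\equiv(\nu\tilde n)(p\to P'\,|\,P'')$ for some $\tilde n,p,P',P''$ with $\mathsf{pn}(p)\cap\tilde n=\emptyset$ and $\tilde m=\mathsf{fn}(p)\setminus\tilde n$. Barbed congruence $\simeq$ is the largest binary relation $\mathcal R$ on processes that is symmetric, barb preserving (if $P\,\mathcal R\,Q$ and $P\downarrow_{\tilde m}$ then $Q\downarrow_{\tilde m}$), reduction closed (if $P\,\mathcal R\,Q$ and $P\mapsto P'$ then $Q\mapsto Q'$ with $P'\,\mathcal R\,Q'$ for some $Q'$) and context closed (if $P\,\mathcal R\,Q$ then $C[P]\,\mathcal R\,C[Q]$ for every CPC context $C$, i.e. every process with a hole, which may capture names). *Transitions.* Labels are $\mu ::= \tau\mid(\nu\tilde n)p$ with $\tilde n$ a finite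 set of names; $\mathsf{names}(\tau)=\emptyset$ and $\mathsf{names}((\nu\tilde n)p)=\tilde n\cup\mathsf{bn}(p)\cup\mathsf{fn}(p)$. The transitions are those derivable by the rules - (case) $(p\to P)\xrightarrow{p}P$; - (resnon) if $P\xrightarrow{\mu}P'$ and $n\notin\mathsf{names}(\mu)$ then $(\nu n)P\xrightarrow{\mu}(\nu n)P'$; - (open) if $P\xrightarrow{(\nu\tilde n)p}P'$ and $m\in\mathsf{vn}(p)\setminus(\tilde n\cup\mathsf{pn}(p)\cup\mathsf{bn}(p))$ then $(\nu m)P\xrightarrow{(\nu\tilde n\cup\{m\})p}P'$; - (unify) if $P\xrightarrow{(\nu\tilde m)p}P'$, $Q\xrightarrow{(\nu\tilde n)q}Q'$, $\{p\|q\}=(\sigma,\rho)$ and $\tilde m\cap\mathsf{fn}(Q)=\tilde n\cap\mathsf{fn}(P)=\tilde m\cap\tilde n=\emptyset$ then $P|Q\xrightarrow{\tau}(\nu\tilde m\cup\tilde n)(\sigma P'|\rho Q')$, where the order in which the names of $\tilde m\cup\tilde n$ are restricted is arbitrary; - (parint) if $P\xrightarrow{\tau}P'$ then $P|Q\xrightarrow{\tau}P'|Q$,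 and symmetrically; - (parext) if $P\xrightarrow{(\nu\tilde n)p}P'$ and $(\tilde n\cup\mathsf{bn}(p))\cap\mathsf{fn}(Q)=\emptyset$ then $P|Q\xrightarrow{(\nu\tilde n)p}P'|Q$, and symmetrically; - (rep) if $!P|P\xrightarrow{\mu}P'$ then $!P\xrightarrow{\mu}P'$. *Bisimilarity.* A match $(p,\sigma)$ is a pattern and a substitution with $\mathsf{bn}(p)=\mathsf{dom}(\sigma)$. Compatibility of matches, $p,\sigma\ll q,\rho$, is defined inductively by: $p,\sigma\ll\lambda y,\{\hat\sigma p/y\}$ if $\mathsf{fn}(p)=\emptyset$; $n,\emptyset\ll n,\emptyset$; $\ulcorner n\urcorner,\emptyset\ll\ulcorner n\urcorner,\emptyset$; $\ulcorner n\urcorner,\emptyset\ll n,\emptyset$; and $p_1\bullet p_2,\sigma_1\cup\sigma_2\ll q_1\bullet q_2,\rho_1\cup\rho_2$ if $p_i,\sigma_i\ll q_i,\rho_i$ for $i=1,2$. A symmetric relation $\mathcal R$ on processes is a bisimulation if, for all $P\,\mathcal R\,Q$ and $P\xrightarrow{\mu}P'$: if $\mu=\tau$ then $Q\xrightarrow{\tau}Q'$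 for some $Q'$ with $P'\,\mathcal R\,Q'$; if $\mu=(\nu\tilde n)p$ and $(\mathsf{bn}(p)\cup\tilde n)\cap\mathsf{fn}(Q)=\emptyset$ then, for every match $(p,\sigma)$ with $\mathsf{fn}(\sigma)\cap\tilde n=\emptyset$, there are a match $(q,\rho)$ and $Q'$ with $p,\sigma\ll q,\rho$, $Q\xrightarrow{(\nu\tilde n)q}Q'$ and $\sigma P'\,\mathcal R\,\rho Q'$. Bisimilarity $\sim$ is the largest bisimulation $\mathcal R$ that is closed under substitutions ($P\,\mathcal R\,Q$ implies $\sigma P\,\mathcal R\,\sigma Q$ for every $\sigma$). -/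

import Mathlib

universe u

namespace CPC

/-! ## Patterns and communicable patterns

`CPat V` is the type of communicable patterns over the names `V`: those built from variable names
and compounds only. `Pat V B` is the type of patterns with free names in `V` and binding names in
`B`. The patterns of the calculus over a set of names `N` are the elements of `Pat N N`. -/

inductive CPat (V : Type u) : Type u
  | name (x : V) : CPat V
  | comp (c d : CPat V) : CPat V

inductive Pat (V : Type u) (B : Type u) : Type u
  | bind (x : B) : Pat V B
  | var (x : V) : Pat V B
  | prot (x : V) : Pat V B
  | comp (p q : Pat V B) : Pat V B

namespace CPat

variable {V W B : Type u}

def map (f : V → W) : CPat V → CPat W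
  | name x => name (f x)
  | comp c d => comp (c.map f) (d.map f)

def fn : CPat V → Set V
  | name x => {x}
  | comp c d => c.fn ∪ d.fn

/-- A communicable pattern as a pattern. -/
def toPat : CPat V → Pat V B
  | name x => Pat.var x
  | comp c d => Pat.comp c.toPat d.toPat

/-- The protection `⌜c⌝` of a communicable pattern: `⌜c • d⌝ = ⌜c⌝ • ⌜d⌝`. -/
def toProt : CPat V → Pat V B
  | name x => Pat.prot x
  | comp c d => Pat.comp c.toProt d.toProt

end CPat

namespace Pat

variable {V W B C : Type u}

/-- Variable names. -/
def vn : Pat V B → Set V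
  | bind _ => ∅
  | var x => {x}
  | prot _ => ∅
  | comp p q => p.vn ∪ q.vn

/-- Protected names. -/
def pn : Pat V B → Set V
  | bind _ => ∅
  | var _ => ∅
  | prot x => {x}
  | comp p q => p.pn ∪ q.pn

/-- Binding names, listed from left to right. -/
def binders : Pat V B → List B
  | bind x => [x]
  | var _ => []
  | prot _ => []
  | comp p q => p.binders ++ q.binders

/-- Binding names. -/
def bn (p : Pat V B) : Set B := {x | x ∈ p.binders}

/-- Free names. -/
def fn (p : Pat V B) : Set V := p.vn ∪ p.pn

/-- A pattern is well formed if its binding names are pairwise distinct and different from the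
free ones. -/
def WellFormed (p : Pat V V) : Prop := p.binders.Nodup ∧ Disjoint p.bn p.fn

/-- Replace every free name `x` by `σ x`; a protected name `⌜x⌝` becomes `⌜σ x⌝`. -/
def subst (σ : V → CPat W) : Pat V B → Pat W B
  | bind x => bind x
  | var x => (σ x).toPat
  | prot x => (σ x).toProt
  | comp p q => comp (p.subst σ) (q.subst σ)

/-- Forget the binding names, keeping their positions. -/
def erase : Pat V B → Pat V PUnit
  | bind _ => bind PUnit.unit
  | var x => var x
  | prot x => prot x
  | comp p q => comp p.erase q.erase

theorem length_binders_erase (p : Pat V B) : p.erase.binders.length = p.binders.length := by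
  induction p with
  | bind _ => rfl
  | var _ => rfl
  | prot _ => rfl
  | comp p q hp hq => simp [erase, binders, hp, hq]

theorem binders_toPat (c : CPat V) : (c.toPat : Pat V B).binders = [] := by
  induction c with
  | name _ => rfl
  | comp c d hc hd => simp [CPat.toPat, binders, hc, hd]

theorem binders_toProt (c : CPat V) : (c.toProt : Pat V B).binders = [] := by
  induction c with
  | name _ => rfl
  | comp c d hc hd => simp [CPat.toProt, binders, hc, hd]

theorem binders_subst (σ : V → CPat W) (p : Pat V B) : (p.subst σ).binders = p.binders := by
  induction p with
  | bind _ => rfl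
  | var x => exact binders_toPat _
  | prot x => exact binders_toProt _
  | comp p q hp hq => simp [subst, binders, hp, hq]

end Pat

/-! ## Processes up to alpha-conversion

`Proc V` is the type of processes with free names in `V`, taken up to alpha-conversion: bound
names are anonymous. The body of a restriction has one additional name `Sum.inr 0`. The body of a
case whose pattern has `m` binding names has the additional names `Sum.inr 0, …, Sum.inr (m - 1)`,
where `Sum.inr i` stands for the `i`-th binding name of the pattern from left to right. The
operators of the calculus with named binders, `(ν x) P` and `p → P`, are `Proc.new` and
`Proc.pre` below; everything that follows is stated with these two, and alpha-convertible
processes are equal. -/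

inductive Proc : Type u → Type (u + 1)
  | zero {V : Type u} : Proc V
  | par {V : Type u} (P Q : Proc V) : Proc V
  | rep {V : Type u} (P : Proc V) : Proc V
  | res {V : Type u} (P : Proc (V ⊕ Fin 1)) : Proc V
  | case {V : Type u} {m : ℕ} (p : Pat V PUnit) (hp : p.binders.length = m)
      (P : Proc (V ⊕ Fin m)) : Proc V

/-- Extend a substitution to the scope of a binder, without capture. -/
def lift {V W : Type u} {m : ℕ} (σ : V → CPat W) : V ⊕ Fin m → CPat (W ⊕ Fin m)
  | Sum.inl x => (σ x).map Sum.inl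
  | Sum.inr i => CPat.name (Sum.inr i)

namespace Proc

/-- Free names. -/
def fn : {V : Type u} → Proc V → Set V
  | _, zero => ∅
  | _, par P Q => P.fn ∪ Q.fn
  | _, rep P => P.fn
  | _, res P => {x | Sum.inl x ∈ P.fn}
  | _, case p _ P => p.fn ∪ {x | Sum.inl x ∈ P.fn}

/-- Capture-avoiding simultaneous replacement of every free name `x` by `σ x`. -/
def subst : {V W : Type u} → (V → CPat W) → Proc V → Proc W
  | _, _, _, zero => zero
  | _, _, σ, par P Q => par (P.subst σ) (Q.subst σ)
  | _, _, σ, rep P => rep (P.subst σ)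
  | _, _, σ, res P => res (P.subst (lift σ))
  | _, _, σ, case p hp P =>
      case (p.subst σ) ((congrArg List.length (Pat.binders_subst σ p)).trans hp)
        (P.subst (lift σ))

end Proc

variable {N : Type u} [DecidableEq N]

/-- A name in the list `xs` becomes the bound name given by its position, every other name
remains free. -/
def closeName (xs : List N) (y : N) : N ⊕ Fin xs.length :=
  if h : y ∈ xs then Sum.inr ⟨xs.idxOf y, List.idxOf_lt_length_iff.2 h⟩ else Sum.inl y

namespace Proc

/-- Bind the names in `xs`. -/
def close (xs : List N) (P : Proc N) : Proc (N ⊕ Fin xs.length) :=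
  P.subst fun y => CPat.name (closeName xs y)

/-- The restriction `(ν x) P`. -/
def new (x : N) (P : Proc N) : Proc N := res (close [x] P)

/-- The case `p → P`: the binding names of `p` bind their free occurrences in `P`. -/
def pre (p : Pat N N) (P : Proc N) : Proc N :=
  case p.erase (Pat.length_binders_erase p) (close p.binders P)

/-- `(ν x₁) … (ν xₖ) P`. -/
def news (xs : List N) (P : Proc N) : Proc N := xs.foldr new P

end Proc

/-! ## Substitutions, unification and compatibility -/

/-- A substitution is a partial function with finite domain from names to communicable patterns. -/
abbrev Sub (N : Type u) : Type u := Finmap fun _ : N => CPat N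

namespace Sub

def dom (σ : Sub N) : Set N := {x | x ∈ σ}

def fn (σ : Sub N) : Set N := {y | ∃ x c, σ.lookup x = some c ∧ y ∈ c.fn}

/-- The value of `σ` at a name; names outside the domain are fixed. -/
def app (σ : Sub N) (x : N) : CPat N := (σ.lookup x).getD (CPat.name x)

/-- The application `σ P`. -/
def onProc (σ : Sub N) (P : Proc N) : Proc N := P.subst σ.app

/-- `σ̂ p`: the action of `σ` on the binding names of `p`. -/
def hat (σ : Sub N) : Pat N N → Pat N N
  | Pat.bind x => ((σ.lookup x).map CPat.toPat).getD (Pat.bind x)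
  | Pat.var x => Pat.var x
  | Pat.prot x => Pat.prot x
  | Pat.comp p q => Pat.comp (hat σ p) (hat σ q)

end Sub

/-- `Unify p q σ ρ` is `{p ‖ q} = (σ, ρ)`. -/
inductive Unify : Pat N N → Pat N N → Sub N → Sub N → Prop
  | var_var (x : N) : Unify (Pat.var x) (Pat.var x) ∅ ∅
  | var_prot (x : N) : Unify (Pat.var x) (Pat.prot x) ∅ ∅
  | prot_var (x : N) : Unify (Pat.prot x) (Pat.var x) ∅ ∅
  | prot_prot (x : N) : Unify (Pat.prot x) (Pat.prot x) ∅ ∅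
  | bind_left (x : N) (c : CPat N) : Unify (Pat.bind x) c.toPat (Finmap.singleton x c) ∅
  | bind_right (x : N) (c : CPat N) : Unify c.toPat (Pat.bind x) ∅ (Finmap.singleton x c)
  | comp {p₁ p₂ q₁ q₂ : Pat N N} {σ₁ σ₂ ρ₁ ρ₂ : Sub N} :
      Unify p₁ q₁ σ₁ ρ₁ → Unify p₂ q₂ σ₂ ρ₂ →
      Unify (Pat.comp p₁ p₂) (Pat.comp q₁ q₂) (σ₁ ∪ σ₂) (ρ₁ ∪ ρ₂)

/-- `(p, σ)` is a match. -/
def IsMatch (p : Pat N N) (σ : Sub N) : Prop := p.bn = σ.dom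

/-- `Compat p σ q ρ` is `p, σ ≪ q, ρ`. In the first rule `c` is the pattern `σ̂ p`, which is
communicable since `p` has no free names and `(p, σ)` is a match. -/
inductive Compat : Pat N N → Sub N → Pat N N → Sub N → Prop
  | bind {p : Pat N N} {σ : Sub N} {c : CPat N} (y : N) :
      p.fn = ∅ → IsMatch p σ → σ.hat p = c.toPat →
      Compat p σ (Pat.bind y) (Finmap.singleton y c)
  | var (n : N) : Compat (Pat.var n) ∅ (Pat.var n) ∅
  | prot (n : N) : Compat (Pat.prot n) ∅ (Pat.prot n) ∅
  | prot_var (n : N) : Compat (Pat.prot n) ∅ (Pat.var n) ∅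
  | comp {p₁ p₂ q₁ q₂ : Pat N N} {σ₁ σ₂ ρ₁ ρ₂ : Sub N} :
      Compat p₁ σ₁ q₁ ρ₁ → Compat p₂ σ₂ q₂ ρ₂ →
      Compat (Pat.comp p₁ p₂) (σ₁ ∪ σ₂) (Pat.comp q₁ q₂) (ρ₁ ∪ ρ₂)

/-! ## Structural congruence, reduction and barbed congruence -/

/-- Structural congruence; alpha-conversion is included, being equality. -/
inductive Struct : Proc N → Proc N → Prop
  | refl (P : Proc N) : Struct P P
  | symm {P Q : Proc N} : Struct P Q → Struct Q P
  | trans {P Q R : Proc N} : Struct P Q → Struct Q R → Struct P R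
  | par_congr {P P' Q Q' : Proc N} : Struct P P' → Struct Q Q' → Struct (P.par Q) (P'.par Q')
  | rep_congr {P P' : Proc N} : Struct P P' → Struct P.rep P'.rep
  | new_congr (n : N) {P P' : Proc N} : Struct P P' → Struct (Proc.new n P) (Proc.new n P')
  | pre_congr (p : Pat N N) {P P' : Proc N} : p.WellFormed → Struct P P' →
      Struct (Proc.pre p P) (Proc.pre p P')
  | par_zero (P : Proc N) : Struct (P.par Proc.zero) P
  | par_comm (P Q : Proc N) : Struct (P.par Q) (Q.par P)
  | par_assoc (P Q R : Proc N) : Struct (P.par (Q.par R)) ((P.par Q).par R)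
  | new_zero (n : N) : Struct (Proc.new n Proc.zero) Proc.zero
  | new_comm (n m : N) (P : Proc N) :
      Struct (Proc.new n (Proc.new m P)) (Proc.new m (Proc.new n P))
  | rep_unfold (P : Proc N) : Struct P.rep (P.par P.rep)
  | scope (n : N) (P Q : Proc N) : n ∉ P.fn →
      Struct (P.par (Proc.new n Q)) (Proc.new n (P.par Q))

/-- Reduction `P ↦ P'`. -/
inductive Red : Proc N → Proc N → Prop
  | comm {p q : Pat N N} {σ ρ : Sub N} (P Q : Proc N) :
      p.WellFormed → q.WellFormed → Unify p q σ ρ →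
      Red ((Proc.pre p P).par (Proc.pre q Q)) ((σ.onProc P).par (ρ.onProc Q))
  | par {P P' : Proc N} (Q : Proc N) : Red P P' → Red (P.par Q) (P'.par Q)
  | new (n : N) {P P' : Proc N} : Red P P' → Red (Proc.new n P) (Proc.new n P')
  | struct {P Q Q' P' : Proc N} : Struct P Q → Red Q Q' → Struct Q' P' → Red P P'

/-- The barb `P ↓ ms`. -/
def Barb (P : Proc N) (ms : Set N) : Prop :=
  ∃ (ns : List N) (p : Pat N N) (P' P'' : Proc N), p.WellFormed ∧
    Struct P (Proc.news ns ((Proc.pre p P').par P'')) ∧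
    Disjoint p.pn {x | x ∈ ns} ∧ ms = p.fn \ {x | x ∈ ns}

/-- Contexts: processes with a hole, which may be in the scope of binders. -/
inductive Ctx (N : Type u) : Type (u + 1)
  | hole : Ctx N
  | parLeft (C : Ctx N) (P : Proc N) : Ctx N
  | parRight (P : Proc N) (C : Ctx N) : Ctx N
  | rep (C : Ctx N) : Ctx N
  | new (x : N) (C : Ctx N) : Ctx N
  | pre (p : Pat N N) (hp : p.WellFormed) (C : Ctx N) : Ctx N

/-- Fill the hole of a context; free names of the process may be captured. -/
def Ctx.fill : Ctx N → Proc N → Proc N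
  | .hole, P => P
  | .parLeft C Q, P => (C.fill P).par Q
  | .parRight Q C, P => Q.par (C.fill P)
  | .rep C, P => (C.fill P).rep
  | .new x C, P => Proc.new x (C.fill P)
  | .pre p _ C, P => Proc.pre p (C.fill P)

def BarbPreserving (R : Proc N → Proc N → Prop) : Prop :=
  ∀ P Q, R P Q → ∀ ms : Set N, Barb P ms → Barb Q ms

def ReductionClosed (R : Proc N → Proc N → Prop) : Prop :=
  ∀ P Q, R P Q → ∀ P', Red P P' → ∃ Q', Red Q Q' ∧ R P' Q'

def ContextClosed (R : Proc N → Proc N → Prop) : Prop :=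
  ∀ P Q, R P Q → ∀ C : Ctx N, R (C.fill P) (C.fill Q)

/-- Barbed congruence: the largest symmetric, barb preserving, reduction closed and context closed
relation, that is, the union of all such relations. -/
def BarbedCongruent (P Q : Proc N) : Prop :=
  ∃ R : Proc N → Proc N → Prop,
    (∀ P Q, R P Q → R Q P) ∧ BarbPreserving R ∧ ReductionClosed R ∧ ContextClosed R ∧ R P Q

/-! ## Labelled transitions and bisimilarity -/

/-- Labels: `τ`, and `(ν ns) p` with a finite set `ns` of restricted names. -/
inductive Label (N : Type u) : Type u
  | tau : Label N
  | act (ns : Finset N) (p : Pat N N) : Label N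

def Label.names : Label N → Set N
  | .tau => ∅
  | .act ns p => ↑ns ∪ p.bn ∪ p.fn

/-- The labelled transition system. In `unify` the restricted names `ms ∪ ns` of the result form
a set: they may be listed in any order, without repetition. -/
inductive Step : Proc N → Label N → Proc N → Prop
  | case (p : Pat N N) (P : Proc N) : p.WellFormed → Step (Proc.pre p P) (.act ∅ p) P
  | resnon {P P' : Proc N} {μ : Label N} (n : N) : Step P μ P' → n ∉ μ.names →
      Step (Proc.new n P) μ (Proc.new n P')
  | open {P P' : Proc N} {ns : Finset N} {p : Pat N N} (m : N) : Step P (.act ns p) P' →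
      m ∈ p.vn \ (↑ns ∪ p.pn ∪ p.bn) →
      Step (Proc.new m P) (.act (insert m ns) p) P'
  | unify {P P' Q Q' : Proc N} {ms ns : Finset N} {p q : Pat N N} {σ ρ : Sub N} (l : List N) :
      Step P (.act ms p) P' → Step Q (.act ns q) Q' → Unify p q σ ρ →
      Disjoint (↑ms) Q.fn → Disjoint (↑ns) P.fn → Disjoint ms ns →
      l.Nodup → l.toFinset = ms ∪ ns →
      Step (P.par Q) .tau (Proc.news l ((σ.onProc P').par (ρ.onProc Q')))
  | parint_left {P P' : Proc N} (Q : Proc N) : Step P .tau P' →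
      Step (P.par Q) .tau (P'.par Q)
  | parint_right {Q Q' : Proc N} (P : Proc N) : Step Q .tau Q' →
      Step (P.par Q) .tau (P.par Q')
  | parext_left {P P' : Proc N} {ns : Finset N} {p : Pat N N} (Q : Proc N) :
      Step P (.act ns p) P' → Disjoint (↑ns ∪ p.bn) Q.fn →
      Step (P.par Q) (.act ns p) (P'.par Q)
  | parext_right {Q Q' : Proc N} {ns : Finset N} {p : Pat N N} (P : Proc N) :
      Step Q (.act ns p) Q' → Disjoint (↑ns ∪ p.bn) P.fn →
      Step (P.par Q) (.act ns p) (P.par Q')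
  | rep {P P' : Proc N} {μ : Label N} : Step (P.rep.par P) μ P' → Step P.rep μ P'

/-- A symmetric relation is a bisimulation if every challenge has a proper reply. -/
def IsBisimulation (R : Proc N → Proc N → Prop) : Prop :=
  (∀ P Q, R P Q → R Q P) ∧ ∀ P Q, R P Q →
    (∀ P', Step P .tau P' → ∃ Q', Step Q .tau Q' ∧ R P' Q') ∧
    (∀ (ns : Finset N) (p : Pat N N) (P' : Proc N), Step P (.act ns p) P' →
      Disjoint (p.bn ∪ ↑ns) Q.fn →
      ∀ σ : Sub N, IsMatch p σ → Disjoint σ.fn ↑ns →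
        ∃ (q : Pat N N) (ρ : Sub N) (Q' : Proc N), IsMatch q ρ ∧ Compat p σ q ρ ∧
          Step Q (.act ns q) Q' ∧ R (σ.onProc P') (ρ.onProc Q'))

def SubstClosed (R : Proc N → Proc N → Prop) : Prop :=
  ∀ P Q, R P Q → ∀ σ : Sub N, R (σ.onProc P) (σ.onProc Q)

/-- Bisimilarity: the largest bisimulation closed under substitutions, that is, the union of all
bisimulations closed under substitutions. -/
def Bisimilar (P Q : Proc N) : Prop :=
  ∃ R : Proc N → Proc N → Prop, IsBisimulation R ∧ SubstClosed R ∧ R P Q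

end CPC

/-!
Bisimilarity is sound because the congruence closure of a bisimulation is again a bisimulation.

Let `R` be a reflexive bisimulation closed under substitutions, and let `CongClosure R` be the least
relation that contains `R` and is closed under the operators of the calculus. It is context closed
by construction. `CongClosure.reply` shows, by induction on the derivation of a transition, that
every transition of the left process is answered by the right one with residuals again in
`CongClosure R`. Because the closure contains parallel composition and replication at once, the rule
for replication is an instance of the induction hypothesis. The rule for unification rests on
`Compat.unify`: a compatible reply unifies with everything the challenge unifies with and leaves the
substitution of the partner unchanged, so the replies of two communicating components communicate
as well. Closure under substitutions is what makes the case of a prefix go through.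

Names are handled by permutations. Transitions are equivariant (`Step.ren`), the binding names of a
label can be replaced by fresh ones without changing the instances of the target
(`Step.rename_binders`), and names that occur neither in a process nor in its transition can be
assumed not to occur in the related process (`reply_of_fresh`).

To pass from transitions to reductions and barbs, structurally congruent processes are shown to have
the same transitions up to structural congruence (`Struct.sim`). Together with a normal form of
processes that perform a given action (`Step.actionForm`), this identifies reductions with
`τ`-transitions (`Step.red`, `Red.step`) and barbs with actions (`Step.barb`, `Barb.exists_step`).
The relation `Struct ∘ CongClosure R ∘ Struct` is then symmetric, barb preserving, reduction closed
and context closed.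
-/

set_option linter.unusedSectionVars false

namespace CPC

/-! ### Substitution -/

section Basics

variable {V W X B C D : Type u}

namespace CPat

/-- Simultaneous substitution in a communicable pattern. -/
def bind (σ : V → CPat W) : CPat V → CPat W
  | name x => σ x
  | comp c d => comp (bind σ c) (bind σ d)

theorem bind_comp (σ : V → CPat W) (τ : W → CPat X) (c : CPat V) :
    (c.bind σ).bind τ = c.bind fun x => (σ x).bind τ := by
  induction c <;> simp_all [bind]

theorem map_eq_bind (f : V → W) (c : CPat V) : c.map f = c.bind fun x => name (f x) := by
  induction c <;> simp_all [bind, map]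

theorem bind_congr {σ τ : V → CPat W} {c : CPat V} (h : ∀ x ∈ c.fn, σ x = τ x) :
    c.bind σ = c.bind τ := by
  induction c <;> simp_all [bind, fn]

theorem bind_name (c : CPat V) : c.bind name = c := by
  induction c <;> simp_all [bind]

theorem map_id (c : CPat V) : c.map (fun x => x) = c := by
  rw [map_eq_bind]; exact bind_name c

theorem mem_fn_bind {σ : V → CPat W} {c : CPat V} {y : W} :
    y ∈ (c.bind σ).fn ↔ ∃ x ∈ c.fn, y ∈ (σ x).fn := by
  induction c with
  | name x => simp [bind, fn]
  | comp c d hc hd => simp [bind, fn, hc, hd, or_and_right, exists_or]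

theorem fn_map (f : V → W) (c : CPat V) : (c.map f).fn = f '' c.fn := by
  ext y; rw [map_eq_bind, mem_fn_bind]; simp [fn, eq_comm]

theorem fn_finite (c : CPat V) : c.fn.Finite := by
  induction c with
  | name x => exact Set.finite_singleton x
  | comp c d hc hd => exact hc.union hd

theorem fn_nonempty (c : CPat V) : c.fn.Nonempty := by
  induction c with
  | name x => exact Set.singleton_nonempty x
  | comp c d hc hd => exact hc.inl

theorem vn_toPat (c : CPat V) : (c.toPat : Pat V B).vn = c.fn := by
  induction c <;> simp_all [toPat, Pat.vn, fn]

theorem pn_toPat (c : CPat V) : (c.toPat : Pat V B).pn = ∅ := by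
  induction c <;> simp_all [toPat, Pat.pn]

theorem vn_toProt (c : CPat V) : (c.toProt : Pat V B).vn = ∅ := by
  induction c <;> simp_all [toProt, Pat.vn]

theorem pn_toProt (c : CPat V) : (c.toProt : Pat V B).pn = c.fn := by
  induction c <;> simp_all [toProt, Pat.pn, fn]

theorem subst_toPat (σ : V → CPat W) (c : CPat V) :
    (c.toPat : Pat V B).subst σ = (c.bind σ).toPat := by
  induction c <;> simp_all [toPat, Pat.subst, bind]

theorem subst_toProt (σ : V → CPat W) (c : CPat V) :
    (c.toProt : Pat V B).subst σ = (c.bind σ).toProt := by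
  induction c <;> simp_all [toProt, Pat.subst, bind]

end CPat

namespace Pat

/-- Rename the free names by `f` and the binding names by `g`. -/
def map (f : V → W) (g : B → C) : Pat V B → Pat W C
  | bind x => bind (g x)
  | var x => var (f x)
  | prot x => prot (f x)
  | comp p q => comp (p.map f g) (q.map f g)

theorem map_toPat (f : V → W) (g : B → C) (c : CPat V) :
    (c.toPat : Pat V B).map f g = (c.map f).toPat := by
  induction c <;> simp_all [map, CPat.toPat, CPat.map]

theorem binders_map (f : V → W) (g : B → C) (p : Pat V B) :
    (p.map f g).binders = p.binders.map g := by
  induction p <;> simp_all [map, binders]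

theorem vn_map (f : V → W) (g : B → C) (p : Pat V B) : (p.map f g).vn = f '' p.vn := by
  induction p <;> simp_all [map, vn, Set.image_union]

theorem pn_map (f : V → W) (g : B → C) (p : Pat V B) : (p.map f g).pn = f '' p.pn := by
  induction p <;> simp_all [map, pn, Set.image_union]

theorem fn_map (f : V → W) (g : B → C) (p : Pat V B) : (p.map f g).fn = f '' p.fn := by
  simp [fn, vn_map, pn_map, Set.image_union]

theorem bn_map (f : V → W) (g : B → C) (p : Pat V B) : (p.map f g).bn = g '' p.bn := by
  ext; simp [bn, binders_map]

theorem map_map {E : Type u} (f : V → W) (g : B → C) (f' : W → X) (g' : C → E) (p : Pat V B) :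
    (p.map f g).map f' g' = p.map (fun x => f' (f x)) (fun x => g' (g x)) := by
  induction p <;> simp_all [map]

theorem bn_comp (p q : Pat V B) : (comp p q).bn = p.bn ∪ q.bn := by
  ext; simp [bn, binders]

theorem fn_comp (p q : Pat V B) : (comp p q).fn = p.fn ∪ q.fn := by
  ext; simp only [fn, vn, pn, Set.mem_union]; tauto

theorem map_congr {f f' : V → W} {g g' : B → C} {p : Pat V B} (hf : ∀ x ∈ p.fn, f x = f' x)
    (hg : ∀ x ∈ p.bn, g x = g' x) : p.map f g = p.map f' g' := by
  induction p with
  | bind x => simp [map, hg x (by simp [bn, binders])]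
  | var x => simp [map, hf x (by simp [fn, vn])]
  | prot x => simp [map, hf x (by simp [fn, pn])]
  | comp p q hp hq =>
    rw [fn_comp] at hf
    rw [bn_comp] at hg
    simp only [map]
    rw [hp (fun x h => hf x (.inl h)) (fun x h => hg x (.inl h)),
      hq (fun x h => hf x (.inr h)) (fun x h => hg x (.inr h))]

theorem map_id (p : Pat V B) : p.map (fun x => x) (fun x => x) = p := by
  induction p <;> simp_all [map]

theorem subst_congr {σ τ : V → CPat W} {p : Pat V B} (h : ∀ x ∈ p.fn, σ x = τ x) :
    p.subst σ = p.subst τ := by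
  induction p with
  | bind x => rfl
  | var x => simp [subst, h x (by simp [fn, vn])]
  | prot x => simp [subst, h x (by simp [fn, pn])]
  | comp p q hp hq =>
    rw [fn_comp] at h
    simp only [subst]
    rw [hp (fun x hx => h x (.inl hx)), hq (fun x hx => h x (.inr hx))]

theorem subst_comp (σ : V → CPat W) (τ : W → CPat X) (p : Pat V B) :
    (p.subst σ).subst τ = p.subst fun x => (σ x).bind τ := by
  induction p <;> simp_all [subst, CPat.subst_toPat, CPat.subst_toProt]

theorem subst_name (f : V → W) (p : Pat V B) :
    p.subst (fun x => CPat.name (f x)) = p.map f fun x => x := by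
  induction p <;> simp_all [subst, map, CPat.toPat, CPat.toProt]

theorem mem_vn_subst {σ : V → CPat W} {p : Pat V B} {y : W} :
    y ∈ (p.subst σ).vn ↔ ∃ x ∈ p.vn, y ∈ (σ x).fn := by
  induction p with
  | comp p q hp hq => simp [subst, vn, hp, hq, or_and_right, exists_or]
  | _ => simp [subst, vn, CPat.vn_toPat, CPat.vn_toProt]

theorem mem_pn_subst {σ : V → CPat W} {p : Pat V B} {y : W} :
    y ∈ (p.subst σ).pn ↔ ∃ x ∈ p.pn, y ∈ (σ x).fn := by
  induction p with
  | comp p q hp hq => simp [subst, pn, hp, hq, or_and_right, exists_or]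
  | _ => simp [subst, pn, CPat.pn_toPat, CPat.pn_toProt]

theorem mem_fn_subst {σ : V → CPat W} {p : Pat V B} {y : W} :
    y ∈ (p.subst σ).fn ↔ ∃ x ∈ p.fn, y ∈ (σ x).fn := by
  simp [fn, mem_vn_subst, mem_pn_subst, or_and_right, exists_or]

theorem fn_finite (p : Pat V B) : p.fn.Finite := by
  induction p with
  | comp p q hp hq => rw [fn_comp]; exact hp.union hq
  | _ => simp [fn, vn, pn]

theorem bn_finite (p : Pat V B) : p.bn.Finite := List.finite_toSet p.binders

theorem erase_subst (σ : V → CPat W) (p : Pat V B) : (p.subst σ).erase = p.erase.subst σ := by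
  have h₁ (c : CPat W) : (c.toPat : Pat W B).erase = c.toPat := by
    induction c <;> simp_all [CPat.toPat, erase]
  have h₂ (c : CPat W) : (c.toProt : Pat W B).erase = c.toProt := by
    induction c <;> simp_all [CPat.toProt, erase]
  induction p <;> simp_all [subst, erase]

theorem erase_map (f : V → W) (g : B → C) (p : Pat V B) :
    (p.map f g).erase = p.erase.map f fun x => x := by
  induction p <;> simp_all [map, erase]

theorem vn_erase (p : Pat V B) : p.erase.vn = p.vn := by
  induction p <;> simp_all [vn, erase]

theorem pn_erase (p : Pat V B) : p.erase.pn = p.pn := by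
  induction p <;> simp_all [pn, erase]

theorem fn_erase (p : Pat V B) : p.erase.fn = p.fn := by
  simp [fn, vn_erase, pn_erase]

/-- A pattern is determined by its erasure and the list of its binding names. -/
theorem eq_of_erase_eq {p q : Pat V B} (h : p.erase = q.erase) (hb : p.binders = q.binders) :
    p = q := by
  induction p generalizing q with
  | comp p₁ p₂ h₁ h₂ =>
    cases q <;> simp only [erase, comp.injEq, reduceCtorEq] at h
    rename_i q₁ q₂
    have hl : p₁.binders.length = q₁.binders.length := by
      rw [← length_binders_erase, h.1, length_binders_erase]
    have := List.append_inj hb hl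
    rw [h₁ h.1 this.1, h₂ h.2 this.2]
  | _ => cases q <;> simp_all [erase, binders]

end Pat

theorem lift_bind (σ : V → CPat W) (τ : W → CPat X) {m : ℕ} :
    (fun x => (lift (m := m) σ x).bind (lift τ)) = lift fun x => (σ x).bind τ := by
  funext x
  cases x with
  | inl x => simp only [lift, CPat.map_eq_bind, CPat.bind_comp, CPat.bind]
  | inr i => rfl

namespace Proc

theorem subst_congr {V : Type u} {P : Proc V} {W : Type u} {σ τ : V → CPat W}
    (h : ∀ x ∈ P.fn, σ x = τ x) : P.subst σ = P.subst τ := by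
  have hl {V W : Type u} {m : ℕ} {P : Proc (V ⊕ Fin m)} {σ τ : V → CPat W}
      (h : ∀ x, Sum.inl x ∈ P.fn → σ x = τ x) : ∀ x ∈ P.fn, lift σ x = lift (m := m) τ x := by
    rintro (x | i) hx
    · simp only [lift]; rw [h x hx]
    · rfl
  induction P generalizing W with
  | zero => rfl
  | par P Q hP hQ =>
    simp only [subst]
    rw [hP fun x hx => h x (.inl hx), hQ fun x hx => h x (.inr hx)]
  | rep P hP => simp only [subst]; rw [hP h]
  | res P hP => simp only [subst]; rw [hP (hl h)]
  | case p hp P hP =>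
    simp only [subst]
    rw [hP (hl fun x hx => h x (.inr hx))]
    congr 1
    exact Pat.subst_congr fun x hx => h x (.inl hx)

theorem subst_comp {V : Type u} (P : Proc V) {W X : Type u} (σ : V → CPat W) (τ : W → CPat X) :
    (P.subst σ).subst τ = P.subst fun x => (σ x).bind τ := by
  induction P generalizing W X with
  | zero => rfl
  | par P Q hP hQ => simp only [subst, hP, hQ]
  | rep P hP => simp only [subst, hP]
  | res P hP => simp only [subst, hP, lift_bind]
  | case p hp P hP => simp only [subst, hP, lift_bind, Pat.subst_comp]

theorem subst_id {V : Type u} (P : Proc V) : P.subst CPat.name = P := by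
  have h {V : Type u} {m : ℕ} : lift (m := m) (CPat.name : V → CPat V) = CPat.name := by
    funext x; cases x <;> rfl
  induction P with
  | case p hp P hP =>
    simp only [subst, h, hP]
    congr 1
    exact (Pat.subst_name _ _).trans (Pat.map_id p)
  | _ => simp_all [subst]

theorem mem_fn_subst {V : Type u} {P : Proc V} {W : Type u} {σ : V → CPat W} {y : W} :
    y ∈ (P.subst σ).fn ↔ ∃ x ∈ P.fn, y ∈ (σ x).fn := by
  have hl {V W : Type u} {m : ℕ} {P : Proc (V ⊕ Fin m)} {σ : V → CPat W} {y : W} :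
      (∃ x ∈ P.fn, Sum.inl y ∈ (lift (m := m) σ x).fn) ↔ ∃ x, Sum.inl x ∈ P.fn ∧ y ∈ (σ x).fn := by
    simp [lift, CPat.fn_map, CPat.fn]
  induction P generalizing W with
  | zero => simp [subst, fn]
  | par P Q hP hQ => simp [subst, fn, hP, hQ, or_and_right, exists_or]
  | rep P hP => simp only [subst, fn, hP]
  | res P hP => simp only [subst, fn, hP, Set.mem_ofPred_eq, hl]
  | case p hp P hP =>
    simp only [subst, fn, hP, Set.mem_ofPred_eq, hl, Set.mem_union, Pat.mem_fn_subst,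
      or_and_right, exists_or]

theorem fn_finite {V : Type u} (P : Proc V) : P.fn.Finite := by
  induction P with
  | zero => exact Set.finite_empty
  | par P Q hP hQ => exact hP.union hQ
  | rep P hP => exact hP
  | res P hP => exact hP.preimage Sum.inl_injective.injOn
  | case p hp P hP => exact p.fn_finite.union (hP.preimage Sum.inl_injective.injOn)

/-- Renaming of free names. -/
def ren (f : V → W) (P : Proc V) : Proc W := P.subst fun x => CPat.name (f x)

theorem ren_congr {f g : V → W} {P : Proc V} (h : ∀ x ∈ P.fn, f x = g x) : P.ren f = P.ren g :=
  subst_congr fun x hx => congrArg _ (h x hx)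

theorem ren_id (P : Proc V) : P.ren (fun x => x) = P := subst_id P

theorem ren_eq_self {f : V → V} {P : Proc V} (h : ∀ x ∈ P.fn, f x = x) : P.ren f = P :=
  (ren_congr h).trans (ren_id P)

theorem ren_ren (f : V → W) (g : W → X) (P : Proc V) : (P.ren f).ren g = P.ren fun x => g (f x) :=
  subst_comp P _ _

theorem fn_ren (f : V → W) (P : Proc V) : (P.ren f).fn = f '' P.fn := by
  ext y; simp [ren, mem_fn_subst, CPat.fn, eq_comm]

end Proc

end Basics

/-! ### Restrictions and cases with named binders -/

variable {N : Type u} [DecidableEq N]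

namespace Proc

/-- Bind the names in `xs`, listed with a length that is only propositionally equal to `m`. -/
def closeAs (m : ℕ) (xs : List N) (h : xs.length = m) (P : Proc N) : Proc (N ⊕ Fin m) :=
  P.subst fun y => CPat.name
    (if hy : y ∈ xs then Sum.inr ⟨xs.idxOf y, h ▸ List.idxOf_lt_length_iff.2 hy⟩ else Sum.inl y)

theorem pre_eq (p : Pat N N) (P : Proc N) {m : ℕ} {xs : List N} {q : Pat N PUnit}
    (hq : q.binders.length = m) (he : p.erase = q) (hx : p.binders = xs) (h : xs.length = m) :
    pre p P = case q hq (closeAs m xs h P) := by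
  subst hx he h; rfl

/-- Replace the `i`-th bound name by the `i`-th name of `xs`. -/
def openAs (m : ℕ) (xs : List N) (h : xs.length = m) (P : Proc (N ⊕ Fin m)) : Proc N :=
  P.subst fun y => CPat.name (Sum.elim id (fun i => xs[i]) y)

/-- The renaming that takes the names of `xs` to the corresponding ones of `ys` and fixes all
others. -/
def listMap (xs ys : List N) (h : xs.length = ys.length) (y : N) : N :=
  if hy : y ∈ xs then ys[xs.idxOf y]'(h ▸ List.idxOf_lt_length_iff.2 hy) else y

theorem openAs_closeAs (m : ℕ) (xs ys : List N) (hx : xs.length = m) (hy : ys.length = m)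
    (P : Proc N) : openAs m ys hy (closeAs m xs hx P) =
      P.subst fun y => CPat.name (listMap xs ys (hx.trans hy.symm) y) := by
  rw [openAs, closeAs, subst_comp]
  congr 1; funext y
  simp only [CPat.bind, listMap]
  split <;> simp

theorem listMap_self (xs : List N) (y : N) : listMap xs xs rfl y = y := by
  unfold listMap; split <;> simp

theorem openAs_closeAs_self (m : ℕ) (xs : List N) (hx : xs.length = m) (P : Proc N) :
    openAs m xs hx (closeAs m xs hx P) = P := by
  rw [openAs_closeAs]; simp only [listMap_self]; exact subst_id P

theorem fn_new (x : N) (P : Proc N) : (new x P).fn = P.fn \ {x} := by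
  ext y
  simp only [new, fn, close, Set.mem_ofPred_eq, mem_fn_subst, closeName, CPat.fn]
  constructor
  · rintro ⟨z, hz, h⟩
    split_ifs at h with hzx
    · simp at h
    · simp only [Set.mem_singleton_iff, Sum.inl.injEq] at h
      subst h; simp_all
  · rintro ⟨hy, hyx⟩
    have : y ∉ [x] := by simpa using hyx
    exact ⟨y, hy, by simp [this]⟩

theorem fn_pre (p : Pat N N) (P : Proc N) : (pre p P).fn = p.fn ∪ (P.fn \ p.bn) := by
  ext y
  simp only [pre, fn, close, Set.mem_ofPred_eq, Set.mem_union, Pat.fn_erase, mem_fn_subst,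
    closeName, CPat.fn]
  refine or_congr_right ?_
  constructor
  · rintro ⟨z, hz, h⟩
    split_ifs at h with hzx
    · simp at h
    · simp only [Set.mem_singleton_iff, Sum.inl.injEq] at h
      subst h; exact ⟨hz, hzx⟩
  · rintro ⟨hy, hyx⟩
    have : y ∉ p.binders := hyx
    exact ⟨y, hy, by simp [this]⟩

theorem mem_fn_news {xs : List N} {P : Proc N} {y : N} :
    y ∈ (news xs P).fn ↔ y ∈ P.fn ∧ y ∉ xs := by
  induction xs with
  | nil => simp [news]
  | cons x xs ih =>
    have : news (x :: xs) P = new x (news xs P) := rfl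
    rw [this, fn_new]; simp [ih]; tauto

/-- Substitution in a restriction, with the bound name `x` renamed to `z` on the way. -/
theorem subst_new {x z : N} {P : Proc N} {σ : N → CPat N}
    (h : ∀ y ∈ P.fn, y ≠ x → z ∉ (σ y).fn) :
    (new x P).subst σ = new z (P.subst (Function.update σ x (CPat.name z))) := by
  simp only [new, close, subst, subst_comp]
  congr 1
  refine subst_congr fun y hy => ?_
  by_cases hyx : y = x
  · subst hyx
    simp [closeName, CPat.bind, lift]
  · have h1 : closeName [x] y = Sum.inl y := by simp [closeName, hyx]
    rw [h1, Function.update_of_ne hyx]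
    simp only [CPat.bind, lift, CPat.map_eq_bind]
    refine CPat.bind_congr fun w hw => ?_
    have : w ≠ z := fun e => h y hy hyx (e ▸ hw)
    simp [closeName, this]

theorem idxOf_map {g : N → N} {xs : List N} (hg : Set.InjOn g {x | x ∈ xs}) {y : N} (hy : y ∈ xs) :
    (xs.map g).idxOf (g y) = xs.idxOf y := by
  induction xs with
  | nil => simp at hy
  | cons x xs ih =>
    by_cases h : x = y
    · subst h; simp
    · have h' : g x ≠ g y := fun e => h (hg (by simp) hy e)
      rw [List.map_cons, List.idxOf_cons_ne _ h', List.idxOf_cons_ne _ h,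
        ih (hg.mono fun _ h => List.mem_cons_of_mem _ h) (by simpa [Ne.symm h] using hy)]

/-- Substitution in a case, with the binding names renamed by `g` on the way. -/
theorem subst_pre {p : Pat N N} {P : Proc N} {σ : N → CPat N} {g : N → N}
    (hg : Set.InjOn g p.bn)
    (h : ∀ y ∈ P.fn, y ∉ p.bn → ∀ x ∈ p.bn, g x ∉ (σ y).fn) :
    (pre p P).subst σ = pre ((p.map id g).subst σ)
      (P.subst fun y => if y ∈ p.binders then CPat.name (g y) else σ y) := by
  have hl : (p.binders.map g).length = p.binders.length := List.length_map _
  rw [pre_eq ((p.map id g).subst σ) _ (xs := p.binders.map g) (m := p.binders.length)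
    (q := p.erase.subst σ)
    ((congrArg List.length (Pat.binders_subst σ _)).trans (Pat.length_binders_erase p))
    (by rw [Pat.erase_subst, Pat.erase_map]; congr 1; exact Pat.map_id _)
    (by rw [Pat.binders_subst, Pat.binders_map]) hl]
  simp only [pre, close, subst, subst_comp, closeAs]
  congr 1
  refine subst_congr fun y hy => ?_
  by_cases hyp : y ∈ p.binders
  · have : g y ∈ p.binders.map g := List.mem_map_of_mem hyp
    simp only [closeName, hyp, dite_true, if_true, CPat.bind, lift, this]
    simp only [idxOf_map hg hyp]
  · simp only [closeName, hyp, dite_false, if_false, CPat.bind, lift, CPat.map_eq_bind]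
    refine CPat.bind_congr fun w hw => ?_
    have : w ∉ p.binders.map g := by
      rintro hw'
      obtain ⟨x, hx, rfl⟩ := List.mem_map.1 hw'
      exact h y hy hyp x hx hw
    rw [dif_neg this]

theorem ren_new (π : Equiv.Perm N) (x : N) (P : Proc N) :
    (new x P).ren π = new (π x) (P.ren π) := by
  rw [ren, subst_new (z := π x)]
  · congr 1
    refine subst_congr fun y _ => ?_
    by_cases h : y = x <;> simp [h, Function.update_of_ne]
  · rintro y _ h
    simpa [CPat.fn] using Ne.symm h

theorem ren_news (π : Equiv.Perm N) (xs : List N) (P : Proc N) :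
    (news xs P).ren π = news (xs.map π) (P.ren π) := by
  induction xs with
  | nil => rfl
  | cons x xs ih =>
    have (xs : List N) (x : N) (P : Proc N) : news (x :: xs) P = new x (news xs P) := rfl
    rw [this, ren_new, ih]; rfl

theorem ren_pre (π : Equiv.Perm N) (p : Pat N N) (P : Proc N) :
    (pre p P).ren π = pre (p.map π π) (P.ren π) := by
  rw [ren, subst_pre (g := π) π.injective.injOn]
  · rw [Pat.subst_name, Pat.map_map]
    congr 1
    refine subst_congr fun y _ => ?_
    simp
  · rintro y _ h x hx
    simp only [CPat.fn, Set.mem_singleton_iff, π.injective.eq_iff]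
    rintro rfl; exact h hx

/-- Alpha-conversion of a restriction. -/
theorem new_eq_ren {x z : N} {P : Proc N} (hz : z ∉ (new x P).fn) :
    new x P = new z (P.ren (Equiv.swap x z)) := by
  have h := ren_new (Equiv.swap x z) x P
  rw [Equiv.swap_apply_left] at h
  rw [← h, ren_eq_self]
  intro y hy
  refine Equiv.swap_apply_of_ne_of_ne ?_ ?_
  · rintro rfl; simp [fn_new] at hy
  · rintro rfl; exact hz hy

theorem ren_swap_par {n m : N} {P : Proc N} (hn : n ∉ P.fn) (hm : m ∉ P.fn) (Q : Proc N) :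
    (P.par Q).ren (Equiv.swap n m) = P.par (Q.ren (Equiv.swap n m)) :=
  congrArg (Proc.par · _) (Proc.ren_eq_self fun _ hx =>
    Equiv.swap_apply_of_ne_of_ne (ne_of_mem_of_not_mem hx hn) (ne_of_mem_of_not_mem hx hm))

theorem notMem_fn_of_new {n : N} {Q : Proc N} {x : N} (h : x ∉ (new n Q).fn) (hx : x ≠ n) :
    x ∉ Q.fn := fun h' => h (by rw [fn_new]; exact ⟨h', hx⟩)

theorem notMem_fn_ren_swap {n m : N} {Q : Proc N} {x : N} (h : x ∉ (new n Q).fn) (hx : x ≠ m)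
    (hm : m ∉ (new n Q).fn) : x ∉ (Q.ren (Equiv.swap n m)).fn :=
  notMem_fn_of_new (n := m) (by rwa [← new_eq_ren hm]) hx

/-- Two representations of the same restriction differ by a transposition. -/
theorem eq_ren_of_new_eq {x z : N} {P Q : Proc N} (h : new x P = new z Q) :
    Q = P.ren (Equiv.swap x z) ∧ z ∉ (new x P).fn := by
  have hz : z ∉ (new x P).fn := by rw [h, fn_new]; simp
  refine ⟨?_, hz⟩
  rw [new_eq_ren hz] at h
  have h' : closeAs 1 [z] rfl (P.ren (Equiv.swap x z)) = closeAs 1 [z] rfl Q := by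
    simp only [new, res.injEq] at h
    exact h
  have := congrArg (openAs 1 [z] rfl) h'
  rw [openAs_closeAs_self, openAs_closeAs_self] at this
  exact this.symm

/-- Two representations of the same case differ by a renaming of the binding names; the same
renaming can be applied to every other case with this pattern in which the new binding names
are not free. -/
theorem pre_eq_pre {p q : Pat N N} {P Q : Proc N} (hp : p.WellFormed) (hq : q.WellFormed)
    (h : pre p P = pre q Q) : ∃ f : N → N, Q = P.ren f ∧ q = p.map id f ∧
      ∀ P' : Proc N, Disjoint q.bn (pre p P').fn → pre p P' = pre q (P'.ren f) := by
  have he : p.erase = q.erase := by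
    simp only [pre] at h
    injection h
  have hl : p.binders.length = q.binders.length := by
    rw [← Pat.length_binders_erase, he, Pat.length_binders_erase]
  set f := listMap p.binders q.binders hl with hf
  have hmap : p.binders.map f = q.binders := by
    refine List.ext_getElem (by simp [hl]) fun i hi hi' => ?_
    have hi'' : i < p.binders.length := by simpa using hi
    simp [hf, listMap, hp.1.idxOf_getElem]
  have hqf : q = p.map id f := by
    refine Pat.eq_of_erase_eq ?_ ?_
    · rw [Pat.erase_map]; exact he ▸ (Pat.map_id _).symm
    · rw [Pat.binders_map, hmap]
  have hinj : Set.InjOn f p.bn := by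
    have : (p.binders.map f).Nodup := hmap ▸ hq.1
    exact fun x hx y hy e => List.inj_on_of_nodup_map this hx hy e
  refine ⟨f, ?_, hqf, ?_⟩
  · rw [pre_eq q Q (m := p.binders.length) (q := p.erase) (Pat.length_binders_erase p) he.symm rfl
      hl.symm] at h
    have h' : closeAs p.binders.length p.binders rfl P = closeAs p.binders.length q.binders hl.symm Q := by
      simp only [pre] at h
      injection h
    have := congrArg (openAs _ q.binders hl.symm) h'
    rw [openAs_closeAs, openAs_closeAs_self] at this
    exact this.symm
  · intro P' hd
    have key : (pre p P').subst CPat.name = _ := subst_pre (g := f) hinj (fun y hy hyp x hx => by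
      simp only [CPat.fn, Set.mem_singleton_iff]
      rintro rfl
      refine Set.disjoint_left.1 hd (?_ : f x ∈ q.bn) ?_
      · rw [hqf, Pat.bn_map]; exact ⟨x, hx, rfl⟩
      · rw [fn_pre]; exact .inr ⟨hy, hyp⟩)
    rw [subst_id] at key
    rw [key, ← hqf]
    have : q.subst CPat.name = q := (Pat.subst_name _ _).trans (Pat.map_id q)
    rw [this]
    congr 1
    refine subst_congr fun y _ => ?_
    split_ifs with hy
    · rfl
    · simp [hf, listMap, hy]

end Proc

/-! ### Finite substitutions and their renaming -/

namespace Sub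

theorem mem_dom {σ : Sub N} {x : N} : x ∈ σ.dom ↔ ∃ c, σ.lookup x = some c := by
  rw [← Option.isSome_iff_exists, Finmap.lookup_isSome]; rfl

theorem lookup_eq_none {σ : Sub N} {x : N} : σ.lookup x = none ↔ x ∉ σ.dom :=
  Finmap.lookup_eq_none

theorem app_of_notMem {σ : Sub N} {x : N} (h : x ∉ σ.dom) : σ.app x = CPat.name x := by
  rw [app, lookup_eq_none.2 h]; rfl

theorem app_of_lookup {σ : Sub N} {x : N} {c : CPat N} (h : σ.lookup x = some c) :
    σ.app x = c := by
  rw [app, h]; rfl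

theorem dom_empty : (∅ : Sub N).dom = ∅ := by
  ext x; exact iff_of_false Finmap.notMem_empty (Set.notMem_empty x)

theorem dom_singleton (x : N) (c : CPat N) : dom (Finmap.singleton x c) = {x} := by
  ext y; simp [dom]

theorem dom_union (σ τ : Sub N) : (σ ∪ τ).dom = σ.dom ∪ τ.dom := by
  ext x; simp [dom]

theorem fn_empty : (∅ : Sub N).fn = ∅ := by
  ext y; simp [fn]

theorem lookup_singleton (x y : N) (c : CPat N) :
    (Finmap.singleton x c : Sub N).lookup y = if y = x then some c else none := by
  split_ifs with h
  · subst h; exact Finmap.lookup_singleton_eq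
  · rw [lookup_eq_none, dom_singleton]; exact h

theorem fn_singleton (x : N) (c : CPat N) : fn (Finmap.singleton x c) = c.fn := by
  ext y
  simp [fn, lookup_singleton]

theorem lookup_union (σ τ : Sub N) (x : N) :
    (σ ∪ τ).lookup x = (σ.lookup x).or (τ.lookup x) := by
  by_cases h : x ∈ σ
  · rw [Finmap.lookup_union_left h]
    obtain ⟨c, hc⟩ := mem_dom.1 (show x ∈ σ.dom from h)
    rw [hc]; rfl
  · rw [Finmap.lookup_union_right h, Finmap.lookup_eq_none.2 h]; rfl

theorem fn_union_subset (σ τ : Sub N) : (σ ∪ τ).fn ⊆ σ.fn ∪ τ.fn := by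
  rintro y ⟨x, c, hx, hy⟩
  rw [lookup_union, Option.or_eq_some_iff] at hx
  rcases hx with hx | ⟨-, hx⟩
  · exact .inl ⟨x, c, hx, hy⟩
  · exact .inr ⟨x, c, hx, hy⟩

theorem fn_union {σ τ : Sub N} (h : Disjoint σ.dom τ.dom) : (σ ∪ τ).fn = σ.fn ∪ τ.fn := by
  refine (fn_union_subset σ τ).antisymm ?_
  rintro y (⟨x, c, hx, hy⟩ | ⟨x, c, hx, hy⟩)
  · exact ⟨x, c, by rw [lookup_union, hx]; rfl, hy⟩
  · have : x ∉ σ.dom := Set.disjoint_right.1 h (mem_dom.2 ⟨c, hx⟩)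
    exact ⟨x, c, by rw [lookup_union, hx, lookup_eq_none.2 this]; rfl, hy⟩

/-- A union of substitutions with disjoint domains determines its parts. -/
theorem union_inj {σ₁ σ₂ τ₁ τ₂ : Sub N} (h : σ₁ ∪ σ₂ = τ₁ ∪ τ₂) (h₁ : σ₁.dom = τ₁.dom)
    (h₂ : σ₂.dom = τ₂.dom) (hd : Disjoint σ₁.dom σ₂.dom) : σ₁ = τ₁ ∧ σ₂ = τ₂ := by
  have hl (x) : (σ₁.lookup x).or (σ₂.lookup x) = (τ₁.lookup x).or (τ₂.lookup x) := by
    rw [← lookup_union, ← lookup_union, h]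
  constructor <;> refine Finmap.ext_lookup fun x => ?_ <;> have := hl x
  · by_cases hx : x ∈ σ₁.dom
    · obtain ⟨c, hc⟩ := mem_dom.1 hx
      obtain ⟨d, hd⟩ := mem_dom.1 (h₁ ▸ hx)
      simpa [hc, hd] using this
    · rw [lookup_eq_none.2 hx, lookup_eq_none.2 (show x ∉ τ₁.dom by rwa [← h₁])]
  · by_cases hx : x ∈ σ₂.dom
    · have h1 : x ∉ σ₁.dom := Set.disjoint_right.1 hd hx
      have h2 : x ∉ τ₁.dom := by rwa [← h₁]
      simpa only [lookup_eq_none.2 h1, lookup_eq_none.2 h2, Option.none_or] using this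
    · rw [lookup_eq_none.2 hx, lookup_eq_none.2 (show x ∉ τ₂.dom by rwa [← h₂])]

theorem fn_finite (σ : Sub N) : σ.fn.Finite := by
  have : σ.fn ⊆ ⋃ x ∈ σ.keys, (σ.app x).fn := by
    rintro y ⟨x, c, hx, hy⟩
    refine Set.mem_biUnion (x := x) ?_ ?_
    · exact Finmap.mem_keys.2 (mem_dom.2 ⟨c, hx⟩)
    · rwa [app_of_lookup hx]
  exact (σ.keys.finite_toSet.biUnion fun x _ => CPat.fn_finite _).subset this

theorem app_fn_subset {σ : Sub N} {x : N} : (σ.app x).fn ⊆ σ.fn ∪ {x} := by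
  intro y hy
  by_cases hx : x ∈ σ.dom
  · obtain ⟨c, hc⟩ := mem_dom.1 hx
    rw [app_of_lookup hc] at hy
    exact .inl ⟨x, c, hc, hy⟩
  · rw [app_of_notMem hx] at hy; exact .inr hy

/-- The substitution with domain `s` and values given by `f`. -/
def ofFun (s : Finset N) (f : N → CPat N) : Sub N :=
  Finmap.keysLookupEquiv.symm ⟨(s, fun x => if x ∈ s then some (f x) else none), fun x => by
    simp⟩

theorem lookup_ofFun (s : Finset N) (f : N → CPat N) (x : N) :
    (ofFun s f).lookup x = if x ∈ s then some (f x) else none := by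
  simp [ofFun]

theorem app_ofFun {s : Finset N} {f : N → CPat N} {x : N} (h : x ∈ s) : (ofFun s f).app x = f x :=
  app_of_lookup (by simp [lookup_ofFun, h])

theorem dom_ofFun (s : Finset N) (f : N → CPat N) : (ofFun s f).dom = ↑s := by
  ext x; simp [mem_dom, lookup_ofFun]

theorem fn_ofFun_subset (s : Finset N) (f : N → CPat N) :
    (ofFun s f).fn ⊆ {y | ∃ x ∈ s, y ∈ (f x).fn} := by
  rintro y ⟨x, c, hx, hy⟩
  rw [lookup_ofFun] at hx
  split_ifs at hx with h
  cases hx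
  exact ⟨x, h, hy⟩

/-- Rename the domain of a substitution by `g` and the names in its values by `f`. -/
def act (g : Equiv.Perm N) (f : N → N) (σ : Sub N) : Sub N :=
  Finmap.keysLookupEquiv.symm
    ⟨(σ.keys.map g.toEmbedding, fun x => (σ.lookup (g.symm x)).map (CPat.map f)), fun x => by
      rw [Option.isSome_map, Finmap.lookup_isSome, Finset.mem_map_equiv, Finmap.mem_keys]⟩

theorem lookup_act (g : Equiv.Perm N) (f : N → N) (σ : Sub N) (x : N) :
    (σ.act g f).lookup x = (σ.lookup (g.symm x)).map (CPat.map f) := by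
  simp [act]

theorem lookup_act_apply (g : Equiv.Perm N) (f : N → N) (σ : Sub N) (x : N) :
    (σ.act g f).lookup (g x) = (σ.lookup x).map (CPat.map f) := by
  rw [lookup_act, Equiv.symm_apply_apply]

theorem dom_act (g : Equiv.Perm N) (f : N → N) (σ : Sub N) : (σ.act g f).dom = g '' σ.dom := by
  ext x
  rw [Equiv.image_eq_preimage_symm]
  simp only [mem_dom, lookup_act, Set.mem_preimage, Option.map_eq_some_iff]
  exact ⟨fun ⟨_, c, h, _⟩ => ⟨c, h⟩, fun ⟨c, h⟩ => ⟨_, c, h, rfl⟩⟩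

theorem fn_act (g : Equiv.Perm N) (f : N → N) (σ : Sub N) : (σ.act g f).fn = f '' σ.fn := by
  ext y
  constructor
  · rintro ⟨x, c, hx, hy⟩
    rw [lookup_act, Option.map_eq_some_iff] at hx
    obtain ⟨d, hd, rfl⟩ := hx
    rw [CPat.fn_map] at hy
    obtain ⟨z, hz, rfl⟩ := hy
    exact ⟨z, ⟨_, d, hd, hz⟩, rfl⟩
  · rintro ⟨z, ⟨x, c, hx, hz⟩, rfl⟩
    exact ⟨g x, c.map f, by rw [lookup_act_apply, hx]; rfl, by rw [CPat.fn_map]; exact ⟨z, hz, rfl⟩⟩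

theorem act_empty (g : Equiv.Perm N) (f : N → N) : (∅ : Sub N).act g f = ∅ :=
  Finmap.ext_lookup fun x => by simp [lookup_act]

theorem act_singleton (g : Equiv.Perm N) (f : N → N) (x : N) (c : CPat N) :
    act g f (Finmap.singleton x c) = Finmap.singleton (g x) (c.map f) :=
  Finmap.ext_lookup fun y => by
    rw [lookup_act, lookup_singleton, lookup_singleton]
    simp only [Equiv.symm_apply_eq]
    split <;> rfl

theorem act_union (g : Equiv.Perm N) (f : N → N) (σ τ : Sub N) :
    (σ ∪ τ).act g f = σ.act g f ∪ τ.act g f :=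
  Finmap.ext_lookup fun y => by
    rw [lookup_act, lookup_union, lookup_union, lookup_act, lookup_act, Option.map_or]

theorem act_act (g g' : Equiv.Perm N) (f f' : N → N) (σ : Sub N) :
    (σ.act g f).act g' f' = σ.act (g' * g) (f' ∘ f) :=
  Finmap.ext_lookup fun y => by
    simp only [lookup_act, Option.map_map]
    have : CPat.map f' ∘ CPat.map f = CPat.map (f' ∘ f) := by
      funext c; simp [CPat.map_eq_bind, CPat.bind_comp, CPat.bind]
    rw [this]; rfl

theorem act_id (σ : Sub N) : σ.act 1 (fun x => x) = σ :=
  Finmap.ext_lookup fun y => by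
    rw [lookup_act]
    have : (CPat.map fun x => x : CPat N → CPat N) = id := funext CPat.map_id
    rw [this, Option.map_id]; rfl

theorem app_act (g : Equiv.Perm N) (f : N → N) {σ : Sub N} {x : N} (h : x ∈ σ.dom) :
    (σ.act g f).app (g x) = (σ.app x).map f := by
  obtain ⟨c, hc⟩ := mem_dom.1 h
  rw [app_of_lookup hc, app_of_lookup (c := c.map f)]
  rw [lookup_act_apply, hc]; rfl

theorem app_act_self (π : Equiv.Perm N) (σ : Sub N) (x : N) :
    (σ.act π π).app (π x) = (σ.app x).map π := by
  by_cases h : x ∈ σ.dom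
  · exact app_act π π h
  · rw [app_of_notMem h, app_of_notMem]
    · rfl
    · rw [dom_act]; simpa using h

theorem onProc_eq_self {σ : Sub N} {P : Proc N} (h : Disjoint σ.dom P.fn) : σ.onProc P = P := by
  rw [onProc, Proc.subst_congr (τ := CPat.name), Proc.subst_id]
  exact fun x hx => app_of_notMem (Set.disjoint_right.1 h hx)

theorem ren_onProc (π : Equiv.Perm N) (σ : Sub N) (P : Proc N) :
    (σ.onProc P).ren π = (σ.act π π).onProc (P.ren π) := by
  simp only [onProc, Proc.ren, Proc.subst_comp]
  congr 1; funext x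
  rw [← CPat.map_eq_bind, CPat.bind, app_act_self]

theorem fn_onProc_subset {σ : Sub N} {P : Proc N} :
    (σ.onProc P).fn ⊆ σ.fn ∪ (P.fn \ σ.dom) := by
  intro y hy
  obtain ⟨x, hx, hy⟩ := Proc.mem_fn_subst.1 hy
  by_cases h : x ∈ σ.dom
  · obtain ⟨c, hc⟩ := mem_dom.1 h
    exact .inl ⟨x, c, hc, app_of_lookup hc ▸ hy⟩
  · rw [app_of_notMem h] at hy
    cases hy; exact .inr ⟨hx, h⟩

theorem onProc_new {σ : Sub N} {x : N} {P : Proc N} (hd : x ∉ σ.dom) (hf : x ∉ σ.fn) :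
    σ.onProc (Proc.new x P) = Proc.new x (σ.onProc P) := by
  rw [onProc, Proc.subst_new (z := x), onProc]
  · congr 2
    rw [Function.update_eq_self_iff, app_of_notMem hd]
  · intro y _ hyx h
    rcases app_fn_subset h with h | h
    · exact hf h
    · exact hyx h.symm

theorem onProc_news {σ : Sub N} {xs : List N} {P : Proc N} (hd : ∀ x ∈ xs, x ∉ σ.dom)
    (hf : ∀ x ∈ xs, x ∉ σ.fn) : σ.onProc (Proc.news xs P) = Proc.news xs (σ.onProc P) := by
  induction xs with
  | nil => rfl
  | cons x xs ih =>
    have h (P : Proc N) : Proc.news (x :: xs) P = Proc.new x (Proc.news xs P) := rfl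
    simp only [List.forall_mem_cons] at hd hf
    rw [h, h, onProc_new hd.1 hf.1, ih hd.2 hf.2]

end Sub

/-! ### Unification and compatibility -/

theorem IsMatch.map {p : Pat N N} {σ : Sub N} (h : IsMatch p σ) (f : N → N) (g : Equiv.Perm N) :
    IsMatch (p.map f g) (σ.act g f) := by
  rw [IsMatch, Pat.bn_map, Sub.dom_act, h]

namespace Unify

variable {p q : Pat N N} {σ ρ : Sub N}

theorem symm (h : Unify p q σ ρ) : Unify q p ρ σ := by
  induction h <;> constructor <;> assumption

theorem isMatch_left (h : Unify p q σ ρ) : IsMatch p σ := by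
  have h₁ (c : CPat N) : (c.toPat : Pat N N).bn = ∅ := by simp [Pat.bn, Pat.binders_toPat]
  unfold IsMatch
  induction h with
  | bind_left x c => rw [Sub.dom_singleton]; ext; simp [Pat.bn, Pat.binders]
  | bind_right x c => rw [Sub.dom_empty, h₁]
  | comp _ _ h₁ h₂ => rw [Pat.bn_comp, Sub.dom_union, h₁, h₂]
  | _ => rw [Sub.dom_empty]; simp [Pat.bn, Pat.binders]

theorem isMatch_right (h : Unify p q σ ρ) : IsMatch q ρ := h.symm.isMatch_left

theorem fn_left (h : Unify p q σ ρ) : σ.fn ⊆ q.vn := by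
  induction h with
  | bind_left x c => rw [Sub.fn_singleton, CPat.vn_toPat]
  | comp _ _ h₁ h₂ => exact (Sub.fn_union_subset _ _).trans (Set.union_subset_union h₁ h₂)
  | _ => simp [Sub.fn_empty]

theorem fn_right (h : Unify p q σ ρ) : ρ.fn ⊆ p.vn := h.symm.fn_left

theorem pn_right (h : Unify p q σ ρ) : q.pn ⊆ p.fn := by
  induction h with
  | bind_left x c => simp [CPat.pn_toPat]
  | comp _ _ h₁ h₂ => rw [Pat.fn_comp]; exact Set.union_subset_union h₁ h₂
  | _ => simp [Pat.pn, Pat.fn, Pat.vn]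

theorem map (h : Unify p q σ ρ) (f : N → N) (g₁ g₂ : Equiv.Perm N) :
    Unify (p.map f g₁) (q.map f g₂) (σ.act g₁ f) (ρ.act g₂ f) := by
  induction h with
  | comp _ _ h₁ h₂ => rw [Sub.act_union, Sub.act_union]; exact .comp h₁ h₂
  | bind_left x c =>
    rw [Sub.act_singleton, Sub.act_empty, Pat.map_toPat]; exact .bind_left _ _
  | bind_right x c =>
    rw [Sub.act_singleton, Sub.act_empty, Pat.map_toPat]; exact .bind_right _ _
  | _ => simp only [Sub.act_empty, Pat.map]; constructor

end Unify

theorem Pat.WellFormed.left {p q : Pat N N} (h : (p.comp q).WellFormed) : p.WellFormed :=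
  ⟨(List.nodup_append.1 h.1).1,
    h.2.mono (by rw [Pat.bn_comp]; exact Set.subset_union_left)
      (by rw [Pat.fn_comp]; exact Set.subset_union_left)⟩

theorem Pat.WellFormed.right {p q : Pat N N} (h : (p.comp q).WellFormed) : q.WellFormed :=
  ⟨(List.nodup_append.1 h.1).2.1,
    h.2.mono (by rw [Pat.bn_comp]; exact Set.subset_union_right)
      (by rw [Pat.fn_comp]; exact Set.subset_union_right)⟩

theorem Pat.WellFormed.disjoint {p q : Pat N N} (h : (p.comp q).WellFormed) :
    Disjoint p.bn q.bn :=
  Set.disjoint_left.2 fun _ hx hy => (List.nodup_append.1 h.1).2.2 _ hx _ hy rfl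

theorem Pat.WellFormed.map {p : Pat N N} (h : p.WellFormed) {f : N → N} {g : Equiv.Perm N}
    (hfg : Disjoint (g '' p.bn) (f '' p.fn)) : (p.map f g).WellFormed := by
  refine ⟨?_, by rwa [Pat.bn_map, Pat.fn_map]⟩
  rw [Pat.binders_map]
  exact h.1.map g.injective

theorem Sub.hat_congr {σ τ : Sub N} {p : Pat N N} (h : ∀ x ∈ p.bn, σ.lookup x = τ.lookup x) :
    σ.hat p = τ.hat p := by
  induction p with
  | bind x => simp [hat, h x (by simp [Pat.bn, Pat.binders])]
  | comp p q hp hq =>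
    rw [Pat.bn_comp] at h
    simp only [hat]
    rw [hp fun x hx => h x (.inl hx), hq fun x hx => h x (.inr hx)]
  | _ => rfl

theorem Sub.hat_act (f : N → N) (g : Equiv.Perm N) {σ : Sub N} {p : Pat N N}
    (h : p.bn ⊆ σ.dom) : (σ.act g f).hat (p.map f g) = (σ.hat p).map f id := by
  induction p with
  | bind x =>
    obtain ⟨c, hc⟩ := mem_dom.1 (h (show x ∈ (Pat.bind x : Pat N N).bn by
      simp [Pat.bn, Pat.binders]))
    simp only [hat, Pat.map, lookup_act_apply, hc, Option.map_some, Option.getD_some,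
      Pat.map_toPat]
  | comp p q hp hq =>
    rw [Pat.bn_comp] at h
    simp only [hat, Pat.map]
    rw [hp fun x hx => h (.inl hx), hq fun x hx => h (.inr hx)]
  | _ => rfl

namespace Compat

variable {p q : Pat N N} {σ ρ : Sub N}

theorem isMatch_left (h : Compat p σ q ρ) : IsMatch p σ := by
  induction h with
  | bind _ _ h _ => exact h
  | comp _ _ h₁ h₂ => rw [IsMatch, Pat.bn_comp, Sub.dom_union, h₁, h₂]
  | _ => rw [IsMatch, Sub.dom_empty]; simp [Pat.bn, Pat.binders]

theorem isMatch_right (h : Compat p σ q ρ) : IsMatch q ρ := by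
  induction h with
  | bind _ _ h _ => rw [IsMatch, Sub.dom_singleton]; ext; simp [Pat.bn, Pat.binders]
  | comp _ _ h₁ h₂ => rw [IsMatch, Pat.bn_comp, Sub.dom_union, h₁, h₂]
  | _ => rw [IsMatch, Sub.dom_empty]; simp [Pat.bn, Pat.binders]

theorem fn_eq (h : Compat p σ q ρ) : q.fn = p.fn := by
  induction h with
  | bind y h _ _ => rw [h]; simp [Pat.fn, Pat.vn, Pat.pn]
  | comp _ _ h₁ h₂ => rw [Pat.fn_comp, Pat.fn_comp, h₁, h₂]
  | _ => simp [Pat.fn, Pat.vn, Pat.pn]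

theorem pn_subset (h : Compat p σ q ρ) : q.pn ⊆ p.pn := by
  induction h with
  | comp _ _ h₁ h₂ => exact Set.union_subset_union h₁ h₂
  | _ => simp [Pat.pn]

/-- The values of `σ` occur in the instance `σ̂ p` only, so compatible matches have the same
free names. -/
theorem fn_subset (hp : p.WellFormed) (h : Compat p σ q ρ) : ρ.fn ⊆ σ.fn := by
  induction h with
  | bind y h hm he =>
    rename_i p σ c
    rw [Sub.fn_singleton]
    clear hp
    have key : (σ.hat p).vn ⊆ σ.fn ∪ p.fn := by
      clear h he hm
      induction p with
      | bind x =>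
        intro y hy
        cases hx : σ.lookup x with
        | none => simp [Sub.hat, hx, Pat.vn] at hy
        | some d =>
          simp only [Sub.hat, hx, Option.map_some, Option.getD_some, CPat.vn_toPat] at hy
          exact .inl ⟨x, d, hx, hy⟩
      | comp p q hp hq =>
        rw [Pat.fn_comp]
        exact Set.union_subset (hp.trans (by gcongr; exact Set.subset_union_left))
          (hq.trans (by gcongr; exact Set.subset_union_right))
      | var x => simp [Sub.hat, Pat.vn, Pat.fn]
      | prot x => simp [Sub.hat, Pat.vn]
    rwa [he, CPat.vn_toPat, h, Set.union_empty] at key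
  | comp c₁ c₂ h₁ h₂ =>
    rename_i σ₁ σ₂ _ _
    rw [Sub.fn_union (σ := σ₁) (by rw [← c₁.isMatch_left, ← c₂.isMatch_left]; exact hp.disjoint)]
    exact (Sub.fn_union_subset _ _).trans (Set.union_subset_union (h₁ hp.left) (h₂ hp.right))
  | _ => exact subset_rfl

theorem map (h : Compat p σ q ρ) (f : N → N) (g₁ g₂ : Equiv.Perm N) :
    Compat (p.map f g₁) (σ.act g₁ f) (q.map f g₂) (ρ.act g₂ f) := by
  induction h with
  | comp _ _ h₁ h₂ => rw [Sub.act_union, Sub.act_union]; exact .comp h₁ h₂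
  | bind y hp hm he =>
    rw [Sub.act_singleton]
    refine .bind _ (by rw [Pat.fn_map, hp, Set.image_empty]) (hm.map f g₁) ?_
    rw [Sub.hat_act f g₁ hm.subset, he, Pat.map_toPat]
  | _ => simp only [Sub.act_empty, Pat.map]; constructor

/-- Undo a renaming of the binding names on the left. -/
theorem of_map_left {g : Equiv.Perm N}
    (h : Compat (p.map id g) (σ.act g id) q ρ) : Compat p σ q ρ := by
  have := h.map (fun x => x) g.symm 1
  rw [Pat.map_map, Sub.act_act, Sub.act_id] at this
  have h1 : p.map (fun x => id x) (fun x => g.symm (g x)) = p := by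
    have : (fun x => g.symm (g x)) = fun x => x := funext g.symm_apply_apply
    rw [this]; exact Pat.map_id p
  have h2 : q.map (fun x => x) (1 : Equiv.Perm N) = q := Pat.map_id q
  have h3 : g.symm * g = 1 := inv_mul_cancel g
  rw [h1, h2, h3] at this
  exact Sub.act_id σ ▸ this

theorem map_right {g : Equiv.Perm N} (h : Compat p σ q ρ) :
    Compat p σ (q.map id g) (ρ.act g id) := by
  have := h.map (fun x => x) 1 g
  rw [Sub.act_id] at this
  have h1 : p.map (fun x => x) (1 : Equiv.Perm N) = p := Pat.map_id p
  rw [h1] at this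
  exact this

theorem refl (hp : p.WellFormed) (h : IsMatch p σ) : Compat p σ p σ := by
  induction p generalizing σ with
  | bind x =>
    have hx : x ∈ σ.dom := h ▸ (show x ∈ (Pat.bind x : Pat N N).bn by simp [Pat.bn, Pat.binders])
    obtain ⟨c, hc⟩ := Sub.mem_dom.1 hx
    have : σ = Finmap.singleton x c := Finmap.ext_lookup fun y => by
      rw [Sub.lookup_singleton]
      split_ifs with hy
      · rw [hy, hc]
      · rw [Sub.lookup_eq_none, ← h]; simpa [Pat.bn, Pat.binders] using hy
    subst this
    exact .bind x (by simp [Pat.fn, Pat.vn, Pat.pn]) h (by simp [Sub.hat])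
  | var x =>
    have : σ = ∅ := Finmap.ext_lookup fun y => by
      rw [Finmap.lookup_empty, Sub.lookup_eq_none, ← h]; simp [Pat.bn, Pat.binders]
    subst this; exact .var x
  | prot x =>
    have : σ = ∅ := Finmap.ext_lookup fun y => by
      rw [Finmap.lookup_empty, Sub.lookup_eq_none, ← h]; simp [Pat.bn, Pat.binders]
    subst this; exact .prot x
  | comp p q hp' hq' =>
    have hf : p.bn.Finite := p.bn_finite
    have hf' : q.bn.Finite := q.bn_finite
    rw [IsMatch, Pat.bn_comp] at h
    have : σ = Sub.ofFun hf.toFinset σ.app ∪ Sub.ofFun hf'.toFinset σ.app :=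
      Finmap.ext_lookup fun y => by
        rw [Sub.lookup_union, Sub.lookup_ofFun, Sub.lookup_ofFun]
        by_cases hy : y ∈ σ.dom
        · obtain ⟨c, hc⟩ := Sub.mem_dom.1 hy
          rw [Sub.app_of_lookup hc, hc]
          rw [← h] at hy
          by_cases hy' : y ∈ p.bn
          · rw [if_pos (hf.mem_toFinset.2 hy')]; rfl
          · rw [if_neg (mt hf.mem_toFinset.1 hy'),
              if_pos (hf'.mem_toFinset.2 (hy.resolve_left hy'))]
            rfl
        · rw [Sub.lookup_eq_none.2 hy]
          rw [← h] at hy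
          rw [if_neg (mt hf.mem_toFinset.1 fun h => hy (.inl h)),
            if_neg (mt hf'.mem_toFinset.1 fun h => hy (.inr h))]
          rfl
    rw [this]
    exact .comp (hp' hp.left (by rw [IsMatch, Sub.dom_ofFun, hf.coe_toFinset]))
      (hq' hp.right (by rw [IsMatch, Sub.dom_ofFun, hf'.coe_toFinset]))

/-- A pattern without free names whose instance under `σ` is the communicable pattern `c` unifies,
with result `σ`, with `c` only. -/
theorem unify_closed {θ : Sub N} {c : CPat N} (hp : p.WellFormed) (hf : p.fn = ∅)
    (he : σ.hat p = c.toPat) (hu : Unify p q σ θ) : q = c.toPat ∧ θ = ∅ := by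
  induction p generalizing q σ θ c with
  | bind x =>
    generalize hr : (Pat.bind x : Pat N N) = r at hu
    cases hu with
    | bind_left y d =>
      cases hr
      simp only [Sub.hat, Finmap.lookup_singleton_eq, Option.map_some, Option.getD_some] at he
      exact ⟨he, rfl⟩
    | bind_right y d => cases d <;> simp [CPat.toPat] at hr
    | _ => simp at hr
  | var x => exact absurd hf (Set.Nonempty.ne_empty ⟨x, .inl rfl⟩)
  | prot x => exact absurd hf (Set.Nonempty.ne_empty ⟨x, .inr rfl⟩)
  | comp p₁ p₂ h₁ h₂ =>
    generalize hr : (Pat.comp p₁ p₂ : Pat N N) = r at hu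
    cases hu with
    | comp u₁ u₂ =>
      cases hr
      rename_i q₁ q₂ σ₁ σ₂ ρ₁ ρ₂
      rw [Pat.fn_comp, Set.union_empty_iff] at hf
      have e₁ : (σ₁ ∪ σ₂).hat p₁ = σ₁.hat p₁ := Sub.hat_congr fun x hx => by
        have hx' : x ∈ σ₁.dom := u₁.isMatch_left ▸ hx
        exact Finmap.lookup_union_left hx'
      have e₂ : (σ₁ ∪ σ₂).hat p₂ = σ₂.hat p₂ := Sub.hat_congr fun x hx => by
        have hx' : x ∉ σ₁.dom := u₁.isMatch_left ▸ Set.disjoint_right.1 hp.disjoint hx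
        exact Finmap.lookup_union_right hx'
      simp only [Sub.hat, e₁, e₂] at he
      cases c with
      | name y => simp [CPat.toPat] at he
      | comp c d =>
        simp only [CPat.toPat, Pat.comp.injEq] at he
        obtain ⟨rfl, rfl⟩ := h₁ hp.left hf.1 he.1 u₁
        obtain ⟨rfl, rfl⟩ := h₂ hp.right hf.2 he.2 u₂
        exact ⟨rfl, Finmap.empty_union⟩
    | bind_right y d =>
      rw [hr] at hf
      have := d.fn_nonempty
      rw [← CPat.vn_toPat (B := N)] at this
      rw [Pat.fn, Set.union_empty_iff] at hf
      exact absurd hf.1 this.ne_empty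
    | _ => simp at hr

/-- A communicable pattern is compatible with itself only. -/
theorem eq_of_toPat {c : CPat N} (h : Compat c.toPat σ q ρ) : q = c.toPat ∧ ρ = ∅ := by
  induction c generalizing σ q ρ with
  | name x =>
    cases h with
    | bind y hf _ _ => exact absurd hf (Set.Nonempty.ne_empty ⟨x, .inl rfl⟩)
    | var => exact ⟨rfl, rfl⟩
  | comp c d hc hd =>
    cases h with
    | bind y hf _ _ =>
      rw [Pat.fn, CPat.vn_toPat (c.comp d), Set.union_empty_iff] at hf
      exact absurd hf.1 (CPat.fn_nonempty _).ne_empty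
    | comp h₁ h₂ =>
      obtain ⟨rfl, rfl⟩ := hc h₁
      obtain ⟨rfl, rfl⟩ := hd h₂
      exact ⟨rfl, Finmap.empty_union⟩

/-- A compatible reply unifies with whatever the challenge unifies with, and leaves the
substitution of the partner unchanged. -/
theorem unify {p' : Pat N N} {ρ' θ : Sub N} (hp : p.WellFormed) (h : Compat p σ p' ρ')
    (hu : Unify p q σ θ) : Unify p' q ρ' θ := by
  induction h generalizing q θ with
  | bind y hf hm he =>
    obtain ⟨rfl, rfl⟩ := unify_closed hp hf he hu
    exact .bind_left _ _
  | var n => exact hu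
  | prot n => exact hu
  | prot_var n =>
    generalize hr : (Pat.prot n : Pat N N) = r at hu
    generalize hs : (∅ : Sub N) = s at hu
    cases hu with
    | prot_var x => cases hr; exact .var_var _
    | prot_prot x => cases hr; exact .var_prot _
    | bind_right y d => cases d <;> simp [CPat.toPat] at hr
    | _ => simp at hr
  | comp c₁ c₂ h₁ h₂ =>
    rename_i p₁ p₂ q₁ q₂ σ₁ σ₂ ρ₁ ρ₂
    generalize hr : (Pat.comp p₁ p₂ : Pat N N) = r at hu
    generalize hs : σ₁ ∪ σ₂ = s at hu
    cases hu with
    | comp u₁ u₂ =>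
      cases hr
      have e₁ := c₁.isMatch_left
      have e₂ := c₂.isMatch_left
      obtain ⟨rfl, rfl⟩ := Sub.union_inj hs (by rw [← e₁]; exact u₁.isMatch_left)
        (by rw [← e₂]; exact u₂.isMatch_left) (by rw [← e₁, ← e₂]; exact hp.disjoint)
      exact .comp (h₁ hp.left u₁) (h₂ hp.right u₂)
    | bind_right y d =>
      cases d with
      | name => simp [CPat.toPat] at hr
      | comp d e =>
        cases hr
        obtain ⟨rfl, rfl⟩ := eq_of_toPat c₁
        obtain ⟨rfl, rfl⟩ := eq_of_toPat c₂
        rw [Finmap.empty_union]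
        exact .bind_right y (d.comp e)
    | _ => simp at hr

end Compat

/-! ### Fresh renamings -/

/-- A finite set of names can be moved away from a finite set, by a permutation that fixes all
other names of the latter. -/
theorem exists_fresh_perm [Infinite N] {A F : Set N} (hA : A.Finite) (hF : F.Finite) :
    ∃ π : Equiv.Perm N, (∀ a ∈ A, π a ∉ F ∧ π a ∉ A) ∧ ∀ x ∈ F, x ∉ A → π x = x := by
  induction A, hA using Set.Finite.induction_on generalizing F with
  | empty => exact ⟨1, by simp, by simp⟩
  | @insert a A ha hA ih =>
    obtain ⟨π, h₁, h₂⟩ := ih (hF.insert a)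
    obtain ⟨b, hb⟩ := ((hF.union ((hA.insert a).union (hA.image π)))).exists_notMem
    simp only [Set.mem_union, Set.mem_insert_iff, Set.mem_image, not_or, not_exists, not_and] at hb
    have ha' : π a = a := h₂ a (.inl rfl) ha
    refine ⟨Equiv.swap a b * π, ?_, ?_⟩
    · rintro x (rfl | hx)
      · simp only [Equiv.Perm.mul_apply, ha', Equiv.swap_apply_left]
        exact ⟨hb.1, by simpa using hb.2.1⟩
      · have h := h₁ x hx
        simp only [Set.mem_insert_iff, not_or] at h
        rw [Equiv.Perm.mul_apply, Equiv.swap_apply_of_ne_of_ne h.1.1 (hb.2.2 x hx)]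
        exact ⟨h.1.2, by simpa using ⟨h.1.1, h.2⟩⟩
    · rintro x hx hxA
      simp only [Set.mem_insert_iff, not_or] at hxA
      rw [Equiv.Perm.mul_apply, h₂ x (.inr hx) hxA.2, Equiv.swap_apply_of_ne_of_ne hxA.1]
      rintro rfl; exact hb.1 hx

/-! ### Names in transitions -/

/-- The names bound by a label in the target of a transition. -/
def Label.bound : Label N → Set N
  | .tau => ∅
  | .act ns p => ↑ns ∪ p.bn

theorem Label.bound_subset (μ : Label N) : μ.bound ⊆ μ.names := by
  cases μ with
  | tau => exact subset_rfl
  | act ns p => exact Set.subset_union_left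

theorem Label.names_finite (μ : Label N) : μ.names.Finite := by
  cases μ with
  | tau => exact Set.finite_empty
  | act ns p => exact (ns.finite_toSet.union p.bn_finite).union p.fn_finite

/-- Renaming of labels. -/
def Label.ren (π : Equiv.Perm N) : Label N → Label N
  | .tau => .tau
  | .act ns p => .act (ns.map π.toEmbedding) (p.map π π)

theorem Label.names_ren (π : Equiv.Perm N) (μ : Label N) : (μ.ren π).names = π '' μ.names := by
  cases μ with
  | tau => exact (Set.image_empty _).symm
  | act ns p =>
    simp only [ren, names, Pat.bn_map, Pat.fn_map, Set.image_union, Finset.coe_map,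
      Equiv.coe_toEmbedding]

theorem map_perm_eq_self {π : Equiv.Perm N} {s : Finset N} (h : ∀ x ∈ s, π x = x) :
    s.map π.toEmbedding = s := by
  ext x
  simp only [Finset.mem_map_equiv]
  constructor
  · intro hx
    have := h _ hx
    rw [Equiv.apply_symm_apply] at this
    rwa [this]
  · intro hx
    have : π.symm x = x := by rw [Equiv.symm_apply_eq, h x hx]
    rwa [this]

theorem Label.ren_eq_self {π : Equiv.Perm N} {μ : Label N} (h : ∀ x ∈ μ.names, π x = x) :
    μ.ren π = μ := by
  cases μ with
  | tau => rfl
  | act ns p =>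
    rw [ren, map_perm_eq_self fun x hx => h x (.inl (.inl hx)),
      Pat.map_congr (f' := fun x => x) (g' := fun x => x) (fun x hx => h x (.inr hx))
        (fun x hx => h x (.inl (.inr hx))), Pat.map_id]

theorem Step.ren {P P' : Proc N} {μ : Label N} (π : Equiv.Perm N) (h : Step P μ P') :
    Step (P.ren π) (μ.ren π) (P'.ren π) := by
  have hd {A B : Set N} (h : Disjoint A B) : Disjoint (π '' A) (π '' B) :=
    (Set.disjoint_image_iff π.injective).2 h
  have hl {ns : Finset N} {p : Pat N N} {Q : Proc N} (h : Disjoint (↑ns ∪ p.bn) Q.fn) :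
      Disjoint (↑(ns.map π.toEmbedding) ∪ (p.map π π).bn) (Q.ren π).fn := by
    have := hd h
    rwa [Set.image_union, ← Pat.bn_map π, ← Proc.fn_ren, ← Equiv.coe_toEmbedding,
      ← Finset.coe_map] at this
  induction h with
  | case p P hp =>
    rw [Proc.ren_pre]
    exact .case _ _ (hp.map (hd hp.2))
  | resnon n _ hn ih =>
    rw [Proc.ren_new, Proc.ren_new]
    refine .resnon _ ih ?_
    rw [Label.names_ren]
    simpa using hn
  | @unify P P' Q Q' ms ns p q σ ρ l _ _ hu h₁ h₂ h₃ h₄ h₅ ih₁ ih₂ =>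
    rw [Proc.ren_news]
    change Step ((P.ren π).par (Q.ren π)) .tau (Proc.news _ (((σ.onProc P').ren π).par
      ((ρ.onProc Q').ren π)))
    rw [Sub.ren_onProc, Sub.ren_onProc]
    refine .unify _ ih₁ ih₂ (hu.map π π π) ?_ ?_ ?_ (h₄.map π.injective) ?_
    · rw [Proc.fn_ren, Finset.coe_map]; exact hd h₁
    · rw [Proc.fn_ren, Finset.coe_map]; exact hd h₂
    · rwa [Finset.disjoint_map]
    · rw [← Finset.map_union, ← h₅]; ext; simp [← Equiv.eq_symm_apply]
  | parint_left Q _ ih => exact .parint_left _ ih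
  | parint_right P _ ih => exact .parint_right _ ih
  | parext_left Q _ h ih => exact .parext_left _ ih (hl h)
  | parext_right P _ h ih => exact .parext_right _ ih (hl h)
  | rep _ ih => exact .rep ih
  | _ =>
    rename_i P P' ns p m hs hm ih
    rw [Proc.ren_new]
    have : Label.ren π (.act (insert m ns) p) =
        .act (insert (π m) (ns.map π.toEmbedding)) (p.map π π) := by
      rw [Label.ren, Finset.map_insert]; rfl
    rw [this]
    refine .open _ ih ?_
    rw [Pat.vn_map, Pat.pn_map, Pat.bn_map, Finset.coe_map, Equiv.coe_toEmbedding,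
      ← Set.image_union, ← Set.image_union, ← Set.image_sdiff π.injective]
    exact ⟨m, hm, rfl⟩

/-- What the names in an action `P --(ν ns) p--> P'` satisfy. -/
structure ActionNames (P : Proc N) (ns : Finset N) (p : Pat N N) (P' : Proc N) : Prop where
  wellFormed : p.WellFormed
  ns_fresh : ∀ x ∈ ns, x ∉ P.fn
  bn_fresh : ∀ x ∈ p.bn, x ∉ P.fn
  ns_bn : ∀ x ∈ ns, x ∉ p.bn
  ns_vn : ∀ x ∈ ns, x ∈ p.vn
  ns_pn : ∀ x ∈ ns, x ∉ p.pn
  fn_label : ∀ x ∈ p.fn, x ∈ P.fn ∨ x ∈ ns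
  fn_target : ∀ x ∈ P'.fn, x ∈ P.fn ∨ x ∈ ns ∨ x ∈ p.bn

theorem Step.names {P P' : Proc N} {μ : Label N} (h : Step P μ P') :
    match μ with
    | .tau => P'.fn ⊆ P.fn
    | .act ns p => ActionNames P ns p P' := by
  induction h with
  | case p P hp =>
    refine ⟨hp, by simp, fun x hx hx' => ?_, by simp, by simp, by simp, fun x hx => ?_,
      fun x hx => ?_⟩
    · rw [Proc.fn_pre] at hx'
      rcases hx' with h | h
      · exact Set.disjoint_left.1 hp.2 hx h
      · exact h.2 hx
    · rw [Proc.fn_pre]; exact .inl (.inl hx)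
    · rw [Proc.fn_pre]
      by_cases h : x ∈ p.bn
      · exact .inr (.inr h)
      · exact .inl (.inr ⟨hx, h⟩)
  | @resnon P P' μ n _ hn ih =>
    cases μ with
    | tau =>
      simp only at ih ⊢
      rw [Proc.fn_new, Proc.fn_new]
      exact Set.sdiff_subset_sdiff_left ih
    | act ns p =>
      simp only [Label.names, Set.mem_union, not_or, Finset.mem_coe] at hn
      obtain ⟨a, b, c, d, e, f, g, k⟩ := ih
      refine ⟨a, ?_, ?_, d, e, f, ?_, ?_⟩ <;> simp only [Proc.fn_new, Set.mem_sdiff,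
        Set.mem_singleton_iff]
      · exact fun x hx h => b x hx h.1
      · exact fun x hx h => c x hx h.1
      · intro x hx
        refine (g x hx).imp_left fun h => ⟨h, ?_⟩
        rintro rfl; exact hn.2 hx
      · exact fun x hx => (k x hx.1).imp_left fun h => ⟨h, hx.2⟩
  | @unify P P' Q Q' ms ns p q σ ρ l _ _ hu h₁ h₂ h₃ h₄ h₅ ih₁ ih₂ =>
    intro x hx
    rw [Proc.mem_fn_news] at hx
    have hl : x ∉ ms ∧ x ∉ ns := by
      rw [← not_or, ← Finset.mem_union, ← h₅, List.mem_toFinset]; exact hx.2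
    rcases hx.1 with h | h <;> rcases Sub.fn_onProc_subset h with h | h
    · exact .inr ((ih₂.fn_label x (.inl (hu.fn_left h))).resolve_right hl.2)
    · exact .inl ((ih₁.fn_target x h.1).resolve_right
        (not_or.2 ⟨hl.1, fun h' => h.2 (hu.isMatch_left ▸ h')⟩))
    · exact .inl ((ih₁.fn_label x (.inl (hu.fn_right h))).resolve_right hl.1)
    · exact .inr ((ih₂.fn_target x h.1).resolve_right
        (not_or.2 ⟨hl.2, fun h' => h.2 (hu.isMatch_right ▸ h')⟩))
  | parint_left Q _ ih => exact Set.union_subset_union_left _ ih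
  | parint_right P _ ih => exact Set.union_subset_union_right _ ih
  | parext_left Q _ h ih =>
    obtain ⟨a, b, c, d, e, f, g, k⟩ := ih
    rw [Set.disjoint_left] at h
    refine ⟨a, ?_, ?_, d, e, f, ?_, ?_⟩ <;> simp only [Proc.fn, Set.mem_union]
    · exact fun x hx => not_or.2 ⟨b x hx, h (.inl hx)⟩
    · exact fun x hx => not_or.2 ⟨c x hx, h (.inr hx)⟩
    · intro x hx
      have := g x hx
      tauto
    · intro x hx
      have := k x
      tauto
  | parext_right Q _ h ih =>
    obtain ⟨a, b, c, d, e, f, g, k⟩ := ih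
    rw [Set.disjoint_left] at h
    refine ⟨a, ?_, ?_, d, e, f, ?_, ?_⟩ <;> simp only [Proc.fn, Set.mem_union]
    · exact fun x hx => not_or.2 ⟨h (.inl hx), b x hx⟩
    · exact fun x hx => not_or.2 ⟨h (.inr hx), c x hx⟩
    · intro x hx
      have := g x hx
      tauto
    · intro x hx
      have := k x
      tauto
  | @rep P P' μ _ ih =>
    have h : (P.rep.par P).fn = P.rep.fn := Set.union_self _
    cases μ with
    | tau => simp only at ih ⊢; rwa [← h]
    | act ns p => exact ⟨ih.1, h ▸ ih.2, h ▸ ih.3, ih.4, ih.5, ih.6, h ▸ ih.7, h ▸ ih.8⟩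
  | _ =>
    rename_i P P' ns p m hs hm ih
    simp only [Set.mem_sdiff, Set.mem_union, not_or, Finset.mem_coe] at hm
    obtain ⟨a, b, c, d, e, f, g, k⟩ := ih
    refine ⟨a, ?_, ?_, ?_, ?_, ?_, ?_, ?_⟩ <;> simp only [Proc.fn_new, Set.mem_sdiff,
      Set.mem_singleton_iff, Finset.mem_insert]
    · rintro x (rfl | hx) h
      · exact h.2 rfl
      · exact b x hx h.1
    · exact fun x hx h => c x hx h.1
    · rintro x (rfl | hx)
      · exact hm.2.2
      · exact d x hx
    · rintro x (rfl | hx)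
      · exact hm.1
      · exact e x hx
    · rintro x (rfl | hx)
      · exact hm.2.1.2
      · exact f x hx
    · intro x hx
      have := g x hx
      tauto
    · intro x hx
      have := k x hx
      tauto

theorem Step.actionNames {P P' : Proc N} {ns : Finset N} {p : Pat N N}
    (h : Step P (.act ns p) P') : ActionNames P ns p P' := h.names

theorem Step.fn_target {P P' : Proc N} {μ : Label N} (h : Step P μ P') :
    P'.fn ⊆ P.fn ∪ μ.bound := by
  cases μ with
  | tau => exact h.names.trans Set.subset_union_left
  | act ns p => exact h.actionNames.fn_target

/-- The binding names of a label can be renamed to fresh ones; an instance of the target does not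
change. -/
theorem Step.rename_binders [Infinite N] {P P' : Proc N} {ns : Finset N} {p : Pat N N}
    {σ : Sub N} (h : Step P (.act ns p) P') (hσ : IsMatch p σ) {F : Set N} (hF : F.Finite) :
    ∃ π : Equiv.Perm N, (∀ x ∈ (p.map id π).bn, x ∉ F) ∧
      Step P (.act ns (p.map id π)) (P'.ren π) ∧
      (σ.act π id).onProc (P'.ren π) = σ.onProc P' := by
  have hn := h.actionNames
  obtain ⟨π, h₁, h₂⟩ := exists_fresh_perm p.bn_finite
    ((((hF.union P.fn_finite).union P'.fn_finite).union p.fn_finite).union ns.finite_toSet)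
  have hP : P.ren π = P := Proc.ren_eq_self fun x hx =>
    h₂ x (.inl (.inl (.inl (.inr hx)))) fun h => hn.bn_fresh x h hx
  have hns : ns.map π.toEmbedding = ns := map_perm_eq_self fun x hx =>
    h₂ x (.inr hx) (hn.ns_bn x hx)
  have hp : p.map π π = p.map id π := Pat.map_congr (fun x hx =>
    h₂ x (.inl (.inr hx)) (Set.disjoint_right.1 hn.wellFormed.2 hx)) fun _ _ => rfl
  refine ⟨π, ?_, ?_, ?_⟩
  · rw [Pat.bn_map]
    rintro _ ⟨x, hx, rfl⟩ h
    exact (h₁ x hx).1 (.inl (.inl (.inl (.inl h))))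
  · have := h.ren π
    rwa [hP, Label.ren, hns, hp] at this
  · rw [Sub.onProc, Proc.ren, Proc.subst_comp, Sub.onProc]
    refine Proc.subst_congr fun x hx => ?_
    simp only [CPat.bind]
    by_cases hxp : x ∈ σ.dom
    · rw [Sub.app_act _ _ hxp]; exact CPat.map_id _
    · have hx' : x ∉ p.bn := by rwa [hσ]
      have := h₂ x (.inl (.inl (.inr hx))) hx'
      rw [this, Sub.app_of_notMem hxp, Sub.app_of_notMem]
      rw [Sub.dom_act]
      rintro ⟨y, hy, he⟩
      rw [← this, π.injective.eq_iff] at he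
      exact hxp (he ▸ hy)

/-! ### Inversion of transitions -/

theorem Step.par_left {P P' : Proc N} {μ : Label N} (h : Step P μ P') {Q : Proc N}
    (hd : Disjoint μ.bound Q.fn) : Step (P.par Q) μ (P'.par Q) := by
  cases μ with
  | tau => exact .parint_left _ h
  | act ns p => exact .parext_left _ h hd

theorem Step.par_right {Q Q' : Proc N} {μ : Label N} (h : Step Q μ Q') {P : Proc N}
    (hd : Disjoint μ.bound P.fn) : Step (P.par Q) μ (P.par Q') := by
  cases μ with
  | tau => exact .parint_right _ h
  | act ns p => exact .parext_right _ h hd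

/-- `Interaction F P Q R`: the parallel composition of `P` and `Q` evolves to `R` by a unification
of two actions none of whose bound names is in `F`. -/
inductive Interaction (F : Set N) (P Q : Proc N) : Proc N → Prop
  | mk {P' Q' : Proc N} {ms ns : Finset N} {p q : Pat N N} {σ ρ : Sub N} (l : List N) :
      Step P (.act ms p) P' → Step Q (.act ns q) Q' → Unify p q σ ρ →
      (∀ x ∈ ms, x ∉ Q.fn) → (∀ x ∈ ns, x ∉ P.fn) → (∀ x ∈ ms, x ∉ ns) →
      l.Nodup → (∀ x, x ∈ l ↔ x ∈ ms ∨ x ∈ ns) →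
      (∀ x ∈ ms, x ∉ F) → (∀ x ∈ ns, x ∉ F) → (∀ x ∈ p.bn, x ∉ F) → (∀ x ∈ q.bn, x ∉ F) →
      Interaction F P Q (Proc.news l ((σ.onProc P').par (ρ.onProc Q')))

theorem Proc.news_eq_ren {xs : List N} {P : Proc N} {π : Equiv.Perm N}
    (h : ∀ x ∈ P.fn, x ∉ xs → π x = x) : news xs P = news (xs.map π) (P.ren π) := by
  rw [← ren_news, ren_eq_self]
  intro x hx
  rw [mem_fn_news] at hx
  exact h x hx.1 hx.2

theorem Step.interaction [Infinite N] {P P' Q Q' : Proc N} {ms ns : Finset N} {p q : Pat N N}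
    {σ ρ : Sub N} {l : List N} (hP : Step P (.act ms p) P') (hQ : Step Q (.act ns q) Q')
    (hu : Unify p q σ ρ) (h₁ : Disjoint (↑ms) Q.fn) (h₂ : Disjoint (↑ns) P.fn)
    (h₃ : Disjoint ms ns) (hl : l.Nodup) (hl' : l.toFinset = ms ∪ ns) {F : Set N}
    (hF : F.Finite) :
    Interaction F P Q (Proc.news l ((σ.onProc P').par (ρ.onProc Q'))) := by
  have hmem (x : N) : x ∈ l ↔ x ∈ ms ∨ x ∈ ns := by
    rw [← List.mem_toFinset, hl', Finset.mem_union]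
  set X := (σ.onProc P').par (ρ.onProc Q') with hX
  -- The restricted names are moved first, in both actions together, then the binding names.
  obtain ⟨π, hπ₁, hπ₂⟩ := exists_fresh_perm (ms ∪ ns).finite_toSet
    (((hF.union P.fn_finite).union Q.fn_finite).union X.fn_finite)
  simp only [Finset.coe_union, Set.mem_union, Finset.mem_coe] at hπ₁ hπ₂
  have eX : Proc.news l X = Proc.news (l.map π) (X.ren π) :=
    Proc.news_eq_ren fun x hx hxl => hπ₂ x (.inr hx) (by rwa [← hmem])
  have eP : P.ren π = P := Proc.ren_eq_self fun x hx =>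
    hπ₂ x (.inl (.inl (.inr hx))) (not_or.2
      ⟨fun h => hP.actionNames.ns_fresh x h hx, fun h => Set.disjoint_left.1 h₂ h hx⟩)
  have eQ : Q.ren π = Q := Proc.ren_eq_self fun x hx =>
    hπ₂ x (.inl (.inr hx)) (not_or.2
      ⟨fun h => Set.disjoint_left.1 h₁ h hx, fun h => hQ.actionNames.ns_fresh x h hx⟩)
  have hP₁ := hP.ren π
  have hQ₁ := hQ.ren π
  rw [eP, Label.ren] at hP₁
  rw [eQ, Label.ren] at hQ₁
  have hu₁ := hu.map π π π
  have hmsF : ∀ x ∈ ms.map π.toEmbedding, x ∉ F ∧ x ∉ Q.fn := by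
    intro x hx
    obtain ⟨y, hy, rfl⟩ := Finset.mem_map.1 hx
    exact ⟨fun h => (hπ₁ y (.inl hy)).1 (.inl (.inl (.inl h))),
      fun h => (hπ₁ y (.inl hy)).1 (.inl (.inr h))⟩
  have hnsF : ∀ x ∈ ns.map π.toEmbedding, x ∉ F ∧ x ∉ P.fn := by
    intro x hx
    obtain ⟨y, hy, rfl⟩ := Finset.mem_map.1 hx
    exact ⟨fun h => (hπ₁ y (.inr hy)).1 (.inl (.inl (.inl h))),
      fun h => (hπ₁ y (.inr hy)).1 (.inl (.inl (.inr h)))⟩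
  have hmn : ∀ x ∈ ms.map π.toEmbedding, x ∉ ns.map π.toEmbedding :=
    fun _ hx => Finset.disjoint_left.1 ((Finset.disjoint_map π.toEmbedding).2 h₃) hx
  have e₁ : X.ren π = ((σ.act π π).onProc (P'.ren π)).par ((ρ.act π π).onProc (Q'.ren π)) := by
    rw [← Sub.ren_onProc, ← Sub.ren_onProc]; rfl
  obtain ⟨α, hα, hP₂, eP₂⟩ := hP₁.rename_binders hu₁.isMatch_left hF
  obtain ⟨β, hβ, hQ₂, eQ₂⟩ := hQ₁.rename_binders hu₁.isMatch_right hF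
  rw [eX, e₁, ← eP₂, ← eQ₂]
  refine .mk _ hP₂ hQ₂ (hu₁.map id α β) (fun x hx => (hmsF x hx).2) (fun x hx => (hnsF x hx).2)
    hmn (hl.map π.injective) ?_ (fun x hx => (hmsF x hx).1) (fun x hx => (hnsF x hx).1) hα hβ
  intro x
  simp only [List.mem_map, hmem, Finset.mem_map, Equiv.coe_toEmbedding, or_and_right, exists_or]

theorem Interaction.step {F : Set N} {P Q R : Proc N} (h : Interaction F P Q R) :
    Step (P.par Q) .tau R := by
  cases h with
  | mk l hP hQ hu h₁ h₂ h₃ hl hl' =>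
    exact .unify l hP hQ hu (Set.disjoint_left.2 h₁) (Set.disjoint_left.2 h₂)
      (Finset.disjoint_left.2 h₃) hl (by ext; simp [hl'])

theorem Step.par_inv [Infinite N] {P Q R : Proc N} {μ : Label N} (h : Step (P.par Q) μ R)
    {F : Set N} (hF : F.Finite) :
    (μ = .tau ∧ Interaction F P Q R) ∨
    (∃ P', Step P μ P' ∧ Disjoint μ.bound Q.fn ∧ R = P'.par Q) ∨
    ∃ Q', Step Q μ Q' ∧ Disjoint μ.bound P.fn ∧ R = P.par Q' := by
  generalize hX : P.par Q = X at h
  cases h with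
  | case => simp [Proc.pre] at hX
  | resnon => simp [Proc.new] at hX
  | rep => simp at hX
  | unify l hP hQ hu h₁ h₂ h₃ hl hl' =>
    cases hX
    exact .inl ⟨rfl, hP.interaction hQ hu h₁ h₂ h₃ hl hl' hF⟩
  | parint_left _ h => cases hX; exact .inr (.inl ⟨_, h, Set.empty_disjoint _, rfl⟩)
  | parint_right _ h => cases hX; exact .inr (.inr ⟨_, h, Set.empty_disjoint _, rfl⟩)
  | parext_left _ h hd => cases hX; exact .inr (.inl ⟨_, h, hd, rfl⟩)
  | parext_right _ h hd => cases hX; exact .inr (.inr ⟨_, h, hd, rfl⟩)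
  | _ => simp [Proc.new] at hX

theorem Step.new_inv {n : N} {P R : Proc N} {μ : Label N} (h : Step (Proc.new n P) μ R)
    (hn : n ∉ μ.names) :
    (∃ P', Step P μ P' ∧ R = Proc.new n P') ∨
    ∃ m ns p, μ = .act (insert m ns) p ∧ m ∈ p.vn \ (↑ns ∪ p.pn ∪ p.bn) ∧
      m ∉ (Proc.new n P).fn ∧ Step (P.ren (Equiv.swap n m)) (.act ns p) R := by
  generalize hX : Proc.new n P = X at h
  cases h with
  | case => simp [Proc.new, Proc.pre] at hX
  | @resnon P₀ P₀' _ k h hk =>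
    left
    obtain ⟨e, hn'⟩ := Proc.eq_ren_of_new_eq hX.symm
    have h' := h.ren (Equiv.swap k n)
    rw [← e, Label.ren_eq_self fun x hx => Equiv.swap_apply_of_ne_of_ne
      (ne_of_mem_of_not_mem hx hk) (ne_of_mem_of_not_mem hx hn)] at h'
    refine ⟨_, h', Proc.new_eq_ren ?_⟩
    rw [Proc.fn_new] at hn' ⊢
    rintro ⟨h₁, h₂⟩
    rcases h.fn_target h₁ with h₁ | h₁
    · exact hn' ⟨h₁, h₂⟩
    · exact hn (Label.bound_subset _ h₁)
  | unify => simp [Proc.new] at hX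
  | parint_left => simp [Proc.new] at hX
  | parint_right => simp [Proc.new] at hX
  | parext_left => simp [Proc.new] at hX
  | parext_right => simp [Proc.new] at hX
  | rep => simp [Proc.new] at hX
  | _ =>
    rename_i P₀ ns p m hm h
    right
    obtain ⟨e, hm'⟩ := Proc.eq_ren_of_new_eq hX
    exact ⟨m, ns, p, rfl, hm, hX ▸ hm', e ▸ h⟩

theorem Step.rep_inv {P R : Proc N} {μ : Label N} (h : Step P.rep μ R) :
    Step (P.rep.par P) μ R := by
  generalize hX : P.rep = X at h
  cases h with
  | case => simp [Proc.pre] at hX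
  | resnon => simp [Proc.new] at hX
  | rep h => cases hX; exact h
  | unify => simp at hX
  | parint_left => simp at hX
  | parint_right => simp at hX
  | parext_left => simp at hX
  | parext_right => simp at hX
  | _ => simp [Proc.new] at hX

theorem Step.pre_inv {p : Pat N N} {P R : Proc N} {μ : Label N} (h : Step (Proc.pre p P) μ R) :
    ∃ q, q.WellFormed ∧ μ = .act ∅ q ∧ Proc.pre p P = Proc.pre q R := by
  generalize hX : Proc.pre p P = X at h
  cases h with
  | case q _ hq => exact ⟨q, hq, rfl, rfl⟩
  | _ => simp [Proc.new, Proc.pre] at hX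

theorem not_step_zero {R : Proc N} {μ : Label N} : ¬ Step Proc.zero μ R := by
  intro h
  generalize hX : Proc.zero = X at h
  cases h with
  | _ => simp [Proc.pre, Proc.new] at hX

/-- The reply of `new n P` to an action of `P` that mentions `n`. -/
theorem Step.open_swap {n m : N} {P R : Proc N} {ns : Finset N} {p : Pat N N}
    (h : Step (P.ren (Equiv.swap n m)) (.act ns p) R) (hm : m ∈ p.vn \ (↑ns ∪ p.pn ∪ p.bn))
    (hn : m ∉ (Proc.new n P).fn) : Step (Proc.new n P) (.act (insert m ns) p) R := by
  rw [Proc.new_eq_ren hn]; exact .open m h hm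

/-! ### Structural congruence -/

/-- A substitution can be pushed into two cases with the same pattern simultaneously. -/
theorem Proc.exists_subst_pre [Infinite N] {p : Pat N N} (hp : p.WellFormed) (P P' : Proc N)
    (σ : N → CPat N) : ∃ (q : Pat N N) (τ : N → CPat N), q.WellFormed ∧
      (pre p P).subst σ = pre q (P.subst τ) ∧ (pre p P').subst σ = pre q (P'.subst τ) := by
  obtain ⟨π, h₁, -⟩ := exists_fresh_perm p.bn_finite
    (((P.subst σ).fn_finite.union (P'.subst σ).fn_finite).union (p.subst σ).fn_finite)
  have hf {P : Proc N} (h : ∀ x ∈ p.bn, π x ∉ (P.subst σ).fn) :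
      ∀ y ∈ P.fn, y ∉ p.bn → ∀ x ∈ p.bn, π x ∉ (σ y).fn :=
    fun y hy _ x hx hxy => h x hx (Proc.mem_fn_subst.2 ⟨y, hy, hxy⟩)
  refine ⟨_, _, ⟨?_, ?_⟩,
    subst_pre π.injective.injOn (hf fun x hx h => (h₁ x hx).1 (.inl (.inl h))),
    subst_pre π.injective.injOn (hf fun x hx h => (h₁ x hx).1 (.inl (.inr h)))⟩
  · rw [Pat.binders_subst, Pat.binders_map]; exact hp.1.map π.injective
  · rw [Set.disjoint_left]
    intro y hy hy'
    rw [Pat.bn, Pat.binders_subst] at hy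
    replace hy : y ∈ (p.map id π).bn := hy
    rw [Pat.bn_map] at hy
    obtain ⟨x, hx, rfl⟩ := hy
    refine (h₁ x hx).1 (.inr ?_)
    rw [Pat.mem_fn_subst] at hy' ⊢
    rwa [Pat.fn_map, Set.image_id] at hy'

namespace Struct

theorem fn_eq {P Q : Proc N} (h : Struct P Q) : P.fn = Q.fn := by
  induction h with
  | refl P => rfl
  | symm _ ih => exact ih.symm
  | trans _ _ h₁ h₂ => exact h₁.trans h₂
  | par_congr _ _ h₁ h₂ => simp only [Proc.fn, h₁, h₂]
  | rep_congr _ h => exact h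
  | new_congr n _ h => rw [Proc.fn_new, Proc.fn_new, h]
  | pre_congr p _ _ h => rw [Proc.fn_pre, Proc.fn_pre, h]
  | par_zero P => exact Set.union_empty _
  | par_comm P Q => exact Set.union_comm _ _
  | par_assoc P Q R => exact (Set.union_assoc _ _ _).symm
  | new_zero n => rw [Proc.fn_new]; exact Set.empty_sdiff _
  | new_comm n m P => simp only [Proc.fn_new]; exact Set.sdiff_sdiff_comm
  | rep_unfold P => exact (Set.union_self _).symm
  | scope n P Q hn =>
    simp only [Proc.fn, Proc.fn_new, Set.union_sdiff_distrib]
    rw [Set.sdiff_singleton_eq_self hn]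

theorem subst [Infinite N] {P Q : Proc N} (h : Struct P Q) (σ : N → CPat N) :
    Struct (P.subst σ) (Q.subst σ) := by
  have fresh {P : Proc N} {σ : N → CPat N} {z x : N} (hz : z ∉ (P.subst σ).fn) :
      ∀ y ∈ P.fn, y ≠ x → z ∉ (σ y).fn := fun y hy _ h => hz (Proc.mem_fn_subst.2 ⟨y, hy, h⟩)
  induction h generalizing σ with
  | refl P => exact .refl _
  | symm _ ih => exact (ih σ).symm
  | trans _ _ h₁ h₂ => exact (h₁ σ).trans (h₂ σ)
  | par_congr _ _ h₁ h₂ => exact .par_congr (h₁ σ) (h₂ σ)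
  | rep_congr _ h => exact .rep_congr (h σ)
  | @new_congr n P P' _ ih =>
    obtain ⟨z, hz⟩ := ((P.subst σ).fn_finite.union (P'.subst σ).fn_finite).exists_notMem
    rw [Set.mem_union, not_or] at hz
    rw [Proc.subst_new (fresh hz.1), Proc.subst_new (fresh hz.2)]
    exact .new_congr _ (ih _)
  | @pre_congr p P P' hp _ ih =>
    obtain ⟨q, τ, hq, e, e'⟩ := Proc.exists_subst_pre hp P P' σ
    rw [e, e']
    exact .pre_congr _ hq (ih _)
  | par_zero P => exact .par_zero _
  | par_comm P Q => exact .par_comm _ _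
  | par_assoc P Q R => exact .par_assoc _ _ _
  | new_zero n =>
    rw [Proc.subst_new (z := n) (by intro y hy; simp [Proc.fn] at hy)]
    exact .new_zero n
  | new_comm n m P =>
    by_cases hnm : n = m
    · subst hnm; exact .refl _
    obtain ⟨z, hz⟩ := (P.subst σ).fn_finite.exists_notMem
    obtain ⟨w, hw⟩ := ((P.subst σ).fn_finite.insert z).exists_notMem
    rw [Set.mem_insert_iff, not_or] at hw
    have key {n m z w : N} (hz : z ∉ (P.subst σ).fn) (hw : w ∉ (P.subst σ).fn) (hwz : w ≠ z) :
        (Proc.new n (Proc.new m P)).subst σ = Proc.new z (Proc.new w (P.subst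
          (Function.update (Function.update σ n (CPat.name z)) m (CPat.name w)))) := by
      rw [Proc.subst_new, Proc.subst_new]
      · intro y hy hym h
        by_cases hyn : y = n
        · subst hyn
          rw [Function.update_self] at h; exact hwz h
        · rw [Function.update_of_ne hyn] at h; exact fresh (x := n) hw y hy hyn h
      · intro y hy
        rw [Proc.fn_new] at hy
        exact fresh hz y hy.1
    rw [key hz hw.2 hw.1, key hw.2 hz (Ne.symm hw.1), Function.update_comm hnm]
    exact .new_comm _ _ _
  | rep_unfold P => exact .rep_unfold _
  | scope n P Q hn =>
    obtain ⟨z, hz⟩ := ((P.subst σ).fn_finite.union (Q.subst σ).fn_finite).exists_notMem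
    rw [Set.mem_union, not_or] at hz
    have hP : P.subst (Function.update σ n (CPat.name z)) = P.subst σ :=
      Proc.subst_congr fun x hx => Function.update_of_ne (ne_of_mem_of_not_mem hx hn) _ _
    have h : ((P.par Q).subst σ).fn = (P.subst σ).fn ∪ (Q.subst σ).fn := rfl
    rw [Proc.subst_new (P := P.par Q) (z := z) (fresh (by rw [h]; simp [hz]))]
    change Struct ((P.subst σ).par ((Proc.new n Q).subst σ)) (Proc.new z ((P.subst _).par _))
    rw [Proc.subst_new (fresh hz.2), hP]
    exact .scope _ _ _ hz.1

theorem onProc [Infinite N] {P Q : Proc N} (h : Struct P Q) (σ : Sub N) :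
    Struct (σ.onProc P) (σ.onProc Q) := h.subst _

theorem ren [Infinite N] {P Q : Proc N} (h : Struct P Q) (f : N → N) :
    Struct (P.ren f) (Q.ren f) := h.subst _

theorem news_congr (l : List N) {P Q : Proc N} (h : Struct P Q) :
    Struct (Proc.news l P) (Proc.news l Q) := by
  induction l with
  | nil => exact h
  | cons x l ih => exact .new_congr x ih

theorem news_perm {l l' : List N} (h : l.Perm l') (P : Proc N) :
    Struct (Proc.news l P) (Proc.news l' P) := by
  induction h with
  | nil => exact .refl _
  | cons x _ ih => exact .new_congr x ih
  | swap x y l => exact .new_comm _ _ _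
  | trans _ _ h₁ h₂ => exact h₁.trans h₂

theorem news_new (l : List N) (n : N) (P : Proc N) :
    Struct (Proc.news l (Proc.new n P)) (Proc.new n (Proc.news l P)) := by
  have := news_perm (List.perm_append_singleton n l) P
  rwa [Proc.news, List.foldr_append] at this

theorem scope_news {l : List N} {P : Proc N} (h : ∀ x ∈ l, x ∉ P.fn) (Q : Proc N) :
    Struct (P.par (Proc.news l Q)) (Proc.news l (P.par Q)) := by
  induction l with
  | nil => exact .refl _
  | cons x l ih =>
    rw [List.forall_mem_cons] at h
    exact (scope x _ _ h.1).trans (.new_congr x (ih h.2))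

theorem scope_news' {l : List N} {P : Proc N} (h : ∀ x ∈ l, x ∉ P.fn) (Q : Proc N) :
    Struct ((Proc.news l Q).par P) (Proc.news l (Q.par P)) :=
  (par_comm _ _).trans ((scope_news h Q).trans (news_congr l (par_comm _ _)))

end Struct

/-! ### Structural congruence is a strong bisimulation -/

/-- Every transition of `P` is matched by a transition of `Q` with the same label, up to
structural congruence of the targets. -/
def StructSim (P Q : Proc N) : Prop :=
  ∀ μ P', Step P μ P' → ∃ Q', Step Q μ Q' ∧ Struct P' Q'

namespace StructSim

theorem refl (P : Proc N) : StructSim P P := fun _ P' h => ⟨P', h, .refl _⟩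

theorem trans {P Q R : Proc N} (h₁ : StructSim P Q) (h₂ : StructSim Q R) : StructSim P R := by
  intro μ P' h
  obtain ⟨Q', hQ, e⟩ := h₁ μ P' h
  obtain ⟨R', hR, e'⟩ := h₂ μ Q' hQ
  exact ⟨R', hR, e.trans e'⟩

theorem ren [Infinite N] {P Q : Proc N} (h : StructSim P Q) (π : Equiv.Perm N) :
    StructSim (P.ren π) (Q.ren π) := by
  have hπ (P : Proc N) : (P.ren π).ren π.symm = P := by
    rw [Proc.ren_ren, Proc.ren_eq_self]; simp
  have hπ' (P : Proc N) : (P.ren π.symm).ren π = P := by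
    rw [Proc.ren_ren, Proc.ren_eq_self]; simp
  have hμ (μ : Label N) : (μ.ren π.symm).ren π = μ := by
    cases μ with
    | tau => rfl
    | act ns p =>
      simp only [Label.ren, Finset.map_map, Pat.map_map, Equiv.apply_symm_apply, Pat.map_id]
      congr 1
      ext; simp
  intro μ P' hs
  have hs' := hs.ren π.symm
  rw [hπ] at hs'
  obtain ⟨Q', hQ, e⟩ := h _ _ hs'
  refine ⟨Q'.ren π, ?_, ?_⟩
  · have := hQ.ren π
    rwa [hμ] at this
  · have := e.ren π
    rwa [hπ'] at this

theorem par [Infinite N] {P P₁ Q Q₁ : Proc N} (hP : StructSim P P₁) (hQ : StructSim Q Q₁)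
    (eP : Struct P P₁) (eQ : Struct Q Q₁) : StructSim (P.par Q) (P₁.par Q₁) := by
  intro μ R hs
  rcases hs.par_inv Set.finite_empty with ⟨rfl, h⟩ | ⟨P', h, hd, rfl⟩ | ⟨Q', h, hd, rfl⟩
  · cases h with
    | mk l h₁ h₂ hu a b c d e f g i j =>
      obtain ⟨P', h₁', e₁⟩ := hP _ _ h₁
      obtain ⟨Q', h₂', e₂⟩ := hQ _ _ h₂
      exact ⟨_, (Interaction.mk l h₁' h₂' hu (eQ.fn_eq ▸ a) (eP.fn_eq ▸ b) c d e f g i j).step,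
        .news_congr l (.par_congr (e₁.onProc _) (e₂.onProc _))⟩
  · obtain ⟨P'', h', e⟩ := hP _ _ h
    exact ⟨_, h'.par_left (eQ.fn_eq ▸ hd), .par_congr e eQ⟩
  · obtain ⟨Q'', h', e⟩ := hQ _ _ h
    exact ⟨_, h'.par_right (eP.fn_eq ▸ hd), .par_congr eP e⟩

theorem rep [Infinite N] {P P₁ : Proc N} (hP : StructSim P P₁) (eP : Struct P P₁) :
    StructSim P.rep P₁.rep := by
  intro μ R h
  -- The claim and its analogue for `!P | P` are proved together by induction on the derivation.
  suffices H : ∀ X, Step X μ R →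
      (X = P.rep → ∃ R', Step P₁.rep μ R' ∧ Struct R R') ∧
      (X = P.rep.par P → ∃ R', Step (P₁.rep.par P₁) μ R' ∧ Struct R R') from (H _ h).1 rfl
  clear h
  intro X h
  have hfn : P₁.rep.fn = P.rep.fn := eP.fn_eq.symm
  induction h with
  | case => exact ⟨fun h => by simp [Proc.pre] at h, fun h => by simp [Proc.pre] at h⟩
  | resnon => exact ⟨fun h => by simp [Proc.new] at h, fun h => by simp [Proc.new] at h⟩
  | unify l _ h₂ hu a b c d e ih₁ ih₂ =>
    refine ⟨fun h => by simp at h, fun h => ?_⟩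
    cases h
    obtain ⟨P', h₁', e₁⟩ := ih₁.1 rfl
    obtain ⟨Q', h₂', e₂⟩ := hP _ _ h₂
    exact ⟨_, .unify l h₁' h₂' hu (eP.fn_eq ▸ a) (hfn ▸ b) c d e,
      .news_congr l (.par_congr (e₁.onProc _) (e₂.onProc _))⟩
  | parint_left Q _ ih =>
    refine ⟨fun h => by simp at h, fun h => ?_⟩
    cases h
    obtain ⟨P', h', e⟩ := ih.1 rfl
    exact ⟨_, .parint_left _ h', .par_congr e eP⟩
  | parint_right Q h₁ ih =>
    refine ⟨fun h => by simp at h, fun h => ?_⟩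
    cases h
    obtain ⟨P', h', e⟩ := hP _ _ h₁
    exact ⟨_, .parint_right _ h', .par_congr (.rep_congr eP) e⟩
  | parext_left Q _ hd ih =>
    refine ⟨fun h => by simp at h, fun h => ?_⟩
    cases h
    obtain ⟨P', h', e⟩ := ih.1 rfl
    exact ⟨_, .parext_left _ h' (eP.fn_eq ▸ hd), .par_congr e eP⟩
  | parext_right Q h₁ hd ih =>
    refine ⟨fun h => by simp at h, fun h => ?_⟩
    cases h
    obtain ⟨P', h', e⟩ := hP _ _ h₁
    exact ⟨_, .parext_right _ h' (hfn ▸ hd), .par_congr (.rep_congr eP) e⟩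
  | rep _ ih =>
    refine ⟨fun h => ?_, fun h => by simp at h⟩
    cases h
    obtain ⟨R', h', e⟩ := ih.2 rfl
    exact ⟨R', .rep h', e⟩
  | _ => exact ⟨fun h => by simp [Proc.new] at h, fun h => by simp [Proc.new] at h⟩


theorem new [Infinite N] {P P₁ : Proc N} (hP : StructSim P P₁) (eP : Struct P P₁) (n : N) :
    StructSim (Proc.new n P) (Proc.new n P₁) := by
  intro μ R hs
  obtain ⟨z, hz⟩ := ((Proc.new n P).fn_finite.union μ.names_finite).exists_notMem
  rw [Set.mem_union, not_or] at hz
  have hz₁ : z ∉ (Proc.new n P₁).fn := (Struct.new_congr n eP).fn_eq ▸ hz.1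
  rw [Proc.new_eq_ren hz.1] at hs
  rw [Proc.new_eq_ren hz₁]
  replace hP := hP.ren (Equiv.swap n z)
  replace eP := eP.ren (Equiv.swap n z)
  generalize P.ren (Equiv.swap n z) = P at *
  generalize P₁.ren (Equiv.swap n z) = P₁ at *
  rcases hs.new_inv hz.2 with ⟨P', h, rfl⟩ | ⟨m, ns, p, rfl, hm, hm', h⟩
  · obtain ⟨P'', h', e⟩ := hP _ _ h
    exact ⟨_, .resnon z h' hz.2, .new_congr z e⟩
  · obtain ⟨P'', h', e⟩ := hP.ren (Equiv.swap z m) _ _ h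
    exact ⟨_, h'.open_swap hm ((Struct.new_congr z eP).fn_eq ▸ hm'), e⟩

theorem pre [Infinite N] {P P₁ : Proc N} (eP : Struct P P₁) {p : Pat N N} (hp : p.WellFormed) :
    StructSim (Proc.pre p P) (Proc.pre p P₁) := by
  intro μ R h
  obtain ⟨q, hq, rfl, e⟩ := h.pre_inv
  obtain ⟨f, rfl, -, hf⟩ := Proc.pre_eq_pre hp hq e
  have hd : Disjoint q.bn (Proc.pre p P₁).fn := by
    rw [← (Struct.pre_congr p hp eP).fn_eq, Set.disjoint_left]
    exact h.actionNames.bn_fresh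
  rw [hf P₁ hd]
  exact ⟨_, .case q _ hq, eP.ren f⟩

theorem par_zero [Infinite N] (P : Proc N) : StructSim (P.par .zero) P := by
  intro μ R hs
  rcases hs.par_inv Set.finite_empty with ⟨rfl, h⟩ | ⟨P', h, hd, rfl⟩ | ⟨Q', h, hd, rfl⟩
  · cases h with
    | mk l h₁ h₂ => exact absurd h₂ not_step_zero
  · exact ⟨P', h, .par_zero _⟩
  · exact absurd h not_step_zero

theorem par_zero_symm (P : Proc N) : StructSim P (P.par .zero) :=
  fun _ _ h => ⟨_, h.par_left (Set.disjoint_empty _), (Struct.par_zero _).symm⟩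

theorem par_comm [Infinite N] (P Q : Proc N) : StructSim (P.par Q) (Q.par P) := by
  intro μ R hs
  rcases hs.par_inv Set.finite_empty with ⟨rfl, h⟩ | ⟨P', h, hd, rfl⟩ | ⟨Q', h, hd, rfl⟩
  · cases h with
    | mk l h₁ h₂ hu a b c d e f g i j =>
      exact ⟨_, (Interaction.mk l h₂ h₁ hu.symm b a (fun x hx hx' => c x hx' hx) d
        (fun x => (e x).trans or_comm) g f j i).step, .news_congr l (.par_comm _ _)⟩
  · exact ⟨_, h.par_right hd, .par_comm _ _⟩
  · exact ⟨_, h.par_left hd, .par_comm _ _⟩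

theorem par_assoc [Infinite N] (P Q R : Proc N) :
    StructSim (P.par (Q.par R)) ((P.par Q).par R) := by
  have hfn (P Q : Proc N) (x : N) : x ∉ (P.par Q).fn ↔ x ∉ P.fn ∧ x ∉ Q.fn := not_or
  have hdis {A : Set N} {P Q : Proc N} : Disjoint A (P.par Q).fn ↔
      Disjoint A P.fn ∧ Disjoint A Q.fn := Set.disjoint_union_right
  have hself {σ : Sub N} {p : Pat N N} (hm : IsMatch p σ) {Q : Proc N}
      (hd : ∀ x ∈ p.bn, x ∉ Q.fn) : σ.onProc Q = Q :=
    Sub.onProc_eq_self (by rw [← hm]; exact Set.disjoint_left.2 hd)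
  intro μ X hs
  have hF : (P.fn ∪ Q.fn ∪ R.fn).Finite := (P.fn_finite.union Q.fn_finite).union R.fn_finite
  rcases hs.par_inv hF with ⟨rfl, h⟩ | ⟨P', h, hd, rfl⟩ | ⟨X', hs', hd, rfl⟩
  · cases h with
    | @mk P' X' ms ns p q σ ρ l h₁ h₂ hu a b c d e f g i j =>
      simp only [hfn] at a
      simp only [Set.mem_union, not_or] at f g i j
      rcases h₂.par_inv hF with ⟨h, -⟩ | ⟨Q', h, hd, rfl⟩ | ⟨R', h, hd, rfl⟩
      · cases h
      · refine ⟨_, .parint_left R (Interaction.mk l h₁ h hu (fun x hx => (a x hx).1) b c d e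
          (F := ∅) (by simp) (by simp) (by simp) (by simp)).step, ?_⟩
        have : ρ.onProc (Q'.par R) = (ρ.onProc Q').par R :=
          congrArg _ (hself hu.isMatch_right fun x hx => (j x hx).2)
        rw [this]
        refine (Struct.news_congr l (.par_assoc _ _ _)).trans (Struct.scope_news' ?_ _).symm
        intro x hx
        rcases (e x).1 hx with h | h
        · exact (a x h).2
        · exact (g x h).2
      · refine ⟨_, (Interaction.mk l (h₁.par_left (Q := Q) ?_) h hu (fun x hx => (a x hx).2)
          (fun x hx => (hfn _ _ _).2 ⟨b x hx, (g x hx).1.2⟩) c d e (F := ∅) (by simp) (by simp)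
          (by simp) (by simp)).step, ?_⟩
        · rw [Set.disjoint_left]
          rintro x (hx | hx)
          · exact (a x hx).1
          · exact (i x hx).1.2
        · have e₁ : ρ.onProc (Q.par R') = Q.par (ρ.onProc R') :=
            congrArg (Proc.par · _) (hself hu.isMatch_right fun x hx => (j x hx).1.2)
          have e₂ : σ.onProc (P'.par Q) = (σ.onProc P').par Q :=
            congrArg _ (hself hu.isMatch_left fun x hx => (i x hx).1.2)
          rw [e₁, e₂]
          exact .news_congr l (.par_assoc _ _ _)
  · rw [hdis] at hd
    exact ⟨_, (h.par_left hd.1).par_left hd.2, .par_assoc _ _ _⟩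
  · rcases hs'.par_inv hF with ⟨rfl, h⟩ | ⟨Q', h, hd', rfl⟩ | ⟨R', h, hd', rfl⟩
    · cases h with
      | @mk Q' R' ms ns q r σ ρ l h₁ h₂ hu a b c d e f g i j =>
        simp only [Set.mem_union, not_or] at f g i j
        refine ⟨_, (Interaction.mk l (h₁.par_right (P := P) ?_) h₂ hu a
          (fun x hx => (hfn _ _ _).2 ⟨(g x hx).1.1, b x hx⟩) c d e (F := ∅) (by simp) (by simp)
          (by simp) (by simp)).step, ?_⟩
        · rw [Set.disjoint_left]
          rintro x (hx | hx)
          · exact (f x hx).1.1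
          · exact (i x hx).1.1
        · have e₁ : σ.onProc (P.par Q') = P.par (σ.onProc Q') :=
            congrArg (Proc.par · _) (hself hu.isMatch_left fun x hx => (i x hx).1.1)
          rw [e₁]
          refine (Struct.scope_news ?_ _).trans (.news_congr l (.par_assoc _ _ _))
          intro x hx
          rcases (e x).1 hx with h | h
          · exact (f x h).1.1
          · exact (g x h).1.1
    · exact ⟨_, (h.par_right hd).par_left hd', .par_assoc _ _ _⟩
    · exact ⟨_, h.par_right (hdis.2 ⟨hd, hd'⟩), .par_assoc _ _ _⟩

/-- The converse of `par_assoc` follows from commutativity. -/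
theorem par_assoc_symm [Infinite N] (P Q R : Proc N) :
    StructSim ((P.par Q).par R) (P.par (Q.par R)) :=
  (par_comm _ _).trans <| ((refl R).par (par_comm P Q) (.refl _) (.par_comm _ _)).trans <|
    (par_assoc R Q P).trans <| (par_comm _ _).trans <|
      (refl P).par (par_comm R Q) (.refl _) (.par_comm _ _)

end StructSim

namespace StructSim

theorem new_zero [Infinite N] (n : N) : StructSim (Proc.new n .zero) (.zero : Proc N) := by
  intro μ R h
  obtain ⟨z, hz⟩ := μ.names_finite.exists_notMem
  have e : Proc.new n .zero = Proc.new z (.zero : Proc N) :=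
    Proc.new_eq_ren (by rw [Proc.fn_new]; exact fun h => h.1)
  rw [e] at h
  rcases h.new_inv hz with ⟨P', h, -⟩ | ⟨m, ns, p, -, -, -, h⟩ <;> exact absurd h not_step_zero

theorem of_zero (P : Proc N) : StructSim .zero P := fun _ _ h => absurd h not_step_zero

theorem new_comm [Infinite N] (n m : N) (P : Proc N) :
    StructSim (Proc.new n (Proc.new m P)) (Proc.new m (Proc.new n P)) := by
  by_cases hnm : n = m
  · subst hnm; exact refl _
  intro μ R hs
  -- The two names can be assumed not to occur in the label.
  wlog hμ : n ∉ μ.names ∧ m ∉ μ.names generalizing n m P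
  · obtain ⟨π, h₁, h₂⟩ := exists_fresh_perm (A := {n, m}) (by simp)
      (μ.names_finite.union P.fn_finite)
    have e {n m : N} (h₂ : ∀ x ∈ P.fn, x ≠ n → x ≠ m → π x = x) :
        Proc.new n (Proc.new m P) = Proc.new (π n) (Proc.new (π m) (P.ren π)) := by
      rw [← Proc.ren_new, ← Proc.ren_new, Proc.ren_eq_self]
      intro x hx
      simp only [Proc.fn_new] at hx
      exact h₂ x hx.1.1 hx.2 hx.1.2
    rw [e fun x hx hn hm => h₂ x (.inr hx) (by simp [hn, hm])] at hs
    rw [e fun x hx hm hn => h₂ x (.inr hx) (by simp [hn, hm])]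
    exact this _ _ _ (fun h => hnm (π.injective h)) hs
      ⟨fun h => (h₁ n (by simp)).1 (.inl h), fun h => (h₁ m (by simp)).1 (.inl h)⟩
  have swap_new {a b c : N} (P : Proc N) (h₁ : c ≠ a) (h₂ : c ≠ b) :
      (Proc.new c P).ren (Equiv.swap a b) = Proc.new c (P.ren (Equiv.swap a b)) := by
    rw [Proc.ren_new, Equiv.swap_apply_of_ne_of_ne h₁ h₂]
  have hsub {ns : Finset N} {p : Pat N N} {a x : N} (h : x ∉ (Label.act (insert a ns) p).names) :
      x ∉ (Label.act ns p).names ∧ x ≠ a := by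
    simp only [Label.names, Set.mem_union, Finset.coe_insert, Set.mem_insert_iff, not_or] at h ⊢
    tauto
  obtain ⟨hn, hm⟩ := hμ
  rcases hs.new_inv hn with ⟨X, hX, rfl⟩ | ⟨a, ns, p, rfl, ha, ha', hX⟩
  · rcases hX.new_inv hm with ⟨P', h, rfl⟩ | ⟨b, ns, p, rfl, hb, hb', h⟩
    · exact ⟨_, .resnon m (.resnon n h hn) hm, .new_comm _ _ _⟩
    · obtain ⟨hn', hnb⟩ := hsub hn
      refine ⟨_, Step.open_swap (P := Proc.new n P) ?_ hb ?_, .refl _⟩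
      · rw [swap_new _ hnm hnb]; exact .resnon n h hn'
      · simp only [Proc.fn_new] at hb' ⊢
        exact fun h => hb' ⟨h.1.1, h.2⟩
  · obtain ⟨hm', hma⟩ := hsub hm
    have han := (hsub hn).2
    rw [swap_new _ (Ne.symm hnm) hma] at hX
    rcases hX.new_inv hm' with ⟨P', h, rfl⟩ | ⟨b, ns, p, he, hb, hb', h⟩
    · refine ⟨_, .resnon m (h.open_swap ha ?_) hm, .refl _⟩
      simp only [Proc.fn_new] at ha' ⊢
      exact fun h => ha' ⟨⟨h.1, Ne.symm hma⟩, h.2⟩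
    · cases he
      have hab : a ≠ b := fun e => ha.2 (.inl (.inl (by simp [e])))
      have hnb : n ≠ b := (hsub (hsub hn).1).2
      have hmb : m ≠ b := (hsub hm').2
      have e : (P.ren (Equiv.swap m b)).ren (Equiv.swap n a) =
          (P.ren (Equiv.swap n a)).ren (Equiv.swap m b) := by
        rw [Proc.ren_ren, Proc.ren_ren]
        refine Proc.ren_congr fun x _ => ?_
        by_cases h₁ : x = n
        · subst h₁
          rw [Equiv.swap_apply_of_ne_of_ne hnm hnb, Equiv.swap_apply_left,
            Equiv.swap_apply_of_ne_of_ne (Ne.symm hma) hab]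
        by_cases h₂ : x = a
        · subst h₂
          rw [Equiv.swap_apply_of_ne_of_ne (Ne.symm hma) hab, Equiv.swap_apply_right,
            Equiv.swap_apply_of_ne_of_ne hnm hnb]
        rw [Equiv.swap_apply_of_ne_of_ne h₁ h₂]
        by_cases h₃ : x = m
        · subst h₃
          rw [Equiv.swap_apply_left, Equiv.swap_apply_of_ne_of_ne (Ne.symm hnb) (Ne.symm hab)]
        by_cases h₄ : x = b
        · subst h₄
          rw [Equiv.swap_apply_right, Equiv.swap_apply_of_ne_of_ne (Ne.symm hnm) hma]
        rw [Equiv.swap_apply_of_ne_of_ne h₃ h₄, Equiv.swap_apply_of_ne_of_ne h₁ h₂]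
      rw [← e] at h
      rw [Finset.insert_comm]
      have ha₁ : a ∈ p.vn \ (↑ns ∪ p.pn ∪ p.bn) :=
        ⟨ha.1, fun h => ha.2 (by
          simp only [Set.mem_union, Finset.coe_insert, Set.mem_insert_iff] at h ⊢
          tauto)⟩
      have hb₁ : b ∈ p.vn \ (↑(insert a ns) ∪ p.pn ∪ p.bn) := by
        refine ⟨hb.1, ?_⟩
        have := hb.2
        simp only [Finset.coe_insert, Set.mem_union, Set.mem_insert_iff, not_or] at this ⊢
        exact ⟨⟨⟨Ne.symm hab, this.1.1⟩, this.1.2⟩, this.2⟩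
      refine ⟨_, Step.open_swap (P := Proc.new n P) ?_ hb₁ ?_, .refl _⟩
      · rw [swap_new _ hnm hnb]
        refine h.open_swap ha₁ ?_
        simp only [Proc.fn_new, Proc.fn_ren, Set.mem_sdiff, Set.mem_image] at ha' ⊢
        rintro ⟨⟨y, hy, e⟩, h₂⟩
        rw [Equiv.swap_apply_eq_iff, Equiv.swap_apply_of_ne_of_ne (Ne.symm hma) hab] at e
        subst e
        exact ha' ⟨⟨hy, Ne.symm hma⟩, h₂⟩
      · simp only [Proc.fn_new, Proc.fn_ren, Set.mem_sdiff, Set.mem_image] at hb' ⊢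
        rintro ⟨⟨h₁, -⟩, h₂⟩
        exact hb' ⟨⟨b, h₁, Equiv.swap_apply_of_ne_of_ne (Ne.symm hnb) (Ne.symm hab)⟩, h₂⟩

/-- A name not free in `P` and not in the label can be assumed in both directions of `scope`. -/
theorem scope_aux [Infinite N] {n : N} {P Q : Proc N} (hn : n ∉ P.fn) (μ : Label N) :
    ∃ z Q₁, z ∉ P.fn ∧ z ∉ μ.names ∧ Proc.new n Q = Proc.new z Q₁ ∧
      Proc.new n (P.par Q) = Proc.new z (P.par Q₁) := by
  obtain ⟨z, hz⟩ := (((P.fn_finite.union Q.fn_finite).union μ.names_finite)).exists_notMem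
  simp only [Set.mem_union, not_or] at hz
  refine ⟨z, Q.ren (Equiv.swap n z), hz.1.1, hz.2, ?_, ?_⟩
  · exact Proc.new_eq_ren (by rw [Proc.fn_new]; exact fun h => hz.1.2 h.1)
  · rw [Proc.new_eq_ren (z := z) (by rw [Proc.fn_new]; exact fun h => h.1.elim hz.1.1 hz.1.2)]
    congr 1
    exact congrArg (Proc.par · _) (Proc.ren_eq_self fun x hx =>
      Equiv.swap_apply_of_ne_of_ne (ne_of_mem_of_not_mem hx hn) (ne_of_mem_of_not_mem hx hz.1.1))

/-- The restriction of a name that occurs in one of two interacting processes only, and not in the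
labels, can be extended to both. -/
theorem interaction_scope {n : N} {P P' Q' : Proc N} {ms : Finset N} {p q : Pat N N}
    {σ ρ : Sub N} (l : List N) (h : Step P (.act ms p) P') (hu : Unify p q σ ρ) (hP : n ∉ P.fn)
    (hms : n ∉ ms) (hp : n ∉ p.bn) (hqb : n ∉ q.bn) (hq : n ∉ q.fn) :
    Struct (Proc.news l ((σ.onProc P').par (ρ.onProc (Proc.new n Q'))))
      (Proc.new n (Proc.news l ((σ.onProc P').par (ρ.onProc Q')))) := by
  have hρ : n ∉ ρ.fn := fun h' => ((h.actionNames.fn_label n (.inl (hu.fn_right h'))).elim hP hms)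
  have hσ : n ∉ (σ.onProc P').fn := by
    intro h'
    rcases Sub.fn_onProc_subset h' with h' | h'
    · exact hq (.inl (hu.fn_left h'))
    · rcases h.actionNames.fn_target n h'.1 with h' | h' | h'
      · exact hP h'
      · exact hms h'
      · exact hp h'
  rw [Sub.onProc_new (by rwa [← hu.isMatch_right]) hρ]
  exact (Struct.news_congr l (.scope _ _ _ hσ)).trans (Struct.news_new l n _)

theorem scope [Infinite N] {n : N} {P : Proc N} (hn : n ∉ P.fn) (Q : Proc N) :
    StructSim (P.par (Proc.new n Q)) (Proc.new n (P.par Q)) := by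
  intro μ R hs
  obtain ⟨z, Q₁, hz, hμ, e₁, e₂⟩ := scope_aux (Q := Q) hn μ
  rw [e₁] at hs
  rw [e₂]
  clear e₁ e₂ hn
  rcases hs.par_inv (Set.finite_singleton z) with ⟨rfl, h⟩ | ⟨P', h, hd, rfl⟩ | ⟨Q', hX, hd, rfl⟩
  · cases h with
    | @mk P' Q' ms ns p q σ ρ l h₁ h₂ hu a b c d e f g i j =>
      have f' : z ∉ ms := fun h => f z h rfl
      have g' : z ∉ ns := fun h => g z h rfl
      have i' : z ∉ p.bn := fun h => i z h rfl
      have j' : z ∉ q.bn := fun h => j z h rfl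
      have hq : z ∉ q.fn := fun h => (h₂.actionNames.fn_label z h).elim
        (fun h => by rw [Proc.fn_new] at h; exact h.2 rfl) g'
      rcases h₂.new_inv (by simp [Label.names, g', j', hq]) with
        ⟨Q'', h, rfl⟩ | ⟨m, ns', q', he, hm, hm', h⟩
      · refine ⟨_, .resnon z (Interaction.mk l h₁ h hu
          (fun x hx => Proc.notMem_fn_of_new (a x hx) (ne_of_mem_of_not_mem hx f')) b c d e
          (F := ∅) (by simp) (by simp) (by simp) (by simp)).step (Set.notMem_empty z), ?_⟩
        exact interaction_scope l h₁ hu hz f' i' j' hq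
      · cases he
        have hmP : m ∉ P.fn := b m (by simp)
        have hml : m ∈ l := (e m).2 (.inr (by simp))
        rw [Proc.new_eq_ren (x := z) (z := m), Proc.ren_swap_par hz hmP]
        · refine ⟨_, .resnon m (Interaction.mk (l.erase m) h₁ h hu (fun x hx => ?_)
            (fun x hx => b x (by simp [hx])) (fun x hx hx' => c x hx (by simp [hx']))
            (d.erase m) (fun x => ?_) (F := ∅) (by simp) (by simp) (by simp) (by simp)).step
            (Set.notMem_empty m), Struct.news_perm (List.perm_cons_erase hml) _⟩
          · exact Proc.notMem_fn_ren_swap (a x hx) (fun h => c x hx (by simp [h])) hm'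
          · rw [d.mem_erase_iff, e, Finset.mem_insert]
            have h₁ : m ∉ ms := fun h => c m h (by simp)
            have h₂ : m ∉ ns' := fun h => hm.2 (.inl (.inl h))
            constructor
            · tauto
            · rintro (h | h)
              · exact ⟨ne_of_mem_of_not_mem h h₁, .inl h⟩
              · exact ⟨ne_of_mem_of_not_mem h h₂, .inr (.inr h)⟩
        · rw [Proc.fn_new] at hm' ⊢
          rintro ⟨h | h, h'⟩
          · exact hmP h
          · exact hm' ⟨h, h'⟩
  · have hb : z ∉ μ.bound := fun h => hμ (Label.bound_subset _ h)
    refine ⟨_, .resnon z (h.par_left ?_) hμ, .scope _ _ _ ?_⟩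
    · rw [Set.disjoint_left] at hd ⊢
      exact fun x hx => Proc.notMem_fn_of_new (hd hx) (ne_of_mem_of_not_mem hx hb)
    · exact fun h' => (h.fn_target h').elim hz hb
  · rcases hX.new_inv hμ with ⟨Q'', h, rfl⟩ | ⟨m, ns, q, rfl, hm, hm', h⟩
    · exact ⟨_, .resnon z (h.par_right hd) hμ, .scope _ _ _ hz⟩
    · rw [Set.disjoint_left] at hd
      have hmP : m ∉ P.fn := hd (.inl (by simp))
      refine ⟨_, Step.open_swap ?_ hm ?_, .refl _⟩
      · rw [Proc.ren_swap_par hz hmP]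
        refine h.par_right (Set.disjoint_left.2 fun x hx => hd ?_)
        exact hx.imp_left fun hx => by simp [Finset.mem_coe.1 hx]
      · rw [Proc.fn_new] at hm' ⊢
        rintro ⟨h | h, h'⟩
        · exact hmP h
        · exact hm' ⟨h, h'⟩

theorem scope_symm [Infinite N] {n : N} {P : Proc N} (hn : n ∉ P.fn) (Q : Proc N) :
    StructSim (Proc.new n (P.par Q)) (P.par (Proc.new n Q)) := by
  intro μ R hs
  obtain ⟨z, Q₁, hz, hμ, e₁, e₂⟩ := scope_aux (Q := Q) hn μ
  rw [e₂] at hs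
  rw [e₁]
  clear e₁ e₂ hn
  have hfn {x : N} (h : x ∉ Q₁.fn) : x ∉ (Proc.new z Q₁).fn := by
    rw [Proc.fn_new]; exact fun h' => h h'.1
  rcases hs.new_inv hμ with ⟨X, hX, rfl⟩ | ⟨m, ns, p, rfl, hm, hm', hX⟩
  · rcases hX.par_inv (Set.finite_singleton z) with ⟨rfl, h⟩ | ⟨P', h, hd, rfl⟩ | ⟨Q', h, hd, rfl⟩
    · cases h with
      | @mk P' Q' ms ns p q σ ρ l h₁ h₂ hu a b c d e f g i j =>
        have f' : z ∉ ms := fun h => f z h rfl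
        have g' : z ∉ ns := fun h => g z h rfl
        have i' : z ∉ p.bn := fun h => i z h rfl
        have j' : z ∉ q.bn := fun h => j z h rfl
        by_cases hq : z ∈ q.fn
        · -- `z` is not a name of `p`, so it is not protected in `q` and its scope is extruded.
          have hp : z ∉ p.fn := fun h => (h₁.actionNames.fn_label z h).elim hz f'
          have hqp : z ∉ q.pn := fun h => hp (hu.pn_right h)
          have h₂' : Step (Proc.new z Q₁) (.act (insert z ns) q) Q' :=
            .open z h₂ ⟨hq.resolve_right hqp, by simp [g', hqp, j']⟩
          refine ⟨_, (Interaction.mk (z :: l) h₁ h₂' hu (fun x hx => hfn (a x hx)) ?_ ?_ ?_ ?_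
            (F := ∅) (by simp) (by simp) (by simp) (by simp)).step, .refl _⟩
          · simpa using ⟨hz, b⟩
          · intro x hx
            rw [Finset.mem_insert, not_or]
            exact ⟨ne_of_mem_of_not_mem hx f', c x hx⟩
          · rw [List.nodup_cons, e]; exact ⟨by simp [f', g'], d⟩
          · intro x
            rw [List.mem_cons, e, Finset.mem_insert, or_left_comm]
        · exact ⟨_, (Interaction.mk l h₁ (.resnon z h₂ (by simp [Label.names, g', j', hq])) hu
            (fun x hx => hfn (a x hx)) b c d e (F := ∅) (by simp) (by simp) (by simp)
            (by simp)).step, (interaction_scope l h₁ hu hz f' i' j' hq).symm⟩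
    · have hb : z ∉ μ.bound := fun h => hμ (Label.bound_subset _ h)
      refine ⟨_, h.par_left ?_, (Struct.scope _ _ _ ?_).symm⟩
      · rw [Set.disjoint_left] at hd ⊢
        exact fun x hx => hfn (hd hx)
      · exact fun h' => (h.fn_target h').elim hz hb
    · exact ⟨_, .par_right (.resnon z h hμ) hd, (Struct.scope _ _ _ hz).symm⟩
  · have hmz : m ≠ z := by
      rintro rfl
      exact hμ (.inl (.inl (by simp)))
    rw [Proc.fn_new] at hm'
    have hmP : m ∉ P.fn := fun h => hm' ⟨.inl h, hmz⟩
    rw [Proc.ren_swap_par hz hmP] at hX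
    rcases hX.par_inv Set.finite_empty with ⟨h, -⟩ | ⟨P', h, hd, rfl⟩ | ⟨Q', h, hd, rfl⟩
    · cases h
    · exact ((h.actionNames.fn_label m (.inl hm.1)).elim hmP fun h => hm.2 (.inl (.inl h))).elim
    · refine ⟨_, (h.open_swap hm ?_).par_right ?_, .refl _⟩
      · rw [Proc.fn_new]
        exact fun h => hm' ⟨.inr h.1, hmz⟩
      · rw [Set.disjoint_left] at hd ⊢
        intro x hx
        simp only [Label.bound, Finset.coe_insert, Set.insert_union] at hx
        rcases hx with rfl | hx
        · exact hmP
        · exact hd hx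

end StructSim

/-- Structurally congruent processes have the same transitions up to structural congruence. -/
theorem Struct.sim [Infinite N] {P Q : Proc N} (h : Struct P Q) :
    StructSim P Q ∧ StructSim Q P := by
  induction h with
  | refl P => exact ⟨.refl P, .refl P⟩
  | symm _ ih => exact ih.symm
  | trans _ _ h₁ h₂ => exact ⟨h₁.1.trans h₂.1, h₂.2.trans h₁.2⟩
  | par_congr e₁ e₂ h₁ h₂ => exact ⟨h₁.1.par h₂.1 e₁ e₂, h₁.2.par h₂.2 e₁.symm e₂.symm⟩
  | rep_congr e h => exact ⟨h.1.rep e, h.2.rep e.symm⟩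
  | new_congr n e h => exact ⟨h.1.new e n, h.2.new e.symm n⟩
  | pre_congr p hp e _ => exact ⟨.pre e hp, .pre e.symm hp⟩
  | par_zero P => exact ⟨.par_zero P, .par_zero_symm P⟩
  | par_comm P Q => exact ⟨.par_comm P Q, .par_comm Q P⟩
  | par_assoc P Q R => exact ⟨.par_assoc P Q R, .par_assoc_symm P Q R⟩
  | new_zero n => exact ⟨.new_zero n, .of_zero _⟩
  | new_comm n m P => exact ⟨.new_comm n m P, .new_comm m n P⟩
  | rep_unfold P =>
    exact ⟨fun _ _ h => StructSim.par_comm _ _ _ _ h.rep_inv, fun _ _ h =>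
      (StructSim.par_comm _ _ _ _ h).imp fun _ h => ⟨.rep h.1, h.2⟩⟩
  | scope n P Q hn => exact ⟨.scope hn Q, .scope_symm hn Q⟩

/-! ### The congruence closure of a bisimulation -/

/-- The least relation that contains `R` and is closed under the operators of the calculus. -/
inductive CongClosure (R : Proc N → Proc N → Prop) : Proc N → Proc N → Prop
  | base {P Q : Proc N} : R P Q → CongClosure R P Q
  | par {P P' Q Q' : Proc N} : CongClosure R P Q → CongClosure R P' Q' →
      CongClosure R (P.par P') (Q.par Q')
  | rep {P Q : Proc N} : CongClosure R P Q → CongClosure R P.rep Q.rep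
  | new (n : N) {P Q : Proc N} : CongClosure R P Q →
      CongClosure R (Proc.new n P) (Proc.new n Q)
  | pre (p : Pat N N) {P Q : Proc N} : p.WellFormed → CongClosure R P Q →
      CongClosure R (Proc.pre p P) (Proc.pre p Q)

namespace CongClosure

variable {R : Proc N → Proc N → Prop}

theorem symm (hR : ∀ P Q, R P Q → R Q P) {P Q : Proc N} (h : CongClosure R P Q) :
    CongClosure R Q P := by
  induction h with
  | base h => exact .base (hR _ _ h)
  | par _ _ h₁ h₂ => exact .par h₁ h₂
  | rep _ h => exact .rep h
  | new n _ h => exact .new n h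
  | pre p hp _ h => exact .pre p hp h

theorem news (l : List N) {P Q : Proc N} (h : CongClosure R P Q) :
    CongClosure R (Proc.news l P) (Proc.news l Q) := by
  induction l with
  | nil => exact h
  | cons x l ih => exact .new x ih

theorem fill (hR : ∀ P, R P P) (C : Ctx N) {P Q : Proc N} (h : CongClosure R P Q) :
    CongClosure R (C.fill P) (C.fill Q) := by
  induction C with
  | hole => exact h
  | parLeft C X ih => exact .par ih (.base (hR X))
  | parRight X C ih => exact .par (.base (hR X)) ih
  | rep C ih => exact .rep ih
  | new x C ih => exact .new x ih
  | pre p hp C ih => exact .pre p hp ih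

theorem subst [Infinite N] (hR : SubstClosed R) {P Q : Proc N} (h : CongClosure R P Q)
    (σ : N → CPat N) : CongClosure R (P.subst σ) (Q.subst σ) := by
  have fresh {P : Proc N} {σ : N → CPat N} {z x : N} (hz : z ∉ (P.subst σ).fn) :
      ∀ y ∈ P.fn, y ≠ x → z ∉ (σ y).fn := fun y hy _ h => hz (Proc.mem_fn_subst.2 ⟨y, hy, h⟩)
  induction h generalizing σ with
  | @base P Q h =>
    have hf := P.fn_finite.union Q.fn_finite
    have e {P : Proc N} (h : P.fn ⊆ hf.toFinset) :
        P.subst σ = (Sub.ofFun hf.toFinset σ).onProc P :=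
      Proc.subst_congr fun x hx => (Sub.app_ofFun (h hx)).symm
    rw [e (by rw [hf.coe_toFinset]; exact Set.subset_union_left),
      e (by rw [hf.coe_toFinset]; exact Set.subset_union_right)]
    exact .base (hR _ _ h _)
  | par _ _ h₁ h₂ => exact .par (h₁ σ) (h₂ σ)
  | rep _ h => exact .rep (h σ)
  | @new n P P' _ ih =>
    obtain ⟨z, hz⟩ := ((P.subst σ).fn_finite.union (P'.subst σ).fn_finite).exists_notMem
    rw [Set.mem_union, not_or] at hz
    rw [Proc.subst_new (fresh hz.1), Proc.subst_new (fresh hz.2)]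
    exact .new _ (ih _)
  | @pre p P P' hp _ ih =>
    obtain ⟨q, τ, hq, e, e'⟩ := Proc.exists_subst_pre hp P P' σ
    rw [e, e']
    exact .pre _ hq (ih _)

theorem ren [Infinite N] (hR : SubstClosed R) {P Q : Proc N} (h : CongClosure R P Q)
    (f : N → N) : CongClosure R (P.ren f) (Q.ren f) := h.subst hR _

theorem par_inv {P₁ P₂ Q : Proc N} (h : CongClosure R (P₁.par P₂) Q) :
    R (P₁.par P₂) Q ∨ ∃ Q₁ Q₂, Q = Q₁.par Q₂ ∧ CongClosure R P₁ Q₁ ∧ CongClosure R P₂ Q₂ := by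
  generalize hX : P₁.par P₂ = X at h
  cases h with
  | base h => exact .inl h
  | par h₁ h₂ => cases hX; exact .inr ⟨_, _, rfl, h₁, h₂⟩
  | rep => simp at hX
  | new => simp [Proc.new] at hX
  | pre => simp [Proc.pre] at hX

theorem rep_inv {P Q : Proc N} (h : CongClosure R P.rep Q) :
    R P.rep Q ∨ ∃ Q₀, Q = Q₀.rep ∧ CongClosure R P Q₀ := by
  generalize hX : P.rep = X at h
  cases h with
  | base h => exact .inl h
  | rep h => cases hX; exact .inr ⟨_, rfl, h⟩
  | par => simp at hX
  | new => simp [Proc.new] at hX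
  | pre => simp [Proc.pre] at hX

theorem new_inv [Infinite N] (hR : SubstClosed R) {n : N} {P Q : Proc N}
    (h : CongClosure R (Proc.new n P) Q) (hn : n ∉ Q.fn) :
    R (Proc.new n P) Q ∨ ∃ Q₀, Q = Proc.new n Q₀ ∧ CongClosure R P Q₀ := by
  generalize hX : Proc.new n P = X at h
  cases h with
  | base h => exact .inl h
  | @new m P₁ Q₁ h =>
    obtain ⟨rfl, -⟩ := Proc.eq_ren_of_new_eq hX.symm
    exact .inr ⟨_, Proc.new_eq_ren hn, h.ren hR _⟩
  | par => simp [Proc.new] at hX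
  | rep => simp [Proc.new] at hX
  | pre => simp [Proc.pre, Proc.new] at hX

theorem pre_inv {p : Pat N N} {P Q : Proc N} (h : CongClosure R (Proc.pre p P) Q) :
    R (Proc.pre p P) Q ∨ ∃ p₁ P₁ Q₁, p₁.WellFormed ∧ Proc.pre p P = Proc.pre p₁ P₁ ∧
      Q = Proc.pre p₁ Q₁ ∧ CongClosure R P₁ Q₁ := by
  generalize hX : Proc.pre p P = X at h
  cases h with
  | base h => exact .inl h
  | pre p₁ hp h => exact .inr ⟨p₁, _, _, hp, rfl, rfl, h⟩
  | par => simp [Proc.pre] at hX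
  | rep => simp [Proc.pre] at hX
  | new => simp [Proc.pre, Proc.new] at hX

end CongClosure

/-- `Q` replies to a transition with the given label and target `P'`, up to `S`. The challenges are
the matches whose substitution does not mention the names in `A`; the binding names of the label
may be free in `Q`. -/
def Reply (S : Proc N → Proc N → Prop) (A : Set N) (P' Q : Proc N) : Label N → Prop
  | .tau => ∃ Q', Step Q .tau Q' ∧ S P' Q'
  | .act ns p => (∀ x ∈ ns, x ∉ Q.fn) → ∀ σ : Sub N, IsMatch p σ → (∀ x ∈ ns, x ∉ σ.fn) →
      (∀ x ∈ A, x ∉ σ.fn) →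
      ∃ q ρ Q', Compat p σ q ρ ∧ Step Q (.act ns q) Q' ∧ S (σ.onProc P') (ρ.onProc Q')

/-- Names that occur neither in a process nor in its transition can be assumed not to occur in the
related process and in the challenge: rename them there, and rename the reply back. -/
theorem reply_of_fresh [Infinite N] {S : Proc N → Proc N → Prop}
    (hS : ∀ {P Q : Proc N} (f : N → N), S P Q → S (P.ren f) (Q.ren f)) {P P' : Proc N}
    {μ : Label N} {A : Set N} (hA : A.Finite) (hP : ∀ x ∈ A, x ∉ P.fn) (hP' : ∀ x ∈ A, x ∉ P'.fn)
    (hμ : ∀ x ∈ A, x ∉ μ.names)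
    (H : ∀ Q, S P Q → (∀ x ∈ A, x ∉ Q.fn) → Reply S A P' Q μ) {Q : Proc N} (h : S P Q) :
    Reply S ∅ P' Q μ := by
  have key (B : Set N) (hB : B.Finite) : ∃ π : Equiv.Perm N,
      (∀ x ∈ A, x ∉ π '' B ∧ x ∉ (Q.ren π).fn) ∧
      (∀ x ∈ μ.names, x ∉ B → x ∉ π '' B) ∧ (∀ x ∈ μ.names, x ∉ Q.fn → x ∉ (Q.ren π).fn) ∧
      (∀ x ∈ μ.names, π.symm x = x) ∧ (∀ x ∈ P'.fn, π.symm x = x) ∧ P.ren π = P := by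
    obtain ⟨π, h₁, h₂⟩ := exists_fresh_perm hA
      ((((hB.union P.fn_finite).union P'.fn_finite).union μ.names_finite).union Q.fn_finite)
    have hA' {C : Set N} {x : N} (hx : x ∈ A)
        (hC : C ⊆ B ∪ P.fn ∪ P'.fn ∪ μ.names ∪ Q.fn) : x ∉ π '' C := by
      rintro ⟨y, hy, rfl⟩
      by_cases hyA : y ∈ A
      · exact (h₁ y hyA).2 hx
      · rw [h₂ y (hC hy) hyA] at hx; exact hyA hx
    have hμ' {C : Set N} {x : N} (hx : x ∈ μ.names)
        (hC : C ⊆ B ∪ P.fn ∪ P'.fn ∪ μ.names ∪ Q.fn) (hxC : x ∉ C) : x ∉ π '' C := by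
      rintro ⟨y, hy, rfl⟩
      by_cases hyA : y ∈ A
      · exact (h₁ y hyA).1 (.inl (.inr hx))
      · rw [h₂ y (hC hy) hyA] at hxC; exact hxC hy
    have hfix {x : N} (hx : x ∈ B ∪ P.fn ∪ P'.fn ∪ μ.names ∪ Q.fn) (hxA : x ∉ A) :
        π.symm x = x := by rw [Equiv.symm_apply_eq, h₂ x hx hxA]
    have hB : B ⊆ B ∪ P.fn ∪ P'.fn ∪ μ.names ∪ Q.fn :=
      fun x hx => .inl (.inl (.inl (.inl hx)))
    refine ⟨π, fun x hx => ⟨hA' hx hB, ?_⟩, fun x hx hxB => hμ' hx hB hxB, fun x hx hxQ => ?_,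
      fun x hx => hfix (.inl (.inr hx)) fun h => hμ x h hx,
      fun x hx => hfix (.inl (.inl (.inr hx))) fun h => hP' x h hx,
      Proc.ren_eq_self fun x hx => h₂ x (.inl (.inl (.inl (.inr hx)))) fun h => hP x h hx⟩
    · rw [Proc.fn_ren]; exact hA' hx Set.subset_union_right
    · rw [Proc.fn_ren]; exact hμ' hx Set.subset_union_right hxQ
  have hQ (π : Equiv.Perm N) : (Q.ren π).ren π.symm = Q := by
    rw [Proc.ren_ren, Proc.ren_eq_self]; simp
  cases μ with
  | tau =>
    obtain ⟨π, h₁, -, -, -, h₅, h₆⟩ := key ∅ Set.finite_empty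
    obtain ⟨Q', hs, e⟩ := H (Q.ren π) (h₆ ▸ hS π h) fun x hx => (h₁ x hx).2
    have hs' := hs.ren π.symm
    have e' := hS π.symm e
    rw [hQ] at hs'
    rw [Proc.ren_eq_self h₅] at e'
    exact ⟨_, hs', e'⟩
  | act ns p =>
    intro hns σ hσ hσns _
    obtain ⟨π, h₁, h₂, h₃, h₄, h₅, h₆⟩ := key σ.fn σ.fn_finite
    have hns' {x : N} (hx : x ∈ ns) : x ∈ (Label.act ns p).names := .inl (.inl hx)
    obtain ⟨q, ρ, Q', hc, hs, e⟩ := H (Q.ren π) (h₆ ▸ hS π h) (fun x hx => (h₁ x hx).2)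
      (fun x hx => h₃ x (hns' hx) (hns x hx)) (σ.act 1 π)
      (by rw [IsMatch, Sub.dom_act, hσ]; exact (Set.image_id _).symm)
      (fun x hx => by rw [Sub.fn_act]; exact h₂ x (hns' hx) (hσns x hx))
      (fun x hx => by rw [Sub.fn_act]; exact (h₁ x hx).1)
    have hs' := hs.ren π.symm
    have e' := hS π.symm e
    have hc' := hc.map π.symm 1 π.symm
    have hππ : (π.symm : N → N) ∘ π = fun x => x := funext π.symm_apply_apply
    have hp : p.map π.symm (1 : Equiv.Perm N) = p :=
      (Pat.map_congr (fun x hx => h₄ x (.inr hx)) fun _ _ => rfl).trans p.map_id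
    rw [Sub.act_act, hππ, mul_one, Sub.act_id, hp] at hc'
    rw [hQ, Label.ren, map_perm_eq_self fun x hx => h₄ x (hns' hx)] at hs'
    rw [Sub.ren_onProc π.symm ρ] at e'
    refine ⟨_, _, _, hc', hs', ?_⟩
    convert e' using 1
    simp only [Sub.onProc, Proc.ren, Proc.subst_comp]
    refine Proc.subst_congr fun x hx => ?_
    rw [← CPat.map_eq_bind]
    by_cases hx' : x ∈ σ.dom
    · have := Sub.app_act 1 π hx'
      rw [Equiv.Perm.one_apply] at this
      rw [this, CPat.map_eq_bind, CPat.map_eq_bind, CPat.bind_comp]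
      simp only [CPat.bind, Equiv.symm_apply_apply, CPat.bind_name]
    · rw [Sub.app_of_notMem hx', Sub.app_of_notMem, CPat.map, h₅ x hx]
      rw [Sub.dom_act]
      rintro ⟨y, hy, rfl⟩; exact hx' hy

/-- The binding names of a reply can be chosen fresh. -/
theorem Compat.fresh_reply [Infinite N] {S : Proc N → Proc N → Prop} {p q : Pat N N}
    {σ ρ : Sub N} {ns : Finset N} {X Q Q' : Proc N} (hc : Compat p σ q ρ)
    (hs : Step Q (.act ns q) Q') (e : S X (ρ.onProc Q')) {F : Set N} (hF : F.Finite) :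
    ∃ q ρ Q', Compat p σ q ρ ∧ Step Q (.act ns q) Q' ∧ S X (ρ.onProc Q') ∧ ∀ x ∈ q.bn, x ∉ F := by
  obtain ⟨π, h₁, h₂, h₃⟩ := hs.rename_binders hc.isMatch_right hF
  exact ⟨_, _, _, hc.map_right, h₂, h₃ ▸ e, h₁⟩

/-- The free names of a pattern that are opened in a challenge can be opened in the reply. -/
theorem Compat.mem_vn {p q : Pat N N} {σ ρ : Sub N} (h : Compat p σ q ρ) {x : N}
    (hx : x ∈ p.vn) (hx' : x ∉ p.pn) : x ∈ q.vn ∧ x ∉ q.pn := by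
  have h₁ : x ∉ q.pn := fun h' => hx' (h.pn_subset h')
  have h₂ : x ∈ q.fn := h.fn_eq ▸ .inl hx
  exact ⟨h₂.resolve_right h₁, h₁⟩

namespace CongClosure

variable {R : Proc N → Proc N → Prop}

theorem reply_base [Infinite N] (hR : IsBisimulation R) {P P' Q : Proc N} {μ : Label N}
    (h : R P Q) (hs : Step P μ P') : Reply (CongClosure R) ∅ P' Q μ := by
  cases μ with
  | tau =>
    obtain ⟨Q', h₁, h₂⟩ := (hR.2 P Q h).1 P' hs
    exact ⟨Q', h₁, .base h₂⟩
  | act ns p =>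
    intro hns σ hσ hσns _
    obtain ⟨π, h₁, h₂, h₃⟩ := hs.rename_binders hσ Q.fn_finite
    obtain ⟨q, ρ, Q', -, hc, hs', e⟩ := (hR.2 P Q h).2 _ _ _ h₂
      (Set.disjoint_left.2 fun x hx => hx.elim (h₁ x) (hns x)) _ (hσ.map id π)
      (by rw [Sub.fn_act, Set.image_id]; exact Set.disjoint_right.2 hσns)
    exact ⟨q, ρ, Q', hc.of_map_left, hs', .base (h₃ ▸ e)⟩

/-- The congruence closure of a bisimulation that is closed under substitutions is again a
bisimulation. -/
theorem reply [Infinite N] (hR : IsBisimulation R) (hsub : SubstClosed R) {P P' : Proc N}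
    {μ : Label N} (h : Step P μ P') {Q : Proc N} (hPQ : CongClosure R P Q) :
    Reply (CongClosure R) ∅ P' Q μ := by
  have hS {P Q : Proc N} (f : N → N) (h : CongClosure R P Q) :
      CongClosure R (P.ren f) (Q.ren f) := h.ren hsub f
  have hfn (P Q : Proc N) (x : N) : x ∉ (P.par Q).fn ↔ x ∉ P.fn ∧ x ∉ Q.fn := not_or
  have hself {σ : Sub N} {p : Pat N N} (hm : IsMatch p σ) {Q : Proc N}
      (hd : ∀ x ∈ p.bn, x ∉ Q.fn) : σ.onProc Q = Q :=
    Sub.onProc_eq_self (by rw [← hm]; exact Set.disjoint_left.2 hd)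
  induction h generalizing Q with
  | case p P hp =>
    rcases hPQ.pre_inv with h | ⟨p₁, P₁, Q₁, hp₁, e, rfl, h⟩
    · exact reply_base hR h (.case p P hp)
    intro _ σ hσ _ _
    obtain ⟨π, h₁, h₂, h₃⟩ := (Step.case p P hp).rename_binders hσ (Proc.pre p₁ Q₁).fn_finite
    obtain ⟨q, hq, he, e'⟩ := h₂.pre_inv
    cases he
    obtain ⟨f, hf₁, -, hf₂⟩ := Proc.pre_eq_pre hp₁ hq (e.symm.trans e')
    refine ⟨p.map id π, σ.act π id, Q₁.ren f, (Compat.refl hq (hσ.map id π)).of_map_left, ?_, ?_⟩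
    · rw [hf₂ Q₁ (Set.disjoint_left.2 h₁)]; exact .case _ _ hq
    · rw [← h₃, hf₁]; exact (hS f h).subst hsub _
  | @resnon P P' μ n hs hn ih =>
    refine reply_of_fresh (A := {n}) (P := Proc.new n P) hS (Set.finite_singleton n) ?_ ?_ ?_ ?_ hPQ
    · rintro _ rfl; rw [Proc.fn_new]; exact fun h => h.2 rfl
    · rintro _ rfl; rw [Proc.fn_new]; exact fun h => h.2 rfl
    · rintro _ rfl; exact hn
    clear hPQ Q
    intro Q hPQ hQ
    have hnQ := hQ n rfl
    rcases hPQ.new_inv hsub hnQ with h | ⟨Q, rfl, h⟩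
    · have := reply_base hR h (.resnon n hs hn)
      cases μ with
      | tau => exact this
      | act ns p => exact fun a σ b c _ => this a σ b c (by simp)
    have := ih h
    cases μ with
    | tau =>
      obtain ⟨Q', h₁, h₂⟩ := this
      exact ⟨_, .resnon n h₁ hn, .new n h₂⟩
    | act ns p =>
      simp only [Label.names, Set.mem_union, not_or, Finset.mem_coe] at hn
      intro hns σ hσ hσns hσn
      obtain ⟨q, ρ, Q', hc, hs', e⟩ := this (fun x hx => Proc.notMem_fn_of_new (hns x hx)
        (ne_of_mem_of_not_mem hx hn.1.1)) σ hσ hσns (by simp)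
      obtain ⟨q, ρ, Q', hc, hs', e, hq⟩ := hc.fresh_reply hs' e (Set.finite_singleton n)
      have hnq : n ∉ q.bn := fun h => hq n h rfl
      refine ⟨q, ρ, _, hc, .resnon n hs' ?_, ?_⟩
      · simp only [Label.names, Set.mem_union, not_or, Finset.mem_coe, hc.fn_eq]
        exact ⟨⟨hn.1.1, hnq⟩, hn.2⟩
      · have hσn' := hσn n rfl
        rw [Sub.onProc_new (by rw [← hσ]; exact hn.1.2) hσn',
          Sub.onProc_new (by rw [← hc.isMatch_right]; exact hnq)
            fun h => hσn' (hc.fn_subset hs.actionNames.wellFormed h)]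
        exact .new n e
  | @unify P P' Q₀ Q₀' ms ns p q σ ρ l h₁ h₂ hu hms hns hd hl hl' ih₁ ih₂ =>
    have hmem {x : N} : x ∈ l ↔ x ∈ ms ∨ x ∈ ns := by
      rw [← List.mem_toFinset, hl', Finset.mem_union]
    rw [Set.disjoint_left] at hms hns
    rw [Finset.disjoint_left] at hd
    refine reply_of_fresh (A := {x | x ∈ l}) (P := P.par Q₀) hS (List.finite_toSet l) ?_ ?_ ?_ ?_
      hPQ
    · intro x hx
      rw [hfn]
      rcases hmem.1 hx with hx | hx
      · exact ⟨h₁.actionNames.ns_fresh x hx, hms hx⟩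
      · exact ⟨hns hx, h₂.actionNames.ns_fresh x hx⟩
    · exact fun x hx h => (Proc.mem_fn_news.1 h).2 hx
    · exact fun x _ h => h
    clear hPQ Q
    intro Q hPQ hQ
    rcases hPQ.par_inv with h | ⟨Q₁, Q₂, rfl, e₁, e₂⟩
    · exact reply_base hR h (.unify l h₁ h₂ hu (Set.disjoint_left.2 hms) (Set.disjoint_left.2 hns)
        (Finset.disjoint_left.2 hd) hl hl')
    have hQ' {x : N} (hx : x ∈ ms ∨ x ∈ ns) : x ∉ Q₁.fn ∧ x ∉ Q₂.fn :=
      (hfn _ _ _).1 (hQ x (hmem.2 hx))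
    -- A name restricted in one of the two actions is not a name of the other.
    have hσ : ∀ x ∈ ms, x ∉ σ.fn := fun x hx h =>
      (h₂.actionNames.fn_label x (.inl (hu.fn_left h))).elim (hms hx) (hd hx)
    have hρ : ∀ x ∈ ns, x ∉ ρ.fn := fun x hx h =>
      (h₁.actionNames.fn_label x (.inl (hu.fn_right h))).elim (hns hx) fun h => hd h hx
    obtain ⟨p', σ', P'', c₁, s₁, e₁⟩ := ih₁ e₁ (fun x hx => (hQ' (.inl hx)).1) σ
      hu.isMatch_left hσ (by simp)
    obtain ⟨q', ρ', Q'', c₂, s₂, e₂⟩ := ih₂ e₂ (fun x hx => (hQ' (.inr hx)).2) ρ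
      hu.isMatch_right hρ (by simp)
    have hu' := (c₂.unify h₂.actionNames.wellFormed
      (c₁.unify h₁.actionNames.wellFormed hu).symm).symm
    exact ⟨_, .unify l s₁ s₂ hu' (Set.disjoint_left.2 fun x hx => (hQ' (.inl hx)).2)
      (Set.disjoint_left.2 fun x hx => (hQ' (.inr hx)).1) (Finset.disjoint_left.2 hd) hl hl',
      .news l (.par e₁ e₂)⟩
  | parint_left X hs ih =>
    rcases hPQ.par_inv with h | ⟨Q₁, Q₂, rfl, e₁, e₂⟩
    · exact reply_base hR h (.parint_left X hs)
    obtain ⟨Q', s, e⟩ := ih e₁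
    exact ⟨_, .parint_left _ s, .par e e₂⟩
  | parint_right X hs ih =>
    rcases hPQ.par_inv with h | ⟨Q₁, Q₂, rfl, e₁, e₂⟩
    · exact reply_base hR h (.parint_right X hs)
    obtain ⟨Q', s, e⟩ := ih e₂
    exact ⟨_, .parint_right _ s, .par e₁ e⟩
  | @parext_left P P' ns p X hs hd ih =>
    rcases hPQ.par_inv with h | ⟨Q₁, Q₂, rfl, e₁, e₂⟩
    · exact reply_base hR h (.parext_left X hs hd)
    intro hns σ hσ hσns _
    simp only [hfn] at hns
    obtain ⟨q, ρ, Q', hc, hs', e⟩ := ih e₁ (fun x hx => (hns x hx).1) σ hσ hσns (by simp)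
    obtain ⟨q, ρ, Q', hc, hs', e, hq⟩ := hc.fresh_reply hs' e Q₂.fn_finite
    refine ⟨q, ρ, _, hc, .parext_left Q₂ hs' (Set.disjoint_left.2 fun x hx =>
      hx.elim (fun h => (hns x h).2) (hq x)), ?_⟩
    have := e.par e₂
    rw [← hself hσ fun x hx => Set.disjoint_left.1 hd (.inr hx),
      ← hself hc.isMatch_right hq] at this
    exact this
  | @parext_right P P' ns p X hs hd ih =>
    rcases hPQ.par_inv with h | ⟨Q₁, Q₂, rfl, e₁, e₂⟩
    · exact reply_base hR h (.parext_right X hs hd)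
    intro hns σ hσ hσns _
    simp only [hfn] at hns
    obtain ⟨q, ρ, Q', hc, hs', e⟩ := ih e₂ (fun x hx => (hns x hx).2) σ hσ hσns (by simp)
    obtain ⟨q, ρ, Q', hc, hs', e, hq⟩ := hc.fresh_reply hs' e Q₁.fn_finite
    refine ⟨q, ρ, _, hc, .parext_right Q₁ hs' (Set.disjoint_left.2 fun x hx =>
      hx.elim (fun h => (hns x h).1) (hq x)), ?_⟩
    have := e₁.par e
    rw [← hself hσ fun x hx => Set.disjoint_left.1 hd (.inr hx),
      ← hself hc.isMatch_right hq] at this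
    exact this
  | @rep P P' μ hs ih =>
    rcases hPQ.rep_inv with h | ⟨Q, rfl, h⟩
    · exact reply_base hR h (.rep hs)
    have := ih (.par (.rep h) h)
    cases μ with
    | tau => exact this.imp fun _ h => ⟨.rep h.1, h.2⟩
    | act ns p =>
      intro hns σ hσ hσns hA
      obtain ⟨q, ρ, Q', hc, hs', e⟩ := this
        (fun x hx => (hfn _ _ _).2 ⟨hns x hx, hns x hx⟩) σ hσ hσns hA
      exact ⟨q, ρ, Q', hc, .rep hs', e⟩
  | _ =>
    rename_i P P' ns p m hs hm ih
    intro hns σ hσ hσns _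
    have hmQ := hns m (by simp)
    rcases hPQ.new_inv hsub hmQ with h | ⟨Q, rfl, h⟩
    · exact reply_base hR h (.open m hs hm) hns σ hσ hσns (by simp)
    simp only [Set.mem_sdiff, Set.mem_union, not_or, Finset.mem_coe] at hm
    obtain ⟨q, ρ, Q', hc, hs', e⟩ := ih h (fun x hx => Proc.notMem_fn_of_new
      (hns x (by simp [hx])) (ne_of_mem_of_not_mem hx hm.2.1.1)) σ hσ
      (fun x hx => hσns x (by simp [hx])) (by simp)
    obtain ⟨q, ρ, Q', hc, hs', e, hq⟩ := hc.fresh_reply hs' e (Set.finite_singleton m)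
    have := hc.mem_vn hm.1 hm.2.1.2
    refine ⟨q, ρ, Q', hc, .open m hs' ⟨this.1, ?_⟩, e⟩
    simp only [Set.mem_union, not_or, Finset.mem_coe]
    exact ⟨⟨hm.2.1.1, this.2⟩, fun h => hq m h rfl⟩

end CongClosure

/-! ### Transitions, reductions and barbs -/

/-- `ActionForm ns p P P'`: up to structural congruence, `P` is a case with pattern `p` next to
another process, under the restricted names `ns` of the action and further restrictions `zs`,
and `P'` is what remains when the case is consumed. -/
structure ActionForm (ns : Finset N) (p : Pat N N) (P P' : Proc N) (zs : List N)
    (P₁ P₂ : Proc N) : Prop where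
  source (l : List N) : l.Nodup → l.toFinset = ns →
    Struct P (Proc.news l (Proc.news zs ((Proc.pre p P₁).par P₂)))
  target : Struct P' (Proc.news zs (P₁.par P₂))
  zs_fresh : ∀ x ∈ zs, x ∉ (Label.act ns p).names
  bn_fresh : ∀ x ∈ p.bn, x ∉ P₂.fn

/-- The inner restrictions of an `ActionForm` can be chosen fresh. -/
theorem ActionForm.fresh [Infinite N] {ns : Finset N} {p : Pat N N} {P P' P₁ P₂ : Proc N}
    {zs : List N} (h : ActionForm ns p P P' zs P₁ P₂) {F : Set N} (hF : F.Finite) :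
    ∃ zs P₁ P₂, ActionForm ns p P P' zs P₁ P₂ ∧ ∀ x ∈ zs, x ∉ F := by
  obtain ⟨π, h₁, h₂⟩ := exists_fresh_perm (List.finite_toSet zs)
    ((((hF.union ((Proc.pre p P₁).par P₂).fn_finite)).union (P₁.par P₂).fn_finite).union
      (Label.act ns p).names_finite)
  have hp : p.map π π = p := (Pat.map_congr
    (fun x hx => h₂ x (.inr (.inr hx)) fun h' => h.zs_fresh x h' (.inr hx))
    fun x hx => h₂ x (.inr (.inl (.inr hx))) fun h' => h.zs_fresh x h' (.inl (.inr hx))).trans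
      p.map_id
  have e₁ : Proc.news zs ((Proc.pre p P₁).par P₂) =
      Proc.news (zs.map π) ((Proc.pre p (P₁.ren π)).par (P₂.ren π)) := by
    rw [Proc.news_eq_ren (π := π) fun x hx hz => h₂ x (.inl (.inl (.inr hx))) hz]
    congr 1
    change ((Proc.pre p P₁).ren π).par _ = _
    rw [Proc.ren_pre, hp]
    rfl
  have e₂ : Proc.news zs (P₁.par P₂) = Proc.news (zs.map π) ((P₁.ren π).par (P₂.ren π)) :=
    Proc.news_eq_ren fun x hx hz => h₂ x (.inl (.inr hx)) hz
  have hz {x : N} (hx : x ∈ zs.map π) : x ∉ F ∧ x ∉ (Label.act ns p).names := by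
    obtain ⟨y, hy, rfl⟩ := List.mem_map.1 hx
    have := (h₁ y hy).1
    simp only [Set.mem_union, not_or] at this
    exact ⟨this.1.1.1, this.2⟩
  refine ⟨zs.map π, P₁.ren π, P₂.ren π, ⟨fun l hl hl' => e₁ ▸ h.source l hl hl', e₂ ▸ h.target,
    fun x hx => (hz hx).2, ?_⟩, fun x hx => (hz hx).1⟩
  intro x hx hx'
  rw [Proc.fn_ren] at hx'
  obtain ⟨y, hy, rfl⟩ := hx'
  rw [← hp, Pat.bn_map] at hx
  obtain ⟨w, hw, e⟩ := hx
  exact h.bn_fresh w hw (π.injective e ▸ hy)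

theorem Proc.news_append (l l' : List N) (P : Proc N) :
    news (l ++ l') P = news l (news l' P) := by
  simp [news, List.foldr_append]

theorem Step.actionForm [Infinite N] {P P' : Proc N} {ns : Finset N} {p : Pat N N}
    (h : Step P (.act ns p) P') : ∃ zs P₁ P₂, ActionForm ns p P P' zs P₁ P₂ := by
  generalize hμ : Label.act ns p = μ at h
  have hpar {P P' Q : Proc N} {ns : Finset N} {p : Pat N N} (hd : Disjoint (↑ns ∪ p.bn) Q.fn)
      (h : ∃ zs P₁ P₂, ActionForm ns p P P' zs P₁ P₂) :
      ∃ zs P₁ P₂, ActionForm ns p (P.par Q) (P'.par Q) zs P₁ P₂ := by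
    obtain ⟨zs, P₁, P₂, h⟩ := h
    obtain ⟨zs, P₁, P₂, h, hz⟩ := h.fresh Q.fn_finite
    rw [Set.disjoint_left] at hd
    refine ⟨zs, P₁, P₂.par Q, ⟨fun l hl hl' => ?_, ?_, h.zs_fresh, fun x hx =>
      not_or.2 ⟨h.bn_fresh x hx, hd (.inr hx)⟩⟩⟩
    · refine (Struct.par_congr (h.source l hl hl') (.refl Q)).trans ((Struct.scope_news' ?_ _).trans
        (.news_congr l ((Struct.scope_news' hz _).trans (.news_congr zs
          (.symm (.par_assoc _ _ _))))))
      intro x hx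
      exact hd (.inl (by rw [← hl']; simpa using hx))
    · exact (Struct.par_congr h.target (.refl Q)).trans ((Struct.scope_news' hz _).trans
        (.news_congr zs (.symm (.par_assoc _ _ _))))
  have hcomm {P P' Q Q' : Proc N} {ns : Finset N} {p : Pat N N} (e : Struct P Q)
      (e' : Struct P' Q') (h : ∃ zs P₁ P₂, ActionForm ns p P P' zs P₁ P₂) :
      ∃ zs P₁ P₂, ActionForm ns p Q Q' zs P₁ P₂ := by
    obtain ⟨zs, P₁, P₂, h⟩ := h
    exact ⟨zs, P₁, P₂, ⟨fun l hl hl' => e.symm.trans (h.source l hl hl'), e'.symm.trans h.target,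
      h.zs_fresh, h.bn_fresh⟩⟩
  induction h generalizing ns p with
  | case q P hq =>
    cases hμ
    refine ⟨[], P, .zero, ⟨fun l _ hl => ?_, (Struct.par_zero P).symm, by simp, fun x _ h => h⟩⟩
    rw [(List.toFinset_eq_empty_iff l).1 hl]
    exact (Struct.par_zero _).symm
  | resnon n _ hn ih =>
    subst hμ
    obtain ⟨zs, P₁, P₂, h⟩ := ih rfl
    refine ⟨n :: zs, P₁, P₂, ⟨fun l hl hl' => ?_, .new_congr n h.target, ?_, h.bn_fresh⟩⟩
    · exact (Struct.new_congr n (h.source l hl hl')).trans (Struct.news_new l n _).symm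
    · rw [List.forall_mem_cons]; exact ⟨hn, h.zs_fresh⟩
  | parext_left Q _ hd ih => cases hμ; exact hpar hd (ih rfl)
  | parext_right Q _ hd ih =>
    cases hμ; exact hcomm (.par_comm _ _) (.par_comm _ _) (hpar hd (ih rfl))
  | rep _ ih =>
    exact hcomm ((Struct.par_comm _ _).trans (.symm (.rep_unfold _))) (.refl _) (ih hμ)
  | unify => cases hμ
  | parint_left => cases hμ
  | parint_right => cases hμ
  | _ =>
    rename_i P P' ns p m hs hm ih
    cases hμ
    obtain ⟨zs, P₁, P₂, h⟩ := ih rfl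
    have hmn : m ∉ ns := fun h => hm.2 (.inl (.inl h))
    obtain ⟨zs, P₁, P₂, h, hz⟩ := h.fresh (Set.finite_singleton m)
    refine ⟨zs, P₁, P₂, ⟨fun l hl hl' => ?_, h.target, fun x hx => ?_, h.bn_fresh⟩⟩
    · have hml : m ∈ l := by rw [← List.mem_toFinset, hl']; simp
      refine (Struct.new_congr m (h.source (l.erase m) (hl.erase m) ?_)).trans
        (Struct.news_perm (List.perm_cons_erase hml).symm _)
      ext x
      have := Finset.ext_iff.1 hl' x
      rw [List.mem_toFinset, Finset.mem_insert] at this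
      rw [List.mem_toFinset, hl.mem_erase_iff, this]
      constructor
      · tauto
      · exact fun h => ⟨ne_of_mem_of_not_mem h hmn, .inr h⟩
    · have h₁ := h.zs_fresh x hx
      have h₂ : x ≠ m := hz x hx
      simp only [Label.names, Set.mem_union, Finset.coe_insert, Set.mem_insert_iff, not_or] at h₁ ⊢
      tauto

theorem Red.news (l : List N) {P Q : Proc N} (h : Red P Q) :
    Red (Proc.news l P) (Proc.news l Q) := by
  induction l with
  | nil => exact h
  | cons x l ih => exact .new x ih

theorem Struct.par_par_comm (P Q R S : Proc N) :
    Struct ((P.par Q).par (R.par S)) ((P.par R).par (Q.par S)) :=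
  (par_assoc _ _ _).trans <| .trans
    (.par_congr ((Struct.symm (par_assoc _ _ _)).trans
      ((Struct.par_congr (.refl P) (par_comm Q R)).trans (par_assoc _ _ _))) (.refl S)) <|
    .symm (par_assoc _ _ _)

/-- Every `τ`-transition is a reduction. -/
theorem Step.red [Infinite N] {P P' : Proc N} (h : Step P .tau P') : Red P P' := by
  generalize hμ : Label.tau = μ at h
  induction h with
  | @unify P P' Q Q' ms ns p q σ ρ l hP hQ hu h₁ h₂ h₃ hl hl' =>
    have hwp := hP.actionNames.wellFormed
    have hwq := hQ.actionNames.wellFormed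
    have nP := hP.actionNames
    have nQ := hQ.actionNames
    rw [Set.disjoint_left] at h₁ h₂
    rw [Finset.disjoint_left] at h₃
    obtain ⟨zs, P₁, P₂, fP⟩ := hP.actionForm
    obtain ⟨zs, P₁, P₂, fP, hz⟩ := fP.fresh
      (((Q.fn_finite.union ns.finite_toSet).union σ.fn_finite).union ρ.fn_finite)
    obtain ⟨ws, Q₁, Q₂, fQ⟩ := hQ.actionForm
    obtain ⟨ws, Q₁, Q₂, fQ, hw⟩ := fQ.fresh
      ((((Proc.pre p P₁).par P₂).fn_finite.union σ.fn_finite).union ρ.fn_finite)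
    simp only [Set.mem_union, not_or, Finset.mem_coe] at hz hw
    have eP := fP.source ms.toList ms.nodup_toList ms.toList_toFinset
    have eQ := fQ.source ns.toList ns.nodup_toList ns.toList_toFinset
    set A := (Proc.pre p P₁).par P₂ with hA
    set B := (Proc.pre q Q₁).par Q₂ with hB
    -- The free names of the bodies are free in the processes or restricted in the labels.
    have fnA {x : N} (h : x ∈ (Proc.news zs A).fn) : x ∈ P.fn ∨ x ∈ ms := by
      rw [or_iff_not_imp_right]
      intro h'
      rw [eP.fn_eq, Proc.mem_fn_news]
      exact ⟨h, by simpa using h'⟩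
    have fnB {x : N} (h : x ∈ (Proc.news ws B).fn) : x ∈ Q.fn ∨ x ∈ ns := by
      rw [or_iff_not_imp_right]
      intro h'
      rw [eQ.fn_eq, Proc.mem_fn_news]
      exact ⟨h, by simpa using h'⟩
    have e₁ : Struct (P.par Q)
        (Proc.news l (Proc.news zs (Proc.news ws (A.par B)))) := by
      refine (Struct.par_congr eP (.refl Q)).trans ((Struct.scope_news' ?_ _).trans ?_)
      · intro x hx; exact h₁ (by simpa using hx)
      refine (Struct.news_congr _ ((Struct.par_congr (.refl _) eQ).trans
        (Struct.scope_news ?_ _))).trans ?_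
      · intro x hx h
        rw [Finset.mem_toList] at hx
        exact (fnA h).elim (h₂ hx) fun h => h₃ h hx
      rw [← Proc.news_append]
      refine (Struct.news_perm (List.perm_of_nodup_nodup_toFinset_eq ?_ hl ?_) _).trans
        (.news_congr l ((Struct.scope_news' ?_ _).trans (.news_congr zs (Struct.scope_news ?_ _))))
      · rw [List.nodup_append]
        refine ⟨ms.nodup_toList, ns.nodup_toList, ?_⟩
        rintro x hx y hy rfl
        exact h₃ (Finset.mem_toList.1 hx) (Finset.mem_toList.1 hy)
      · rw [hl', List.toFinset_append, Finset.toList_toFinset, Finset.toList_toFinset]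
      · exact fun x hx h => (fnB h).elim (hz x hx).1.1.1 (hz x hx).1.1.2
      · exact fun x hx => (hw x hx).1.1
    have e₂ : Red (A.par B)
        (((σ.onProc P₁).par P₂).par ((ρ.onProc Q₁).par Q₂)) :=
      .struct (.par_par_comm _ _ _ _) (.par _ (.comm P₁ Q₁ hwp hwq hu)) (.par_par_comm _ _ _ _)
    have inst {p : Pat N N} {σ : Sub N} {ns : Finset N} {zs : List N} {P P' P₁ P₂ : Proc N}
        (hm : IsMatch p σ) (f : ActionForm ns p P P' zs P₁ P₂) (hz : ∀ x ∈ zs, x ∉ σ.fn) :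
        Struct (σ.onProc P') (Proc.news zs ((σ.onProc P₁).par P₂)) := by
      refine (f.target.onProc σ).trans ?_
      rw [Sub.onProc_news (fun x hx h => f.zs_fresh x hx (.inl (.inr (hm ▸ h)))) hz]
      have : σ.onProc (P₁.par P₂) = (σ.onProc P₁).par (σ.onProc P₂) := rfl
      rw [this, Sub.onProc_eq_self (P := P₂) (by
        rw [← hm]; exact Set.disjoint_left.2 f.bn_fresh)]
      exact .refl _
    have fnS {p : Pat N N} {σ : Sub N} {P₁ P₂ : Proc N} (hm : IsMatch p σ) {x : N}
        (hx : x ∉ ((Proc.pre p P₁).par P₂).fn) (hσ : x ∉ σ.fn) :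
        x ∉ ((σ.onProc P₁).par P₂).fn := by
      simp only [Proc.fn, Proc.fn_pre, Set.mem_union, not_or] at hx ⊢
      refine ⟨fun h => (Sub.fn_onProc_subset h).elim hσ fun h => hx.1.2 ?_, hx.2⟩
      rwa [← hm] at h
    have e₃ : Struct (Proc.news zs (Proc.news ws
        (((σ.onProc P₁).par P₂).par ((ρ.onProc Q₁).par Q₂))))
        ((σ.onProc P').par (ρ.onProc Q')) := by
      refine .trans (.symm ((Struct.scope_news' ?_ _).trans (.news_congr zs
        (Struct.scope_news ?_ _)))) (.symm (.par_congr
          (inst hu.isMatch_left fP fun x hx => (hz x hx).1.2)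
          (inst hu.isMatch_right fQ fun x hx => (hw x hx).2)))
      · intro x hx h
        rw [Proc.mem_fn_news] at h
        refine fnS hu.isMatch_right (fun h' => ?_) (hz x hx).2 h.1
        exact (fnB (Proc.mem_fn_news.2 ⟨h', h.2⟩)).elim (hz x hx).1.1.1 (hz x hx).1.1.2
      · exact fun x hx => fnS hu.isMatch_left (hw x hx).1.1 (hw x hx).1.2
    exact .struct e₁ ((Red.news _ (Red.news _ (Red.news _ e₂)))) (.news_congr l e₃)
  | parint_left Q _ ih => exact .par Q (ih hμ)
  | parint_right P _ ih =>
    exact .struct (.par_comm _ _) (.par P (ih hμ)) (.par_comm _ _)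
  | resnon n _ _ ih => exact .new n (ih hμ)
  | rep _ ih => exact .struct ((Struct.rep_unfold _).trans (.par_comm _ _)) (ih hμ) (.refl _)
  | _ => cases hμ

/-- Every reduction is a `τ`-transition up to structural congruence. -/
theorem Red.step [Infinite N] {P P' : Proc N} (h : Red P P') :
    ∃ P'', Step P .tau P'' ∧ Struct P'' P' := by
  induction h with
  | comm P Q hp hq hu =>
    exact ⟨_, .unify [] (.case _ P hp) (.case _ Q hq) hu (by simp) (by simp) (by simp) (by simp)
      (by simp), .refl _⟩
  | par Q _ ih =>
    obtain ⟨P'', s, e⟩ := ih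
    exact ⟨_, .parint_left Q s, .par_congr e (.refl Q)⟩
  | new n _ ih =>
    obtain ⟨P'', s, e⟩ := ih
    exact ⟨_, .resnon n s (Set.notMem_empty n), .new_congr n e⟩
  | struct e₁ _ e₂ ih =>
    obtain ⟨Q'', s, e⟩ := ih
    obtain ⟨P'', s', e'⟩ := e₁.sim.2 _ _ s
    exact ⟨P'', s', e'.symm.trans (e.trans e₂)⟩

/-- Actions give rise to barbs. -/
theorem Step.barb [Infinite N] {P P' : Proc N} {ns : Finset N} {p : Pat N N}
    (h : Step P (.act ns p) P') : Barb P (p.fn \ ↑ns) := by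
  have hn := h.actionNames
  obtain ⟨zs, P₁, P₂, f⟩ := h.actionForm
  have hz {x : N} (hx : x ∈ zs) : x ∉ p.fn := fun h => f.zs_fresh x hx (.inr h)
  refine ⟨ns.toList ++ zs, p, P₁, P₂, hn.wellFormed, ?_, ?_, ?_⟩
  · rw [Proc.news_append]; exact f.source _ ns.nodup_toList ns.toList_toFinset
  · rw [Set.disjoint_right]
    intro x hx
    rcases List.mem_append.1 hx with hx | hx
    · exact hn.ns_pn x (Finset.mem_toList.1 hx)
    · exact fun h => hz hx (.inr h)
  · ext x
    simp only [Set.mem_sdiff, Finset.mem_coe, Set.mem_ofPred_eq, List.mem_append,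
      Finset.mem_toList]
    have := @hz x
    tauto

/-- An action without restricted names is available under restrictions of names that are neither
protected nor binding in its pattern; the names that occur in the pattern are opened. -/
theorem Step.news_action [Infinite N] {P P' : Proc N} {p : Pat N N} (h : Step P (.act ∅ p) P')
    {l : List N} (hp : ∀ x ∈ l, x ∉ p.pn) (hb : ∀ x ∈ l, x ∉ p.bn) :
    ∃ (ns : Finset N) (P'' : Proc N), Step (Proc.news l P) (.act ns p) P'' ∧ (∀ x ∈ ns, x ∈ l) ∧
      ∀ x ∈ p.fn, x ∈ l → x ∈ ns := by
  induction l with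
  | nil => exact ⟨∅, P', h, by simp, by simp⟩
  | cons n l ih =>
    rw [List.forall_mem_cons] at hp hb
    obtain ⟨ns, P'', hs, h₁, h₂⟩ := ih hp.2 hb.2
    by_cases hn : n ∈ ns
    · -- The name is already opened, so the outer restriction binds nothing.
      have hnP := hs.actionNames.ns_fresh n hn
      obtain ⟨z, hz⟩ := ((Proc.news l P).fn_finite.union
        (Label.act ns p).names_finite).exists_notMem
      rw [Set.mem_union, not_or] at hz
      refine ⟨ns, Proc.new z P'', ?_, fun x hx => .tail _ (h₁ x hx), ?_⟩
      · change Step (Proc.new n (Proc.news l P)) _ _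
        rw [Proc.new_eq_ren (z := z) (by rw [Proc.fn_new]; exact fun h => hz.1 h.1),
          Proc.ren_eq_self fun x hx => Equiv.swap_apply_of_ne_of_ne
            (ne_of_mem_of_not_mem hx hnP) (ne_of_mem_of_not_mem hx hz.1)]
        exact .resnon z hs hz.2
      · rintro x hx (_ | ⟨_, hxl⟩)
        · exact hn
        · exact h₂ x hx hxl
    by_cases hnp : n ∈ p.fn
    · refine ⟨insert n ns, P'', .open n hs ⟨hnp.resolve_right hp.1, ?_⟩, ?_, ?_⟩
      · rintro ((h | h) | h)
        · exact hn h
        · exact hp.1 h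
        · exact hb.1 h
      · simp only [Finset.mem_insert, List.mem_cons]
        exact fun x hx => hx.imp_right (h₁ x)
      · simp only [Finset.mem_insert, List.mem_cons]
        exact fun x hx hxl => hxl.imp_right (h₂ x hx)
    · refine ⟨ns, _, .resnon n hs ?_, fun x hx => .tail _ (h₁ x hx), ?_⟩
      · rintro ((h | h) | h)
        · exact hn h
        · exact hb.1 h
        · exact hnp h
      · rintro x hx (_ | ⟨_, hxl⟩)
        · exact absurd hx hnp
        · exact h₂ x hx hxl

theorem exists_match (p : Pat N N) : ∃ σ : Sub N, IsMatch p σ ∧ σ.fn ⊆ p.bn := by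
  refine ⟨Sub.ofFun p.binders.toFinset CPat.name, ?_, ?_⟩
  · rw [IsMatch, Sub.dom_ofFun]; ext; simp [Pat.bn]
  · intro y hy
    obtain ⟨x, hx, h⟩ := Sub.fn_ofFun_subset _ _ hy
    cases h
    exact List.mem_toFinset.1 hx

/-- Barbs give rise to actions whose restricted names are fresh. -/
theorem Barb.exists_step [Infinite N] {P : Proc N} {ms : Set N} (h : Barb P ms) {F : Set N}
    (hF : F.Finite) : ∃ (ns : Finset N) (p : Pat N N) (P' : Proc N), Step P (.act ns p) P' ∧
      (∀ x ∈ ns, x ∉ F) ∧ ms = p.fn \ ↑ns := by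
  obtain ⟨l, p, P₁, P₂, hp, e, hd, rfl⟩ := h
  rw [Set.disjoint_left] at hd
  obtain ⟨π, h₁, h₂⟩ := exists_fresh_perm (List.finite_toSet l)
    ((hF.union ((Proc.pre p P₁).par P₂).fn_finite).union p.fn_finite)
  have hX : Proc.news l ((Proc.pre p P₁).par P₂) =
      Proc.news (l.map π) ((Proc.pre (p.map π π) (P₁.ren π)).par (P₂.ren π)) := by
    rw [Proc.news_eq_ren (π := π) fun x hx hxl => h₂ x (.inl (.inr hx)) hxl]
    congr 1
    exact congrArg (Proc.par · _) (Proc.ren_pre π p P₁)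
  have hp' : (p.map π π).WellFormed := hp.map ((Set.disjoint_image_iff π.injective).2 hp.2)
  obtain ⟨σ, hσ, -⟩ := exists_match (p.map π π)
  obtain ⟨α, h₃, h₄, -⟩ := (Step.case _ (P₁.ren π) hp').rename_binders hσ
    ((P₂.ren π).fn_finite.union (List.finite_toSet (l.map π)))
  have hs := Step.parext_left (P₂.ren π) h₄ (Set.disjoint_left.2 fun x hx => by
    rcases hx with hx | hx
    · simp at hx
    · exact fun h => h₃ x hx (.inl h))
  have hl {x : N} (hx : x ∈ l.map π) : ∃ y ∈ l, π y = x := List.mem_map.1 hx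
  have epn : ((p.map π π).map id α).pn = π '' p.pn := by
    rw [Pat.pn_map, Set.image_id, Pat.pn_map]
  have efn : ((p.map π π).map id α).fn = π '' p.fn := by
    rw [Pat.fn_map, Set.image_id, Pat.fn_map]
  obtain ⟨ns, P', hs', h₅, h₆⟩ := hs.news_action (l := l.map π) (fun x hx h => by
    obtain ⟨y, hy, rfl⟩ := hl hx
    rw [epn] at h
    obtain ⟨w, hw, hwy⟩ := h
    rw [π.injective hwy] at hw
    exact hd hw hy) (fun x hx h => h₃ x h (.inr hx))
  rw [← hX] at hs'
  obtain ⟨P'', hs'', -⟩ := e.sim.2 _ _ hs'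
  refine ⟨ns, _, P'', hs'', fun x hx hxF => ?_, ?_⟩
  · obtain ⟨y, hy, rfl⟩ := hl (h₅ x hx)
    exact (h₁ y hy).1 (.inl (.inl hxF))
  · rw [efn] at h₆ ⊢
    ext x
    constructor
    · rintro ⟨hx, hxl⟩
      have : π x = x := h₂ x (.inr hx) hxl
      refine ⟨⟨x, hx, this⟩, fun hxn => ?_⟩
      obtain ⟨y, hy, rfl⟩ := hl (h₅ x hxn)
      exact (h₁ y hy).1 (.inr hx)
    · rintro ⟨⟨y, hy, rfl⟩, hyn⟩
      have hyl : y ∉ l := fun h => hyn (h₆ _ ⟨y, hy, rfl⟩ (List.mem_map_of_mem h))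
      rw [h₂ y (.inr hy) hyl]
      exact ⟨hy, hyl⟩

/-! ### Soundness -/

theorem Struct.fill {P Q : Proc N} (h : Struct P Q) (C : Ctx N) :
    Struct (C.fill P) (C.fill Q) := by
  induction C with
  | hole => exact h
  | parLeft C X ih => exact .par_congr ih (.refl X)
  | parRight X C ih => exact .par_congr (.refl X) ih
  | rep C ih => exact .rep_congr ih
  | new x C ih => exact .new_congr x ih
  | pre p hp C ih => exact .pre_congr p hp ih

/-- The reflexive closure of a bisimulation is a bisimulation. -/
theorem IsBisimulation.reflClosure {R : Proc N → Proc N → Prop} (h : IsBisimulation R) :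
    IsBisimulation fun P Q => P = Q ∨ R P Q := by
  refine ⟨fun P Q => Or.imp Eq.symm (h.1 P Q), ?_⟩
  rintro P Q (rfl | hPQ)
  · exact ⟨fun P' hs => ⟨P', hs, .inl rfl⟩, fun ns p P' hs _ σ hσ _ =>
      ⟨p, σ, P', hσ, .refl hs.actionNames.wellFormed hσ, hs, .inl rfl⟩⟩
  · refine ⟨fun P' hs => ?_, fun ns p P' hs hd σ hσ hσd => ?_⟩
    · obtain ⟨Q', h₁, h₂⟩ := (h.2 P Q hPQ).1 P' hs
      exact ⟨Q', h₁, .inr h₂⟩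
    · obtain ⟨q, ρ, Q', h₁, h₂, h₃, h₄⟩ := (h.2 P Q hPQ).2 ns p P' hs hd σ hσ hσd
      exact ⟨q, ρ, Q', h₁, h₂, h₃, .inr h₄⟩

theorem SubstClosed.reflClosure {R : Proc N → Proc N → Prop} (h : SubstClosed R) :
    SubstClosed fun P Q => P = Q ∨ R P Q := by
  rintro P Q (rfl | hPQ) σ
  · exact .inl rfl
  · exact .inr (h P Q hPQ σ)

end CPC

theorem mainTheorem1 {N : Type u} [DecidableEq N] [Infinite N] (P Q : CPC.Proc N)
    (h : CPC.Bisimilar P Q) : CPC.BarbedCongruent P Q := by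
  open CPC in
  obtain ⟨R₀, hR₀, hsub₀, hPQ⟩ := h
  have hR := hR₀.reflClosure
  have hsub := hsub₀.reflClosure
  set R : Proc N → Proc N → Prop := fun P Q => P = Q ∨ R₀ P Q with hRdef
  have hrefl (P : Proc N) : R P P := .inl rfl
  refine ⟨fun P Q => ∃ P₁ Q₁, Struct P P₁ ∧ CongClosure R P₁ Q₁ ∧ Struct Q₁ Q,
    ?_, ?_, ?_, ?_, P, Q, .refl P, .base (.inr hPQ), .refl Q⟩
  · rintro P Q ⟨P₁, Q₁, e₁, h, e₂⟩
    exact ⟨Q₁, P₁, e₂.symm, h.symm hR.1, e₁.symm⟩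
  · rintro P Q ⟨P₁, Q₁, e₁, h, e₂⟩ ms hb
    obtain ⟨ns, p, P', hs, hns, rfl⟩ := hb.exists_step Q₁.fn_finite
    obtain ⟨P₁', hs₁, -⟩ := e₁.sim.1 _ _ hs
    obtain ⟨σ, hσ, hσp⟩ := exists_match p
    obtain ⟨q, ρ, Q', hc, hsQ, -⟩ := CongClosure.reply hR hsub hs₁ h hns σ hσ
      (fun x hx hxσ => hs.actionNames.ns_bn x hx (hσp hxσ)) (by simp)
    obtain ⟨Q'', hs', -⟩ := e₂.sim.1 _ _ hsQ
    rw [← hc.fn_eq]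
    exact hs'.barb
  · rintro P Q ⟨P₁, Q₁, e₁, h, e₂⟩ P' hr
    obtain ⟨P₁', hs, e⟩ := (Red.struct e₁.symm hr (.refl P')).step
    obtain ⟨Q', hsQ, h'⟩ := CongClosure.reply hR hsub hs h
    exact ⟨Q', .struct e₂.symm hsQ.red (.refl Q'), P₁', Q', e.symm, h', .refl Q'⟩
  · rintro P Q ⟨P₁, Q₁, e₁, h, e₂⟩ C
    exact ⟨_, _, e₁.fill C, h.fill hrefl C, e₂.fill C⟩
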